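/- Let $d\in\mathbb N$ and $\tfrac12\le\theta<1$. For $h>0$ let $\mathcal S_{\theta,h}(\mathbb R^d)$ be the Banach space of all $f\in C^\infty(\mathbb R^d;\mathbb C)$ with $$\|f\|_{\theta,h}=\sup_{\alpha,\beta\in\mathbb N^d}\sup_{x\in\mathbb R^d}h^{-|\alpha|-|\beta|}(\alpha!)^{-\theta}(\beta!)^{-\theta}|x^\alpha\partial^\beta f(x)|<\infty ,$$ let $\mathcal S_\theta(\mathbb R^d)=\bigcup_{h>0}\mathcal S_{\theta,h}(\mathbb R^d)$, and let $\mathcal S_\theta'(\mathbb R^d)$ be its dual, that is, the space of all linear forms $u:\mathcal S_\theta(\mathbb R^d)\to\mathbb C$ such that for every $h>0$ there is $K_h$ with $|u(f)|\le K_h\|f\|_{\theta,h}$ for all $f\in\mathcal S_{\theta,h}(\mathbb R^d)$. A function $u\in\mathcal S_\theta(\mathbb R^d)$ is regarded as an element of $\mathcal S_\theta'(\mathbb R^d)$ through $\langle u,f\rangle=\int_{\mathbb R^d}u(y)f(y)\,dy$. An FBI phase is a quadratic form $\varphi(z,y)=\frac12\langle Az,z\rangle+\langle Bz,y\rangle+\frac12\langle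 Cy,y\rangle$ on $\mathbb C^d\times\mathbb R^d$ (with bilinear brackets), where $A,B,C$ are complex $d\times d$ matrices, $A$ and $C$ are symmetric, $\det B\ne0$ and $\operatorname{Im}C$ is positive definite. Put $\Phi(z)=\max_{y\in\mathbb R^d}(-\operatorname{Im}\varphi(z,y))$ and, for $u\in\mathcal S_\theta'(\mathbb R^d)$, $$T_\varphi u(z)=c_\varphi\langle u_y,e^{i\varphi(z,y)}\rangle,\qquad c_\varphi=2^{-d/2}\pi^{-3d/4}(\det\operatorname{Im}C)^{-1/4}|\det B| .$$ Let $\varphi$ be an FBI phase. Then: (1) If $u\in\mathcal S_\theta'(\mathbb R^d)$, then $T_\varphi u$ is an entire analytic function on $\mathbb C^d$, and for every $\varepsilon>0$ there is $C_\varepsilon>0$ such that, for all $\alpha\in\mathbb N^d$ and $z\in\mathbb C^d$, $$|\partial_z^\alpha T_\varphi u(z)|\le C_\varepsilon^{|\alpha|+1}\,\alpha!^{\theta}\,e^{\varepsilon|z|^{1/\theta}+\Phi(z)} .$$ (2) If $u\in\mathcal S_\theta(\mathbb R^d)$, then $T_\varphi u$ is entire analytic and there are $\varepsilon>0$ and $C>0$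 such that, for all $\alpha\in\mathbb N^d$ and $z\in\mathbb C^d$, $$|\partial_z^\alpha T_\varphi u(z)|\le C^{|\alpha|+1}\,\alpha!^{\theta}\,e^{-\varepsilon|z|^{1/\theta}+\Phi(z)} .$$ (3) Conversely, if $U$ is an entire analytic function on $\mathbb C^d$ that satisfies the estimates in (1) (for every $\varepsilon>0$, with some $C_\varepsilon>0$), then there is a unique $u\in\mathcal S_\theta'(\mathbb R^d)$ with $U=T_\varphi u$; if $U$ satisfies the estimate in (2) for some $\varepsilon,C>0$, then there is a unique $u\in\mathcal S_\theta(\mathbb R^d)$ with $U=T_\varphi u$. -/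

import Mathlib

open MeasureTheory
open scoped ContDiff Matrix

noncomputable section

namespace GelfandShilov

/-- The length `|α| = α₁ + ⋯ + α_d` of a multi-index. -/
def mlen {d : ℕ} (α : Fin d → ℕ) : ℕ := ∑ i, α i

/-- The factorial `α! = α₁! ⋯ α_d!` of a multi-index, as a real number. -/
def mfact {d : ℕ} (α : Fin d → ℕ) : ℝ := ∏ i, ((α i).factorial : ℝ)

/-- The monomial `x ^ α = x₁ ^ α₁ ⋯ x_d ^ α_d`. -/
def mpow {d : ℕ} (x : EuclideanSpace ℝ (Fin d)) (α : Fin d → ℕ) : ℝ := ∏ i, x i ^ α i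

section Deriv

variable (𝕜 : Type*) [RCLike 𝕜] [NormedSpace 𝕜 ℂ] {d : ℕ}

/-- The partial derivative in the `i`-th coordinate: a real one on `ℝ ^ d` (`𝕜 = ℝ`), the complex
one `∂ / ∂ z_i` on `ℂ ^ d` (`𝕜 = ℂ`). -/
def pderiv (i : Fin d) (f : EuclideanSpace 𝕜 (Fin d) → ℂ) (x : EuclideanSpace 𝕜 (Fin d)) : ℂ :=
  fderiv 𝕜 f x (EuclideanSpace.single i (1 : 𝕜))

/-- `∂_{i₁} ^ α_{i₁} ∂_{i₂} ^ α_{i₂} ⋯ f` along a list `[i₁, i₂, …]` of coordinates. -/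
def mderivList (l : List (Fin d)) (α : Fin d → ℕ) (f : EuclideanSpace 𝕜 (Fin d) → ℂ) :
    EuclideanSpace 𝕜 (Fin d) → ℂ :=
  l.foldr (fun i g => (pderiv 𝕜 i)^[α i] g) f

/-- The derivative `∂ ^ α f = ∂₁ ^ α₁ ⋯ ∂_d ^ α_d f` for a multi-index `α`. -/
def mderiv (α : Fin d → ℕ) (f : EuclideanSpace 𝕜 (Fin d) → ℂ) : EuclideanSpace 𝕜 (Fin d) → ℂ :=
  mderivList 𝕜 (List.finRange d) α f

variable {𝕜}

theorem contDiff_pderiv {f : EuclideanSpace 𝕜 (Fin d) → ℂ} (hf : ContDiff 𝕜 ∞ f) (i : Fin d) :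
    ContDiff 𝕜 ∞ (pderiv 𝕜 i f) :=
  (hf.fderiv_right (m := ∞) (by simp)).clm_apply contDiff_const

theorem contDiff_iterate {f : EuclideanSpace 𝕜 (Fin d) → ℂ} (hf : ContDiff 𝕜 ∞ f) (i : Fin d)
    (n : ℕ) : ContDiff 𝕜 ∞ ((pderiv 𝕜 i)^[n] f) := by
  induction n with
  | zero => exact hf
  | succ n ih => rw [Function.iterate_succ_apply']; exact contDiff_pderiv ih i

theorem contDiff_mderivList {f : EuclideanSpace 𝕜 (Fin d) → ℂ} (hf : ContDiff 𝕜 ∞ f)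
    (l : List (Fin d)) (α : Fin d → ℕ) : ContDiff 𝕜 ∞ (mderivList 𝕜 l α f) := by
  induction l with
  | nil => exact hf
  | cons i l ih => exact contDiff_iterate ih i (α i)

theorem mderivList_add {f g : EuclideanSpace 𝕜 (Fin d) → ℂ} (hf : ContDiff 𝕜 ∞ f)
    (hg : ContDiff 𝕜 ∞ g) (l : List (Fin d)) (α : Fin d → ℕ) :
    mderivList 𝕜 l α (f + g) = mderivList 𝕜 l α f + mderivList 𝕜 l α g := by
  have step : ∀ (i : Fin d) (n : ℕ) {f g : EuclideanSpace 𝕜 (Fin d) → ℂ}, ContDiff 𝕜 ∞ f →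
      ContDiff 𝕜 ∞ g → (pderiv 𝕜 i)^[n] (f + g) = (pderiv 𝕜 i)^[n] f + (pderiv 𝕜 i)^[n] g := by
    intro i n f g hf hg
    induction n with
    | zero => rfl
    | succ n ih =>
      simp only [Function.iterate_succ_apply', ih]
      funext x
      simp only [pderiv, Pi.add_apply]
      rw [fderiv_add ((contDiff_iterate hf i n).differentiable (by simp) x)
        ((contDiff_iterate hg i n).differentiable (by simp) x)]
      rfl
  induction l with
  | nil => rfl
  | cons i l ih =>
    change (pderiv 𝕜 i)^[α i] (mderivList 𝕜 l α (f + g)) = _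
    rw [ih]
    exact step i _ (contDiff_mderivList hf l α) (contDiff_mderivList hg l α)

theorem mderivList_smul {f : EuclideanSpace ℝ (Fin d) → ℂ} (hf : ContDiff ℝ ∞ f) (c : ℂ)
    (l : List (Fin d)) (α : Fin d → ℕ) :
    mderivList ℝ l α (c • f) = c • mderivList ℝ l α f := by
  have step : ∀ (i : Fin d) (n : ℕ) {f : EuclideanSpace ℝ (Fin d) → ℂ}, ContDiff ℝ ∞ f →
      (pderiv ℝ i)^[n] (c • f) = c • (pderiv ℝ i)^[n] f := by
    intro i n f hf
    induction n with
    | zero => rfl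
    | succ n ih =>
      simp only [Function.iterate_succ_apply', ih]
      funext x
      simp only [pderiv, Pi.smul_apply]
      rw [fderiv_const_smul ((contDiff_iterate hf i n).differentiable (by simp) x)]
      rfl
  induction l with
  | nil => rfl
  | cons i l ih =>
    change (pderiv ℝ i)^[α i] (mderivList ℝ l α (c • f)) = _
    rw [ih]
    exact step i _ (contDiff_mderivList hf l α)

end Deriv

/-- `|x ^ α ∂ ^ β f(x)| ≤ M h ^ (|α| + |β|) α! ^ θ β! ^ θ` for all `α`, `β`, `x`; that is, the norm
of `f` in the Banach space `S_{θ,h}(ℝ ^ d)` is at most `M`. -/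
def NormLE {d : ℕ} (θ h M : ℝ) (f : EuclideanSpace ℝ (Fin d) → ℂ) : Prop :=
  ∀ (α β : Fin d → ℕ) (x : EuclideanSpace ℝ (Fin d)),
    ‖(mpow x α : ℂ) * mderiv ℝ β f x‖ ≤
      M * h ^ (mlen α + mlen β) * mfact α ^ θ * mfact β ^ θ

theorem mfact_pos {d : ℕ} (α : Fin d → ℕ) : 0 < mfact α :=
  Finset.prod_pos fun i _ => by exact_mod_cast (α i).factorial_pos

theorem NormLE.mono {d : ℕ} {θ h h' M : ℝ} {f : EuclideanSpace ℝ (Fin d) → ℂ} (hM : 0 ≤ M)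
    (hh : 0 ≤ h) (hh' : h ≤ h') (H : NormLE θ h M f) : NormLE θ h' M f := by
  intro α β x
  refine (H α β x).trans ?_
  have := Real.rpow_nonneg (mfact_pos α).le θ
  have := Real.rpow_nonneg (mfact_pos β).le θ
  gcongr

theorem NormLE.norm_le {d : ℕ} {θ h M : ℝ} {f : EuclideanSpace ℝ (Fin d) → ℂ}
    (H : NormLE θ h M f) (x : EuclideanSpace ℝ (Fin d)) : ‖f x‖ ≤ M := by
  have := H 0 0 x
  have h1 : mderiv ℝ (0 : Fin d → ℕ) f = f := by
    have : ∀ l : List (Fin d), mderivList ℝ l (0 : Fin d → ℕ) f = f := by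
      intro l
      induction l with
      | nil => rfl
      | cons i l ih => change (pderiv ℝ i)^[0] (mderivList ℝ l 0 f) = f; exact ih
    exact this _
  rw [h1] at this
  simpa [mpow, mfact, mlen] using this

theorem NormLE.nonneg {d : ℕ} {θ h M : ℝ} {f : EuclideanSpace ℝ (Fin d) → ℂ}
    (H : NormLE θ h M f) : 0 ≤ M := (norm_nonneg _).trans (H.norm_le 0)

/-- The Gelfand-Shilov space `S_θ(ℝ ^ d)`: the union over `h > 0` of the Banach spaces
`S_{θ,h}(ℝ ^ d)`. -/
def Space (d : ℕ) (θ : ℝ) : Submodule ℂ (EuclideanSpace ℝ (Fin d) → ℂ) where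
  carrier := {f | ContDiff ℝ ∞ f ∧ ∃ h : ℝ, 0 < h ∧ ∃ M : ℝ, NormLE θ h M f}
  zero_mem' := by
    refine ⟨contDiff_const, 1, one_pos, 0, fun α β x => ?_⟩
    have : mderiv ℝ β (0 : EuclideanSpace ℝ (Fin d) → ℂ) = 0 := by
      simpa [mderiv] using
        mderivList_smul (f := (0 : EuclideanSpace ℝ (Fin d) → ℂ)) contDiff_const 0
          (List.finRange d) β
    simp [this]
  add_mem' := by
    rintro f g ⟨hf, h, hh, M, H⟩ ⟨hg, h', hh', M', H'⟩
    refine ⟨hf.add hg, max h h', lt_max_of_lt_left hh, M + M', fun α β x => ?_⟩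
    have e1 := H.mono H.nonneg hh.le (le_max_left h h') α β x
    have e2 := H'.mono H'.nonneg hh'.le (le_max_right h h') α β x
    rw [mderiv, mderivList_add hf hg, Pi.add_apply, mul_add]
    refine (norm_add_le _ _).trans ((add_le_add e1 e2).trans_eq (by ring))
  smul_mem' := by
    rintro c f ⟨hf, h, hh, M, H⟩
    refine ⟨hf.const_smul c, h, hh, ‖c‖ * M, fun α β x => ?_⟩
    rw [mderiv, mderivList_smul hf, Pi.smul_apply, smul_eq_mul, mul_left_comm, norm_mul]
    exact (mul_le_mul_of_nonneg_left (H α β x) (norm_nonneg c)).trans_eq (by ring)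

/-- The dual `S_θ'(ℝ ^ d)` of the inductive limit `S_θ(ℝ ^ d)`: the linear forms that are bounded on
each of the Banach spaces `S_{θ,h}(ℝ ^ d)`. -/
def Dual (d : ℕ) (θ : ℝ) : Submodule ℂ (Module.Dual ℂ (Space d θ)) where
  carrier := {u | ∀ h : ℝ, 0 < h → ∃ K : ℝ, ∀ (f : Space d θ) (M : ℝ),
    NormLE θ h M (f : EuclideanSpace ℝ (Fin d) → ℂ) → ‖u f‖ ≤ K * M}
  zero_mem' := fun h _ => ⟨0, fun f M _ => by simp⟩
  add_mem' := by
    intro u v hu hv h hh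
    obtain ⟨K, hK⟩ := hu h hh
    obtain ⟨K', hK'⟩ := hv h hh
    refine ⟨K + K', fun f M H => (norm_add_le _ _).trans ?_⟩
    exact (add_le_add (hK f M H) (hK' f M H)).trans_eq (by ring)
  smul_mem' := by
    intro c u hu h hh
    obtain ⟨K, hK⟩ := hu h hh
    refine ⟨‖c‖ * K, fun f M H => ?_⟩
    rw [LinearMap.smul_apply, norm_smul]
    exact (mul_le_mul_of_nonneg_left (hK f M H) (norm_nonneg c)).trans_eq (by ring)

theorem Space.integrable {d : ℕ} {θ : ℝ} (f : Space d θ) :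
    Integrable (f : EuclideanSpace ℝ (Fin d) → ℂ) := by
  obtain ⟨f, hf, h, hh, M, H⟩ := f
  have h0 : ∀ α x, ‖(mpow x α : ℂ) * f x‖ ≤ M * h ^ (mlen α) * mfact α ^ θ := by
    intro α x
    have := H α 0 x
    have h1 : mderiv ℝ (0 : Fin d → ℕ) f = f := by
      have : ∀ l : List (Fin d), mderivList ℝ l (0 : Fin d → ℕ) f = f := by
        intro l
        induction l with
        | nil => rfl
        | cons i l ih => change (pderiv ℝ i)^[0] (mderivList ℝ l 0 f) = f; exact ih
      exact this _
    rw [h1] at this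
    simpa [mfact, mlen] using this
  let a : Finset (Fin d) → Fin d → ℕ := fun t i => if i ∈ t then 2 else 0
  let K : ℝ := ∑ t ∈ (Finset.univ : Finset (Fin d)).powerset, M * h ^ (mlen (a t)) * mfact (a t) ^ θ
  have hdom : Integrable (fun x : EuclideanSpace ℝ (Fin d) => K * ∏ i, (1 + x i ^ 2)⁻¹) := by
    have h2 : Integrable (fun x : Fin d → ℝ => ∏ i, (1 + x i ^ 2)⁻¹) :=
      Integrable.fintype_prod (f := fun _ (t : ℝ) => (1 + t ^ 2)⁻¹)
        fun _ => integrable_inv_one_add_sq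
    exact ((PiLp.volume_preserving_ofLp (Fin d)).integrable_comp_of_integrable h2).const_mul K
  refine hdom.mono' hf.continuous.aestronglyMeasurable (Filter.Eventually.of_forall fun x => ?_)
  have hpos : 0 < ∏ i, (1 + x i ^ 2) := Finset.prod_pos fun i _ => by positivity
  rw [Finset.prod_inv_distrib, ← div_eq_mul_inv, le_div_iff₀ hpos, Finset.prod_one_add,
    Finset.mul_sum]
  refine Finset.sum_le_sum fun t _ => ?_
  refine le_trans (le_of_eq ?_) (h0 (a t) x)
  have : mpow x (a t) = ∏ i ∈ t, x i ^ 2 := by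
    simp only [mpow, a]
    rw [← Finset.prod_subset (Finset.subset_univ t)]
    · exact Finset.prod_congr rfl fun i hi => by simp [hi]
    · intro i _ hi; simp [hi]
  rw [norm_mul, Complex.norm_real, this, Real.norm_of_nonneg
    (Finset.prod_nonneg fun i _ => sq_nonneg _), mul_comm]

theorem Space.integrable_mul {d : ℕ} {θ : ℝ} (f g : Space d θ) :
    Integrable fun y : EuclideanSpace ℝ (Fin d) => f.1 y * g.1 y := by
  obtain ⟨hg, h, hh, M, H⟩ := g.2
  exact (Space.integrable f).mul_bdd (c := M) hg.continuous.aestronglyMeasurable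
    (Filter.Eventually.of_forall H.norm_le)

/-- The inclusion of `S_θ` in `S_θ'`: a function acts by `⟨f, g⟩ = ∫ f(y) g(y) dy`. -/
def Space.toDual {d : ℕ} {θ : ℝ} (f : Space d θ) : Dual d θ :=
  ⟨{ toFun := fun g => ∫ y : EuclideanSpace ℝ (Fin d), f.1 y * g.1 y
     map_add' := fun g g' => by
      rw [← integral_add (Space.integrable_mul f g) (Space.integrable_mul f g')]
      exact integral_congr_ae (Filter.Eventually.of_forall fun y => mul_add _ _ _)
     map_smul' := fun c g => by
      rw [RingHom.id_apply, smul_eq_mul, ← integral_const_mul]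
      exact integral_congr_ae (Filter.Eventually.of_forall fun y => mul_left_comm _ _ _) }, by
    intro h hh
    refine ⟨∫ y : EuclideanSpace ℝ (Fin d), ‖f.1 y‖, fun g M H => ?_⟩
    rw [← integral_mul_const]
    refine norm_integral_le_of_norm_le ((Space.integrable f).norm.mul_const M)
      (Filter.Eventually.of_forall fun y => ?_)
    rw [norm_mul]
    exact mul_le_mul_of_nonneg_left (H.norm_le y) (norm_nonneg _)⟩

/-- An FBI phase on `ℂ ^ d × ℝ ^ d`: the quadratic form
`φ(z, y) = ½⟨Az, z⟩ + ⟨Bz, y⟩ + ½⟨Cy, y⟩` with complex `d × d` matrices, `A` and `C` symmetric,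
`det B ≠ 0` and `Im C` positive definite. The brackets are bilinear. -/
structure FBIPhase (d : ℕ) where
  A : Matrix (Fin d) (Fin d) ℂ
  B : Matrix (Fin d) (Fin d) ℂ
  C : Matrix (Fin d) (Fin d) ℂ
  symm_A : A.IsSymm
  symm_C : C.IsSymm
  det_B : B.det ≠ 0
  posDef_C : (C.map Complex.im).PosDef

namespace FBIPhase

variable {d : ℕ}

/-- The value `φ(z, y)`. -/
def val (φ : FBIPhase d) (z : EuclideanSpace ℂ (Fin d)) (y : EuclideanSpace ℝ (Fin d)) : ℂ :=
  (1 / 2) * ((φ.A *ᵥ z.ofLp) ⬝ᵥ z.ofLp) + (φ.B *ᵥ z.ofLp) ⬝ᵥ (fun i => (y i : ℂ)) +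
    (1 / 2) * ((φ.C *ᵥ fun i => (y i : ℂ)) ⬝ᵥ fun i => (y i : ℂ))

/-- The normalizing constant `c_φ = 2 ^ (-d/2) π ^ (-3d/4) (det Im C) ^ (-1/4) |det B|`. -/
def const (φ : FBIPhase d) : ℝ :=
  (2 : ℝ) ^ (-(d : ℝ) / 2) * Real.pi ^ (-(3 * (d : ℝ)) / 4) *
    (φ.C.map Complex.im).det ^ (-(1 : ℝ) / 4) * ‖φ.B.det‖

/-- The weight `Φ(z) = max_y (-Im φ(z, y))`, the maximum being over `y ∈ ℝ ^ d`. -/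
def weight (φ : FBIPhase d) (z : EuclideanSpace ℂ (Fin d)) : ℝ :=
  ⨆ y : EuclideanSpace ℝ (Fin d), -(φ.val z y).im

/-! The function `y ↦ exp (i φ(z, y))` belongs to `S_θ(ℝ ^ d)` for `θ ≥ 1/2`. -/

/-- The inclusion of `ℝ ^ d` in `ℂ ^ d`. -/
def incl : EuclideanSpace ℝ (Fin d) →L[ℝ] EuclideanSpace ℂ (Fin d) :=
  LinearMap.toContinuousLinearMap
    { toFun := fun y => WithLp.toLp 2 fun i => (y i : ℂ)
      map_add' := fun y y' => by ext i; simp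
      map_smul' := fun c y => by ext i; simp }

theorem incl_apply (y : EuclideanSpace ℝ (Fin d)) (i : Fin d) : incl y i = (y i : ℂ) := rfl

theorem incl_single (i : Fin d) :
    incl (EuclideanSpace.single i (1 : ℝ)) = EuclideanSpace.single i (1 : ℂ) := by
  ext j
  rw [incl_apply]
  by_cases h : j = i <;> simp [h]

theorem norm_incl (y : EuclideanSpace ℝ (Fin d)) : ‖incl y‖ = ‖y‖ := by
  simp [EuclideanSpace.norm_eq, incl_apply]

theorem pderiv_comp_incl {G : EuclideanSpace ℂ (Fin d) → ℂ} (hG : ContDiff ℂ ∞ G) (i : Fin d) :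
    pderiv ℝ i (G ∘ incl) = pderiv ℂ i G ∘ incl := by
  funext x
  have h1 := ((hG.differentiable (by simp) (incl x)).hasFDerivAt.restrictScalars ℝ).comp x
    (incl (d := d)).hasFDerivAt
  simp only [pderiv, Function.comp_apply]
  rw [h1.fderiv]
  simp [incl_single]

theorem mderivList_comp_incl {G : EuclideanSpace ℂ (Fin d) → ℂ} (hG : ContDiff ℂ ∞ G)
    (l : List (Fin d)) (β : Fin d → ℕ) :
    mderivList ℝ l β (G ∘ incl) = mderivList ℂ l β G ∘ incl := by
  induction l with
  | nil => rfl
  | cons i l ih =>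
    change (pderiv ℝ i)^[β i] (mderivList ℝ l β (G ∘ incl)) =
      ((pderiv ℂ i)^[β i] (mderivList ℂ l β G)) ∘ incl
    rw [ih]
    have hs := contDiff_mderivList hG l β
    generalize mderivList ℂ l β G = H at hs
    induction β i with
    | zero => rfl
    | succ n ih =>
      rw [Function.iterate_succ_apply', Function.iterate_succ_apply', ih]
      exact pderiv_comp_incl (contDiff_iterate hs i n) i

theorem iterate_pderiv_eq {G : EuclideanSpace ℂ (Fin d) → ℂ} (hG : ContDiff ℂ ∞ G) (i : Fin d)
    (n : ℕ) (w : EuclideanSpace ℂ (Fin d)) (t : ℂ) :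
    (pderiv ℂ i)^[n] G (w + t • EuclideanSpace.single i 1) =
      iteratedDeriv n (fun s : ℂ => G (w + s • EuclideanSpace.single i 1)) t := by
  induction n generalizing t with
  | zero => simp
  | succ n ih =>
    rw [iteratedDeriv_succ, Function.iterate_succ_apply', ← funext ih]
    have h1 : HasDerivAt (fun s : ℂ => w + s • (EuclideanSpace.single i 1 : EuclideanSpace ℂ (Fin d)))
        (EuclideanSpace.single i 1) t := by
      simpa using ((hasDerivAt_id t).smul_const
        (EuclideanSpace.single i 1 : EuclideanSpace ℂ (Fin d))).const_add w
    exact ((((contDiff_iterate hG i n).differentiable (by simp) _).hasFDerivAt).comp_hasDerivAt t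
      h1).deriv.symm

/-- Cauchy's inequalities on a polydisc. -/
theorem norm_mderivList_le {G : EuclideanSpace ℂ (Fin d) → ℂ} (hG : ContDiff ℂ ∞ G)
    (β : Fin d → ℕ) (r : Fin d → ℝ) (hr : ∀ i, 0 < r i) (N : ℝ) (l : List (Fin d)) (hl : l.Nodup)
    (w : EuclideanSpace ℂ (Fin d))
    (hN : ∀ w' : EuclideanSpace ℂ (Fin d), (∀ j ∈ l, ‖w' j - w j‖ ≤ r j) →
      (∀ j ∉ l, w' j = w j) → ‖G w'‖ ≤ N) :
    ‖mderivList ℂ l β G w‖ ≤ (l.map fun i => ((β i).factorial : ℝ) / r i ^ β i).prod * N := by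
  induction l generalizing w with
  | nil => simpa [mderivList] using hN w (by simp) (by simp)
  | cons i l ih =>
    obtain ⟨hi, hl⟩ := List.nodup_cons.1 hl
    have hs := contDiff_mderivList hG l β
    have e := iterate_pderiv_eq hs i (β i) w 0
    simp only [zero_smul, add_zero] at e
    change ‖(pderiv ℂ i)^[β i] (mderivList ℂ l β G) w‖ ≤ _
    rw [e]
    refine (Complex.norm_iteratedDeriv_le_of_forall_mem_sphere_norm_le (β i) (hr i) ?_
      (C := (l.map fun i => ((β i).factorial : ℝ) / r i ^ β i).prod * N) ?_).trans_eq ?_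
    · refine Differentiable.diffContOnCl ?_
      exact (hs.differentiable (by simp)).comp (by fun_prop)
    · intro t ht
      refine ih hl _ fun w' h1 h2 => hN w' ?_ ?_
      · intro j hj
        rcases List.mem_cons.1 hj with rfl | hj
        · rw [h2 j hi]
          simpa using (mem_sphere_zero_iff_norm.1 ht).le
        · have hne : j ≠ i := fun h => hi (h ▸ hj)
          simpa [hne] using h1 j hj
      · intro j hj
        rw [List.mem_cons, not_or] at hj
        rw [h2 j hj.2]
        simp [hj.1]
    · rw [List.map_cons, List.prod_cons]
      ring

theorem exists_coercive {M : Matrix (Fin d) (Fin d) ℝ} (hM : M.PosDef) :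
    ∃ c > 0, ∀ x : EuclideanSpace ℝ (Fin d), c * ‖x‖ ^ 2 ≤ (M *ᵥ x.ofLp) ⬝ᵥ x.ofLp := by
  have hpos : ∀ x : EuclideanSpace ℝ (Fin d), x ≠ 0 → 0 < (M *ᵥ x.ofLp) ⬝ᵥ x.ofLp := by
    intro x hx
    have := (Matrix.posDef_iff_dotProduct_mulVec.1 hM).2 (x := x.ofLp) (by simpa using hx)
    rwa [dotProduct_comm, star_trivial] at this
  have hcont : Continuous fun x : EuclideanSpace ℝ (Fin d) => (M *ᵥ x.ofLp) ⬝ᵥ x.ofLp := by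
    fun_prop
  rcases (Metric.sphere (0 : EuclideanSpace ℝ (Fin d)) 1).eq_empty_or_nonempty with he | hne
  · refine ⟨1, one_pos, fun x => ?_⟩
    have : x = 0 := by
      by_contra hx
      have : ‖x‖⁻¹ • x ∈ Metric.sphere (0 : EuclideanSpace ℝ (Fin d)) 1 := by
        rw [mem_sphere_zero_iff_norm, norm_smul, norm_inv, norm_norm,
          inv_mul_cancel₀ (norm_ne_zero_iff.2 hx)]
      rw [he] at this
      exact this
    simp [this]
  · obtain ⟨x₀, hx₀, hmin⟩ := (isCompact_sphere (0 : EuclideanSpace ℝ (Fin d)) 1).exists_isMinOn hne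
      hcont.continuousOn
    refine ⟨_, hpos x₀ (by rintro rfl; simp at hx₀), fun x => ?_⟩
    by_cases hx : x = 0
    · simp [hx]
    have hn : ‖x‖ ≠ 0 := norm_ne_zero_iff.2 hx
    have h1 : ‖x‖⁻¹ • x ∈ Metric.sphere (0 : EuclideanSpace ℝ (Fin d)) 1 := by
      rw [mem_sphere_zero_iff_norm, norm_smul, norm_inv, norm_norm, inv_mul_cancel₀ hn]
    have h2 := hmin h1
    simp only [Set.mem_ofPred_eq, WithLp.ofLp_smul, Matrix.mulVec_smul, smul_dotProduct,
      dotProduct_smul, smul_eq_mul] at h2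
    calc _ ≤ ‖x‖⁻¹ * (‖x‖⁻¹ * (M *ᵥ x.ofLp ⬝ᵥ x.ofLp)) * ‖x‖ ^ 2 := by gcongr
      _ = _ := by field_simp

theorem norm_bilin_le (M : Matrix (Fin d) (Fin d) ℂ) :
    ∃ K ≥ 0, ∀ v w : EuclideanSpace ℂ (Fin d), ‖(M *ᵥ v.ofLp) ⬝ᵥ w.ofLp‖ ≤ K * ‖v‖ * ‖w‖ := by
  refine ⟨∑ i, ∑ j, ‖M i j‖, by positivity, fun v w => ?_⟩
  rw [Finset.sum_mul, Finset.sum_mul]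
  refine (norm_sum_le _ _).trans (Finset.sum_le_sum fun i _ => ?_)
  rw [norm_mul, Matrix.mulVec]
  refine mul_le_mul ?_ (PiLp.norm_apply_le w i) (norm_nonneg _) (by positivity)
  rw [Finset.sum_mul]
  refine (norm_sum_le _ _).trans (Finset.sum_le_sum fun j _ => ?_)
  rw [norm_mul]
  exact mul_le_mul_of_nonneg_left (PiLp.norm_apply_le v j) (norm_nonneg _)

theorem norm_lin_le (b : Fin d → ℂ) :
    ∃ K ≥ 0, ∀ w : EuclideanSpace ℂ (Fin d), ‖b ⬝ᵥ w.ofLp‖ ≤ K * ‖w‖ := by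
  refine ⟨∑ i, ‖b i‖, by positivity, fun w => ?_⟩
  rw [Finset.sum_mul]
  refine (norm_sum_le _ _).trans (Finset.sum_le_sum fun i _ => ?_)
  rw [norm_mul]
  exact mul_le_mul_of_nonneg_left (PiLp.norm_apply_le w i) (norm_nonneg _)

/-- The phase with its second variable extended to `ℂ ^ d`. -/
def valC (φ : FBIPhase d) (z w : EuclideanSpace ℂ (Fin d)) : ℂ :=
  (1 / 2) * ((φ.A *ᵥ z.ofLp) ⬝ᵥ z.ofLp) + (φ.B *ᵥ z.ofLp) ⬝ᵥ w.ofLp +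
    (1 / 2) * ((φ.C *ᵥ w.ofLp) ⬝ᵥ w.ofLp)

theorem contDiff_valC (φ : FBIPhase d) (z : EuclideanSpace ℂ (Fin d)) :
    ContDiff ℂ ∞ fun w => Complex.exp (Complex.I * φ.valC z w) := by
  unfold valC dotProduct Matrix.mulVec dotProduct
  fun_prop

theorem im_quad (φ : FBIPhase d) (x : EuclideanSpace ℝ (Fin d)) :
    ((φ.C *ᵥ (incl x).ofLp) ⬝ᵥ (incl x).ofLp).im =
      ((φ.C.map Complex.im) *ᵥ x.ofLp) ⬝ᵥ x.ofLp := by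
  simp [dotProduct, Matrix.mulVec, incl_apply, Complex.im_sum]

theorem exists_bound (φ : FBIPhase d) (z : EuclideanSpace ℂ (Fin d)) :
    ∃ c > 0, ∃ L > 0, ∃ K, ∀ (x : EuclideanSpace ℝ (Fin d)) (η : EuclideanSpace ℂ (Fin d)),
      -(φ.valC z (incl x + η)).im ≤ K - c * ‖x‖ ^ 2 + L * ‖η‖ ^ 2 := by
  obtain ⟨c, hc, hc'⟩ := exists_coercive φ.posDef_C
  obtain ⟨K₁, hK₁, hK₁'⟩ := norm_lin_le (φ.B *ᵥ z.ofLp)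
  obtain ⟨K₂, hK₂, hK₂'⟩ := norm_bilin_le φ.C
  let a : ℂ := (1 / 2) * ((φ.A *ᵥ z.ofLp) ⬝ᵥ z.ofLp)
  refine ⟨c / 4, by positivity, K₂ ^ 2 * 2 / c + K₂ + 1, by positivity,
    ‖a‖ + 2 * K₁ ^ 2 / c + K₁ ^ 2, fun x η => ?_⟩
  have e : φ.valC z (incl x + η) = a + (φ.B *ᵥ z.ofLp) ⬝ᵥ (incl x).ofLp +
      (φ.B *ᵥ z.ofLp) ⬝ᵥ η.ofLp + (1 / 2) * ((φ.C *ᵥ (incl x).ofLp) ⬝ᵥ (incl x).ofLp) +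
      (1 / 2) * ((φ.C *ᵥ (incl x).ofLp) ⬝ᵥ η.ofLp) + (1 / 2) * ((φ.C *ᵥ η.ofLp) ⬝ᵥ (incl x).ofLp) +
      (1 / 2) * ((φ.C *ᵥ η.ofLp) ⬝ᵥ η.ofLp) := by
    simp only [valC, a, WithLp.ofLp_add, Matrix.mulVec_add, dotProduct_add, add_dotProduct]
    ring
  have half : ∀ u : ℂ, ((1 / 2) * u).im = u.im / 2 := by
    intro u
    rw [show (1 / 2 : ℂ) = ((1 / 2 : ℝ) : ℂ) by norm_num, Complex.im_ofReal_mul]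
    ring
  have t : ∀ u : ℂ, -u.im ≤ ‖u‖ := fun u => (neg_le_abs _).trans (Complex.abs_im_le_norm u)
  have h1 := (t _).trans (hK₁' (incl x))
  have h2 := (t _).trans (hK₁' η)
  have h3 := (t _).trans (hK₂' (incl x) η)
  have h4 := (t _).trans (hK₂' η (incl x))
  have h5 := (t _).trans (hK₂' η η)
  have h6 := hc' x
  rw [← im_quad] at h6
  have h7 := t a
  rw [norm_incl] at h1 h3 h4
  rw [e]
  simp only [Complex.add_im, half]
  have q1 : K₁ * ‖x‖ ≤ 2 * K₁ ^ 2 / c + c / 8 * ‖x‖ ^ 2 := by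
    have : 2 * K₁ ^ 2 / c + c / 8 * ‖x‖ ^ 2 - K₁ * ‖x‖ = (4 * K₁ - c * ‖x‖) ^ 2 / (8 * c) := by
      field_simp; ring
    have : 0 ≤ (4 * K₁ - c * ‖x‖) ^ 2 / (8 * c) := by positivity
    linarith
  have q2 : K₂ * ‖x‖ * ‖η‖ ≤ K₂ ^ 2 * 2 / c * ‖η‖ ^ 2 + c / 8 * ‖x‖ ^ 2 := by
    have : K₂ ^ 2 * 2 / c * ‖η‖ ^ 2 + c / 8 * ‖x‖ ^ 2 - K₂ * ‖x‖ * ‖η‖ =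
        (4 * K₂ * ‖η‖ - c * ‖x‖) ^ 2 / (8 * c) := by
      field_simp; ring
    have : 0 ≤ (4 * K₂ * ‖η‖ - c * ‖x‖) ^ 2 / (8 * c) := by positivity
    linarith
  have q3 : K₁ * ‖η‖ ≤ K₁ ^ 2 + ‖η‖ ^ 2 := by nlinarith [sq_nonneg (K₁ - ‖η‖), sq_nonneg K₁, sq_nonneg ‖η‖]
  have q4 : 0 ≤ K₂ * ‖η‖ * ‖η‖ := by positivity
  have q5 : (K₂ ^ 2 * 2 / c + K₂ + 1) * ‖η‖ ^ 2 =
    K₂ ^ 2 * 2 / c * ‖η‖ ^ 2 + K₂ * ‖η‖ * ‖η‖ + ‖η‖ ^ 2 := by ring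
  rw [q5]
  linarith

theorem pow_mul_exp_le {c : ℝ} (hc : 0 < c) (n : ℕ) (t : ℝ) :
    |t| ^ n * Real.exp (-(c * t ^ 2)) ≤ (√(2 * c))⁻¹ ^ n * √(n.factorial : ℝ) := by
  have h1 := Real.pow_div_factorial_le_exp (2 * c * t ^ 2) (by positivity) n
  rw [div_le_iff₀ (by positivity)] at h1
  have hs : √(2 * c) ^ 2 = 2 * c := Real.sq_sqrt (by positivity)
  have hf : √(n.factorial : ℝ) ^ 2 = n.factorial := Real.sq_sqrt (by positivity)
  have he : Real.exp (2 * c * t ^ 2) = Real.exp (c * t ^ 2) ^ 2 := by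
    rw [← Real.exp_nat_mul]; congr 1; push_cast; ring
  have h2 : (√(2 * c) ^ n * |t| ^ n) ^ 2 ≤ (Real.exp (c * t ^ 2) * √(n.factorial : ℝ)) ^ 2 := by
    rw [mul_pow _ √(n.factorial : ℝ), hf, ← he]
    refine le_trans (le_of_eq ?_) h1
    rw [← mul_pow, ← pow_mul, mul_comm n 2, pow_mul, mul_pow, hs, sq_abs]
  have h3 := (sq_le_sq₀ (by positivity) (by positivity)).1 h2
  have hs0 : 0 < √(2 * c) ^ n := by positivity
  rw [Real.exp_neg, ← div_eq_mul_inv, div_le_iff₀ (Real.exp_pos _), inv_pow, mul_assoc,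
    inv_mul_eq_div, le_div_iff₀ hs0]
  linarith

theorem factorial_div_le (n : ℕ) :
    (n.factorial : ℝ) / √((n : ℝ) + 1) ^ n ≤ √(n.factorial : ℝ) := by
  have hf : √(n.factorial : ℝ) * √(n.factorial : ℝ) = n.factorial :=
    Real.mul_self_sqrt (by positivity)
  rw [div_le_iff₀ (by positivity)]
  nth_rewrite 1 [← hf]
  refine mul_le_mul_of_nonneg_left ?_ (Real.sqrt_nonneg _)
  refine Real.sqrt_le_iff.2 ⟨by positivity, ?_⟩
  rw [← pow_mul, mul_comm n 2, pow_mul, Real.sq_sqrt (by positivity)]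
  have : n.factorial ≤ (n + 1) ^ n :=
    (Nat.factorial_le_pow n).trans (Nat.pow_le_pow_left (Nat.le_succ n) n)
  exact_mod_cast this

theorem sqrt_prod_factorial_le {θ : ℝ} (hθ : 1 / 2 ≤ θ) (α : Fin d → ℕ) :
    ∏ i, √((α i).factorial : ℝ) ≤ mfact α ^ θ := by
  have h1 : (1 : ℝ) ≤ mfact α := by
    have : 1 ≤ ∏ i, (α i).factorial := Nat.one_le_iff_ne_zero.2
      (Finset.prod_ne_zero_iff.2 fun i _ => (α i).factorial_ne_zero)
    simpa [mfact] using (by exact_mod_cast this : (1 : ℝ) ≤ ((∏ i, (α i).factorial : ℕ) : ℝ))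
  refine le_trans (le_of_eq ?_) (Real.rpow_le_rpow_of_exponent_le h1 hθ)
  rw [mfact, ← Real.finsetProd_rpow _ _ fun i _ => by positivity]
  exact Finset.prod_congr rfl fun i _ => Real.sqrt_eq_rpow _

theorem kernel_mem {θ : ℝ} (hθ : 1 / 2 ≤ θ) (φ : FBIPhase d) (z : EuclideanSpace ℂ (Fin d)) :
    (fun y => Complex.exp (Complex.I * φ.val z y)) ∈ Space d θ := by
  have hG := φ.contDiff_valC z
  set G : EuclideanSpace ℂ (Fin d) → ℂ := fun w => Complex.exp (Complex.I * φ.valC z w) with hGdef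
  have hcomp : (fun y => Complex.exp (Complex.I * φ.val z y)) = G ∘ incl := rfl
  rw [hcomp]
  obtain ⟨c, hc, L, hL, K, hK⟩ := φ.exists_bound z
  have hsm : ContDiff ℝ ∞ (G ∘ incl) := (hG.restrict_scalars ℝ).comp incl.contDiff
  set h := max (Real.exp L) (√(2 * c))⁻¹ with hh
  have hh0 : 0 < h := lt_max_of_lt_left (Real.exp_pos _)
  refine ⟨hsm, h, hh0, Real.exp (K + L * d), fun α β x => ?_⟩
  rw [mderiv, mderivList_comp_incl hG]
  have hC := norm_mderivList_le hG β (fun i => √((β i : ℝ) + 1)) (fun i => by positivity)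
    (Real.exp (K - c * ‖x‖ ^ 2 + L * (mlen β + d))) (List.finRange d) (List.nodup_finRange d)
    (incl x) (by
      intro w' h1 _
      have h2 := hK x (w' - incl x)
      rw [add_sub_cancel] at h2
      rw [hGdef]
      simp only [Complex.norm_exp, Complex.I_mul_re]
      refine Real.exp_le_exp.2 (h2.trans ?_)
      gcongr
      rw [EuclideanSpace.norm_sq_eq]
      calc ∑ i, ‖(w' - incl x) i‖ ^ 2 ≤ ∑ i, ((β i : ℝ) + 1) := by
            refine Finset.sum_le_sum fun i _ => ?_
            rw [← Real.sq_sqrt (show (0 : ℝ) ≤ (β i : ℝ) + 1 by positivity)]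
            have := h1 i (List.mem_finRange i)
            rw [PiLp.sub_apply]
            gcongr
        _ = _ := by simp [Finset.sum_add_distrib, mlen])
  have hprod : ((List.finRange d).map fun i => ((β i).factorial : ℝ) / √((β i : ℝ) + 1) ^ β i).prod
      = ∏ i, ((β i).factorial : ℝ) / √((β i : ℝ) + 1) ^ β i := by
    rw [← List.ofFn_eq_map, List.prod_ofFn]
  rw [hprod] at hC
  have hβ : ∏ i, ((β i).factorial : ℝ) / √((β i : ℝ) + 1) ^ β i ≤ mfact β ^ θ :=
    (Finset.prod_le_prod (fun i _ => by positivity) fun i _ => factorial_div_le (β i)).trans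
      (sqrt_prod_factorial_le hθ β)
  have hα : |mpow x α| * Real.exp (-(c * ‖x‖ ^ 2)) ≤ h ^ mlen α * mfact α ^ θ := by
    have e1 : |mpow x α| * Real.exp (-(c * ‖x‖ ^ 2)) =
        ∏ i, (|x i| ^ α i * Real.exp (-(c * x i ^ 2))) := by
      rw [mpow, Finset.abs_prod, Finset.prod_mul_distrib, ← Real.exp_sum, EuclideanSpace.norm_sq_eq,
        Finset.mul_sum, Finset.sum_neg_distrib]
      simp [abs_pow]
    rw [e1]
    refine (Finset.prod_le_prod (fun i _ => by positivity)
      fun i _ => pow_mul_exp_le hc (α i) (x i)).trans ?_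
    rw [Finset.prod_mul_distrib, Finset.prod_pow_eq_pow_sum]
    refine mul_le_mul ?_ (sqrt_prod_factorial_le hθ α) (by positivity) (by positivity)
    exact pow_le_pow_left₀ (by positivity) (le_max_right _ _) _
  have hexp : Real.exp (K - c * ‖x‖ ^ 2 + L * (mlen β + d)) =
      Real.exp (K + L * d) * Real.exp L ^ mlen β * Real.exp (-(c * ‖x‖ ^ 2)) := by
    rw [← Real.exp_nat_mul, ← Real.exp_add, ← Real.exp_add]
    congr 1
    ring
  have hLh : Real.exp L ^ mlen β ≤ h ^ mlen β :=
    pow_le_pow_left₀ (Real.exp_pos _).le (le_max_left _ _) _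
  have hβ0 := Real.rpow_nonneg (mfact_pos β).le θ
  have hα0 := Real.rpow_nonneg (mfact_pos α).le θ
  rw [norm_mul, Complex.norm_real, Real.norm_eq_abs, Function.comp_apply]
  calc |mpow x α| * ‖mderivList ℂ (List.finRange d) β G (incl x)‖
      ≤ |mpow x α| * (mfact β ^ θ *
        (Real.exp (K + L * d) * Real.exp L ^ mlen β * Real.exp (-(c * ‖x‖ ^ 2)))) := by
        rw [← hexp]
        gcongr
        exact hC.trans (by gcongr)
    _ = Real.exp (K + L * d) * Real.exp L ^ mlen β *
        (|mpow x α| * Real.exp (-(c * ‖x‖ ^ 2))) * mfact β ^ θ := by ring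
    _ ≤ Real.exp (K + L * d) * h ^ mlen β * (h ^ mlen α * mfact α ^ θ) * mfact β ^ θ := by gcongr
    _ = _ := by rw [pow_add]; ring

/-- The function `y ↦ exp (i φ(z, y))` as an element of `S_θ(ℝ ^ d)`, `θ ≥ 1/2`. -/
def kernel {θ : ℝ} (hθ : 1 / 2 ≤ θ) (φ : FBIPhase d) (z : EuclideanSpace ℂ (Fin d)) : Space d θ :=
  ⟨fun y => Complex.exp (Complex.I * φ.val z y), kernel_mem hθ φ z⟩

/-- The FBI transform `T_φ u(z) = c_φ ⟨u_y, exp (i φ(z, y))⟩` of `u ∈ S_θ'(ℝ ^ d)`. -/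
def transform {θ : ℝ} (hθ : 1 / 2 ≤ θ) (φ : FBIPhase d) (u : Dual d θ)
    (z : EuclideanSpace ℂ (Fin d)) : ℂ :=
  φ.const * u.1 (kernel hθ φ z)

/-- For every `ε > 0` there is `C > 0` with
`|∂ ^ α U(z)| ≤ C ^ (|α| + 1) α! ^ θ exp (ε |z| ^ (1/θ) + Φ(z))` for all `α` and `z`. -/
def GrowthEstimate (φ : FBIPhase d) (θ : ℝ) (U : EuclideanSpace ℂ (Fin d) → ℂ) : Prop :=
  ∀ ε : ℝ, 0 < ε → ∃ C : ℝ, 0 < C ∧ ∀ (α : Fin d → ℕ) (z : EuclideanSpace ℂ (Fin d)),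
    ‖mderiv ℂ α U z‖ ≤
      C ^ (mlen α + 1) * mfact α ^ θ * Real.exp (ε * ‖z‖ ^ (1 / θ) + φ.weight z)

/-- There are `ε > 0` and `C > 0` with
`|∂ ^ α U(z)| ≤ C ^ (|α| + 1) α! ^ θ exp (-ε |z| ^ (1/θ) + Φ(z))` for all `α` and `z`. -/
def DecayEstimate (φ : FBIPhase d) (θ : ℝ) (U : EuclideanSpace ℂ (Fin d) → ℂ) : Prop :=
  ∃ ε : ℝ, 0 < ε ∧ ∃ C : ℝ, 0 < C ∧ ∀ (α : Fin d → ℕ) (z : EuclideanSpace ℂ (Fin d)),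
    ‖mderiv ℂ α U z‖ ≤
      C ^ (mlen α + 1) * mfact α ^ θ * Real.exp (-ε * ‖z‖ ^ (1 / θ) + φ.weight z)

end FBIPhase
end GelfandShilov
end

/-! Put ζ = Bz, S = Im C, η = Im ζ. Then e^{iφ(z,y)} is the zero-free holomorphic factor `hol φ z`
times the Gaussian wave packet `gker φ.C ζ y`. The modulus of the packet peaks at y = -S⁻¹η with the
value e^{½⟨S⁻¹η,η⟩} (`complete_square`), so Φ(z) = log |hol φ z| + `wt S η` (`weight_eq`), and every
claim becomes a claim about packets.

The exponents 1/θ and 1/(1-θ) are conjugate and 1/(1-θ) ≥ 2. Hence cross terms |z||w| split by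
Young's inequality, squares |w|² are absorbed by |w|^{1/(1-θ)}, and Cauchy's inequalities on
polydiscs of radii (β_i+1)^{1-θ} turn growth e^{L|w|^{1/(1-θ)}} into derivative bounds C^{|β|+1}
β!^θ. Sup bounds for entire functions therefore give both membership in S_θ
(`exists_normLE_of_entire`) and the derivative estimates for the transform
(`exists_mderiv_estimate`).

Estimate (1) holds because packets lie in one S_{θ,h} with norm O(e^{wt + ε|ζ|^{1/θ}})
(`exists_normLE_gker`). In (2), with ζ = ξ + iη, a function f in S_θ times the packet of frequency
iη is small for large η, since f is small near the centre of the packet and the packet is small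
elsewhere. Integrating by parts against e^{i⟨ξ,y⟩} gives the decay in ξ
(`exists_norm_integral_mul_gker_le`).

For the converse let `coeff C f ζ` be the pairing of f with the conjugate packet. Fourier inversion
in ξ, followed by a Gaussian average in η, writes f as a superposition of packets
(`exists_inversion`). Ultradistributions commute with such superpositions (`dual_superposition`), so
they are determined by their values on packets; this is uniqueness. For existence divide U by `hol`
to get an entire W, and let u(f) = ∫ W · coeff f · e^{-2wt} up to a constant. That u has transform U
is the reproducing formula `exists_reproducing`: after a translation its integrand is a holomorphic
function times a rotation-invariant Gaussian, and the mean value property evaluates it. If W decays,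
u is itself a superposition of packets, now with the matrix -C̄, and hence a function in S_θ. -/

noncomputable section

namespace GelfandShilov

open FBIPhase (incl)

section

/-! ### Elementary inequalities for the conjugate exponents `1 / θ` and `1 / (1 - θ)` -/

theorem rpow_le_one_add_rpow {a b t : ℝ} (ht : 0 ≤ t) (ha : 0 ≤ a) (hab : a ≤ b) :
    t ^ a ≤ 1 + t ^ b := by
  rcases le_total t 1 with h | h
  · exact (Real.rpow_le_one ht h ha).trans (by linarith [Real.rpow_nonneg ht b])
  · exact (Real.rpow_le_rpow_of_exponent_le h hab).trans (by linarith)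

/-- A quasi-triangle inequality whose constant does not depend on θ, since the exponent `1 / θ` it
is used with is at most 2. Most factors 4 and 8 that accompany ε below come from it. -/
theorem add_rpow_le_four_mul {r a b : ℝ} (hr : 0 ≤ r) (hr2 : r ≤ 2) (ha : 0 ≤ a) (hb : 0 ≤ b) :
    (a + b) ^ r ≤ 4 * (a ^ r + b ^ r) := by
  have h2 : (2 : ℝ) ^ r ≤ 4 := by
    have := Real.rpow_le_rpow_of_exponent_le (x := 2) (by norm_num) hr2
    norm_num at this ⊢
    exact this
  have hm : (a + b) ^ r ≤ (2 * max a b) ^ r :=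
    Real.rpow_le_rpow (by positivity) (by linarith [le_max_left a b, le_max_right a b]) hr
  rw [Real.mul_rpow (by norm_num) (le_max_of_le_left ha)] at hm
  have hmax : (max a b) ^ r ≤ a ^ r + b ^ r := by
    have := Real.rpow_nonneg ha r
    have := Real.rpow_nonneg hb r
    rcases max_choice a b with h | h <;> rw [h] <;> linarith
  have : 0 ≤ (max a b) ^ r := Real.rpow_nonneg (le_max_of_le_left ha) r
  calc (a + b) ^ r ≤ 2 ^ r * (max a b) ^ r := hm
    _ ≤ 4 * (a ^ r + b ^ r) := by gcongr

section Exponents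

variable {θ : ℝ}

theorem one_lt_inv_exponent (hθ : 1 / 2 ≤ θ) (hθ' : θ < 1) : 1 < 1 / θ := by
  rw [lt_div_iff₀ (by linarith)]; linarith

theorem inv_exponent_le_two (hθ : 1 / 2 ≤ θ) : 1 / θ ≤ 2 := by
  rw [div_le_iff₀ (by linarith)]; linarith

theorem two_le_conj_exponent (hθ : 1 / 2 ≤ θ) (hθ' : θ < 1) : 2 ≤ 1 / (1 - θ) := by
  rw [le_div_iff₀ (by linarith)]; linarith

theorem holderConjugate_exponents (hθ : 1 / 2 ≤ θ) (hθ' : θ < 1) :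
    (1 / θ).HolderConjugate (1 / (1 - θ)) := by
  rw [Real.holderConjugate_iff]
  exact ⟨one_lt_inv_exponent hθ hθ', by simp⟩

theorem norm_add_rpow_le {V : Type*} [SeminormedAddCommGroup V] (hθ : 1 / 2 ≤ θ) (x y : V) :
    ‖x + y‖ ^ (1 / θ) ≤ 4 * (‖x‖ ^ (1 / θ) + ‖y‖ ^ (1 / θ)) :=
  (Real.rpow_le_rpow (norm_nonneg _) (norm_add_le x y) (by positivity)).trans
    (add_rpow_le_four_mul (by positivity) (inv_exponent_le_two hθ) (norm_nonneg _)
      (norm_nonneg _))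

theorem rpow_le_one_add_sq (hθ : 1 / 2 ≤ θ) {t : ℝ} (ht : 0 ≤ t) :
    t ^ (1 / θ) ≤ 1 + t ^ 2 := by
  have := rpow_le_one_add_rpow ht (a := 1 / θ) (b := 2) (by positivity) (inv_exponent_le_two hθ)
  simpa using this

/-- This is where `1 / 2 ≤ θ` is decisive: it makes 1/(1-θ) ≥ 2, so the Gaussian growth of a packet
in the complex directions fits under e^{L|w|^{1/(1-θ)}}. -/
theorem sq_le_one_add_rpow (hθ : 1 / 2 ≤ θ) (hθ' : θ < 1) {t : ℝ} (ht : 0 ≤ t) :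
    t ^ 2 ≤ 1 + t ^ (1 / (1 - θ)) := by
  have := rpow_le_one_add_rpow ht (a := 2) (b := 1 / (1 - θ)) (by positivity)
    (two_le_conj_exponent hθ hθ')
  simpa using this

theorem rpow_le_one_add_conj_rpow (hθ : 1 / 2 ≤ θ) (hθ' : θ < 1) {t : ℝ} (ht : 0 ≤ t) :
    t ^ (1 / θ) ≤ 1 + t ^ (1 / (1 - θ)) :=
  rpow_le_one_add_rpow ht (by positivity)
    ((inv_exponent_le_two hθ).trans (two_le_conj_exponent hθ hθ'))

/-- Young's inequality with a small constant in front of the first term. -/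
theorem exists_young (hθ : 1 / 2 ≤ θ) (hθ' : θ < 1) {ε : ℝ} (hε : 0 < ε) (L : ℝ) :
    ∃ C ≥ 0, ∀ a b : ℝ, 0 ≤ a → 0 ≤ b →
      L * (a * b) ≤ ε * a ^ (1 / θ) + C * b ^ (1 / (1 - θ)) := by
  have hθ0 : 0 < θ := by linarith
  have hp := one_lt_inv_exponent hθ hθ'
  have hq := two_le_conj_exponent hθ hθ'
  -- Young's inequality is applied to δa and (|L|/δ)b, whose product is |L|ab; δ = ε^θ makes the
  -- first coefficient at most ε.
  obtain ⟨δ, hδ, hδε⟩ : ∃ δ > 0, δ ^ (1 / θ) ≤ ε := by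
    refine ⟨ε ^ θ, by positivity, ?_⟩
    rw [← Real.rpow_mul hε.le, mul_one_div_cancel hθ0.ne', Real.rpow_one]
  refine ⟨(|L| / δ) ^ (1 / (1 - θ)), by positivity, fun a b ha hb => ?_⟩
  have h := Real.young_inequality_of_nonneg (a := δ * a) (b := |L| / δ * b) (by positivity)
    (by positivity) (holderConjugate_exponents hθ hθ')
  rw [Real.mul_rpow hδ.le ha, Real.mul_rpow (by positivity) hb] at h
  have e : δ * a * (|L| / δ * b) = |L| * (a * b) := by field_simp
  rw [e] at h
  have h1 : δ ^ (1 / θ) * a ^ (1 / θ) / (1 / θ) ≤ ε * a ^ (1 / θ) := by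
    refine (div_le_self (by positivity) hp.le).trans ?_
    gcongr
  have h2 : (|L| / δ) ^ (1 / (1 - θ)) * b ^ (1 / (1 - θ)) / (1 / (1 - θ)) ≤
      (|L| / δ) ^ (1 / (1 - θ)) * b ^ (1 / (1 - θ)) :=
    div_le_self (by positivity) (by linarith)
  have h3 : L * (a * b) ≤ |L| * (a * b) := by gcongr; exact le_abs_self L
  linarith

/-- A power of `t` is absorbed by `exp (δ t ^ (1 / θ))` at the cost of a power of a factorial. -/
theorem exists_pow_le_exp (hθ : 0 < θ) {δ : ℝ} (hδ : 0 < δ) :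
    ∃ h > 0, ∀ (n : ℕ) (t : ℝ), 0 ≤ t →
      t ^ n ≤ h ^ n * (n.factorial : ℝ) ^ θ * Real.exp (δ * t ^ (1 / θ)) := by
  -- The witness comes from s^n ≤ n! e^s at s = (δ/θ) t^{1/θ}, raised to the power θ.
  refine ⟨(θ / δ) ^ θ, by positivity, fun n t ht => ?_⟩
  have h1 := Real.pow_div_factorial_le_exp (δ / θ * t ^ (1 / θ)) (by positivity) n
  rw [div_le_iff₀ (by positivity)] at h1
  have h2 := Real.rpow_le_rpow (by positivity) h1 hθ.le
  have e1 : ((δ / θ * t ^ (1 / θ)) ^ n) ^ θ = ((δ / θ) ^ θ) ^ n * t ^ n := by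
    rw [← Real.rpow_natCast, ← Real.rpow_mul (by positivity), mul_comm (n : ℝ) θ,
      Real.rpow_mul (by positivity), Real.mul_rpow (by positivity) (by positivity),
      ← Real.rpow_mul ht, one_div_mul_cancel hθ.ne', Real.rpow_one, Real.rpow_natCast, mul_pow]
  have e2 : (Real.exp (δ / θ * t ^ (1 / θ)) * n.factorial) ^ θ =
      (n.factorial : ℝ) ^ θ * Real.exp (δ * t ^ (1 / θ)) := by
    rw [Real.mul_rpow (by positivity) (by positivity), ← Real.exp_mul, mul_comm]
    congr 2
    field_simp
  rw [e1, e2] at h2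
  have e3 : ((θ / δ) ^ θ) ^ n * ((δ / θ) ^ θ) ^ n = 1 := by
    rw [← mul_pow, ← Real.mul_rpow (by positivity) (by positivity)]
    simp [div_mul_div_cancel₀ hδ.ne', hθ.ne']
  calc t ^ n = ((θ / δ) ^ θ) ^ n * (((δ / θ) ^ θ) ^ n * t ^ n) := by
        rw [← mul_assoc, e3, one_mul]
    _ ≤ ((θ / δ) ^ θ) ^ n * ((n.factorial : ℝ) ^ θ * Real.exp (δ * t ^ (1 / θ))) := by gcongr
    _ = _ := by ring

/-- Bounds on all moments give exponential decay. -/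
theorem le_exp_of_forall_pow_mul_le (hθ : 0 < θ) {h t a M : ℝ} (hh : 0 < h) (ht : 0 ≤ t)
    (ha : 0 ≤ a) (H : ∀ n : ℕ, t ^ n * a ≤ M * h ^ n * (n.factorial : ℝ) ^ θ) :
    a ≤ Real.exp 1 * M * Real.exp (-((t / (Real.exp 1 * h)) ^ (1 / θ))) := by
  have hM : 0 ≤ M := by simpa using ha.trans (by simpa using H 0)
  -- The useful moment is n = ⌊s⌋: there n^θ ≤ t/(eh), so h^n n!^θ ≤ (t/e)^n and a ≤ M e^{-n}, which
  -- differs from M e^{-s} by at most a factor e.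
  set s := (t / (Real.exp 1 * h)) ^ (1 / θ) with hs
  have hs0 : 0 ≤ s := by positivity
  obtain ⟨n, hn1, hn2⟩ : ∃ n : ℕ, (n : ℝ) ≤ s ∧ s < n + 1 :=
    ⟨⌊s⌋₊, Nat.floor_le hs0, Nat.lt_floor_add_one s⟩
  have hexp : Real.exp (-(n : ℝ)) ≤ Real.exp 1 * Real.exp (-s) := by
    rw [← Real.exp_add]; exact Real.exp_le_exp.2 (by linarith)
  suffices a ≤ M * Real.exp (-(n : ℝ)) by
    calc a ≤ M * Real.exp (-(n : ℝ)) := this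
      _ ≤ M * (Real.exp 1 * Real.exp (-s)) := by gcongr
      _ = _ := by ring
  rcases Nat.eq_zero_or_pos n with rfl | hnpos
  · simpa using H 0
  have hn0 : (0 : ℝ) < n := by exact_mod_cast hnpos
  have ht0 : 0 < t := by
    rcases ht.eq_or_lt with h0 | h0
    · rw [← h0] at hs
      simp [hθ.ne'] at hs
      linarith
    · exact h0
  have h1 : (n : ℝ) ^ θ ≤ t / (Real.exp 1 * h) := by
    have := Real.rpow_le_rpow hn0.le hn1 hθ.le
    rwa [hs, ← Real.rpow_mul (by positivity), one_div_mul_cancel hθ.ne', Real.rpow_one] at this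
  have h2 : (n.factorial : ℝ) ^ θ ≤ (t / (Real.exp 1 * h)) ^ n := by
    calc (n.factorial : ℝ) ^ θ ≤ ((n : ℝ) ^ n) ^ θ := by
          gcongr
          exact_mod_cast Nat.factorial_le_pow n
      _ = ((n : ℝ) ^ θ) ^ n := by
          rw [← Real.rpow_natCast, ← Real.rpow_mul hn0.le, mul_comm, Real.rpow_mul hn0.le,
            Real.rpow_natCast]
      _ ≤ _ := by gcongr
  have h3 := H n
  have h4 : t ^ n * a ≤ t ^ n * (M * Real.exp (-(n : ℝ))) := by
    calc t ^ n * a ≤ M * h ^ n * (n.factorial : ℝ) ^ θ := h3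
      _ ≤ M * h ^ n * (t / (Real.exp 1 * h)) ^ n := by gcongr
      _ = t ^ n * (M * Real.exp (-(n : ℝ))) := by
        rw [Real.exp_neg, ← Real.exp_one_pow, div_pow, mul_pow]
        field_simp
  exact le_of_mul_le_mul_left h4 (by positivity)

end Exponents

theorem norm_rpow_le_of_forall {𝕜 : Type*} [RCLike 𝕜] {d : ℕ} {r B : ℝ} (hr : 0 < r) (hB : 0 ≤ B)
    (x : EuclideanSpace 𝕜 (Fin d)) (H : ∀ i, ‖x i‖ ^ r ≤ B) : ‖x‖ ^ r ≤ (d : ℝ) ^ r * B := by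
  have h1 : ‖x‖ ≤ d * B ^ (1 / r) := by
    have hi : ∀ i, ‖x i‖ ≤ B ^ (1 / r) := fun i => by
      have := Real.rpow_le_rpow (by positivity) (H i) (z := 1 / r) (by positivity)
      rwa [← Real.rpow_mul (norm_nonneg _), mul_one_div_cancel hr.ne', Real.rpow_one] at this
    rw [EuclideanSpace.norm_eq]
    refine Real.sqrt_le_iff.2 ⟨by positivity, ?_⟩
    calc ∑ i, ‖x i‖ ^ 2 ≤ ∑ i : Fin d, (B ^ (1 / r)) ^ 2 := by
          gcongr with i; exact hi i
      _ = d * (B ^ (1 / r)) ^ 2 := by simp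
      _ ≤ (d : ℝ) ^ 2 * (B ^ (1 / r)) ^ 2 := by
          gcongr
          exact_mod_cast Nat.le_self_pow two_ne_zero d
      _ = _ := by ring
  refine (Real.rpow_le_rpow (norm_nonneg _) h1 hr.le).trans_eq ?_
  rw [Real.mul_rpow (by positivity) (by positivity), ← Real.rpow_mul hB, one_div_mul_cancel hr.ne',
    Real.rpow_one]

/-- Bounds on all moments in each coordinate give exponential decay. -/
theorem exists_decay_of_moments (d : ℕ) {θ h : ℝ} (hθ : 0 < θ) (hh : 0 < h) :
    ∃ ε > 0, ∀ (M a : ℝ) (y : EuclideanSpace ℝ (Fin d)), 0 ≤ a → a ≤ M →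
      (∀ (j : Fin d) (n : ℕ), |y j| ^ n * a ≤ M * h ^ n * (n.factorial : ℝ) ^ θ) →
      a ≤ Real.exp 1 * M * Real.exp (-ε * ‖y‖ ^ (1 / θ)) := by
  -- `d + 1` in place of `d` keeps the rate positive when d = 0.
  refine ⟨((Real.exp 1 * h) ^ (1 / θ) * ((d : ℝ) + 1) ^ (1 / θ))⁻¹, by positivity,
    fun M a y ha haM H => ?_⟩
  have hM : 0 ≤ M := ha.trans haM
  rcases ha.eq_or_lt with h0 | hapos
  · rw [← h0]; positivity
  have hMpos : 0 < M := hapos.trans_le haM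
  -- In logarithmic form the decay in each coordinate reads |y_j|^{1/θ} ≤ B with the same B for all
  -- j. The bound then passes to ‖y‖ and is exponentiated back, so the prefactor e·M does not depend
  -- on d.
  set B := (Real.exp 1 * h) ^ (1 / θ) * (1 + Real.log (M / a)) with hB
  have hlog : 0 ≤ Real.log (M / a) := Real.log_nonneg ((one_le_div hapos).2 haM)
  have key : ‖y‖ ^ (1 / θ) ≤ (d : ℝ) ^ (1 / θ) * B := by
    refine norm_rpow_le_of_forall (by positivity) (by positivity) y fun j => ?_
    have h1 := le_exp_of_forall_pow_mul_le hθ hh (abs_nonneg (y j)) ha (H j)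
    have h2 := Real.log_le_log hapos h1
    rw [Real.log_mul (by positivity) (by positivity), Real.log_mul (by positivity) hMpos.ne',
      Real.log_exp, Real.log_exp, Real.div_rpow (abs_nonneg _) (by positivity)] at h2
    rw [hB, Real.log_div hMpos.ne' hapos.ne', Real.norm_eq_abs]
    have h3 : |y j| ^ (1 / θ) / (Real.exp 1 * h) ^ (1 / θ) ≤ 1 + (Real.log M - Real.log a) := by
      linarith
    rw [div_le_iff₀ (by positivity)] at h3
    linarith
  have key2 : ((Real.exp 1 * h) ^ (1 / θ) * ((d : ℝ) + 1) ^ (1 / θ))⁻¹ * ‖y‖ ^ (1 / θ) ≤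
      1 + Real.log (M / a) := by
    rw [inv_mul_le_iff₀ (by positivity)]
    refine key.trans ?_
    rw [hB, mul_left_comm, ← mul_assoc]
    gcongr
    linarith
  rw [Real.log_div hMpos.ne' hapos.ne'] at key2
  rw [← Real.log_le_log_iff hapos (by positivity), Real.log_mul (by positivity) (by positivity),
    Real.log_mul (by positivity) hMpos.ne', Real.log_exp, Real.log_exp]
  linarith

/-! ### Cauchy estimates with factorial losses -/

/-- A radius (n+1)^{1-θ} in Cauchy's inequality cancels the part n!^{1-θ} of n! and leaves exactly
the Gevrey factor n!^θ. -/
theorem factorial_div_rpow_le {θ : ℝ} (hθ' : θ < 1) (n : ℕ) :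
    (n.factorial : ℝ) / (((n : ℝ) + 1) ^ (1 - θ)) ^ n ≤ (n.factorial : ℝ) ^ θ := by
  rw [div_le_iff₀ (by positivity)]
  have h1 : (n.factorial : ℝ) = (n.factorial : ℝ) ^ θ * (n.factorial : ℝ) ^ (1 - θ) := by
    rw [← Real.rpow_add (by positivity)]; simp
  nth_rewrite 1 [h1]
  gcongr
  rw [← Real.rpow_natCast, ← Real.rpow_mul (by positivity), mul_comm,
    Real.rpow_mul (by positivity), Real.rpow_natCast]
  have h2 : (n.factorial : ℝ) ≤ ((n : ℝ) + 1) ^ n := by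
    exact_mod_cast (Nat.factorial_le_pow n).trans (Nat.pow_le_pow_left (Nat.le_succ n) n)
  exact Real.rpow_le_rpow (by positivity) h2 (by linarith)

/-- On the polydisc of radii (β_i+1)^{1-θ} the exponent 1/(1-θ) undoes the radius: ‖w‖^{1/(1-θ)} is
at most a constant times |β| + d, so the growth of F costs only a geometric factor. -/
theorem exists_norm_mderiv_le (d : ℕ) {θ : ℝ} (hθ' : θ < 1) {L : ℝ} (hL : 0 ≤ L) :
    ∃ C > 0, ∀ (F : EuclideanSpace ℂ (Fin d) → ℂ), ContDiff ℂ ∞ F →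
      ∀ (z : EuclideanSpace ℂ (Fin d)) (N : ℝ), 0 ≤ N →
      (∀ w, ‖F (z + w)‖ ≤ N * Real.exp (L * ‖w‖ ^ (1 / (1 - θ)))) →
      ∀ β : Fin d → ℕ, ‖mderiv ℂ β F z‖ ≤ N * C ^ (mlen β + 1) * mfact β ^ θ := by
  have hq : 0 < 1 - θ := by linarith
  set A := L * (d : ℝ) ^ (1 / (1 - θ)) with hA
  have hA0 : 0 ≤ A := by positivity
  refine ⟨Real.exp (A * (d + 1)), by positivity, fun F hF z N hN H β => ?_⟩
  have hC := FBIPhase.norm_mderivList_le hF β (fun i => ((β i : ℝ) + 1) ^ (1 - θ))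
    (fun i => by positivity) (N * Real.exp (A * (mlen β + d))) (List.finRange d)
    (List.nodup_finRange d) z (by
      intro w' h1 _
      have h2 := H (w' - z)
      rw [add_sub_cancel] at h2
      refine h2.trans (mul_le_mul_of_nonneg_left (Real.exp_le_exp.2 ?_) hN)
      rw [hA, mul_assoc]
      gcongr
      refine norm_rpow_le_of_forall (by positivity) (by positivity) _ fun i => ?_
      have h3 := h1 i (List.mem_finRange i)
      rw [PiLp.sub_apply]
      refine (Real.rpow_le_rpow (norm_nonneg _) h3 (by positivity)).trans ?_
      rw [← Real.rpow_mul (by positivity), mul_one_div_cancel hq.ne', Real.rpow_one]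
      have h4 : (β i : ℝ) ≤ mlen β := by
        exact_mod_cast Finset.single_le_sum (f := β) (fun _ _ => Nat.zero_le _) (Finset.mem_univ i)
      have h5 : (1 : ℝ) ≤ d := by exact_mod_cast i.pos
      linarith)
  have hprod : ((List.finRange d).map fun i =>
        ((β i).factorial : ℝ) / (((β i : ℝ) + 1) ^ (1 - θ)) ^ β i).prod
      = ∏ i, ((β i).factorial : ℝ) / (((β i : ℝ) + 1) ^ (1 - θ)) ^ β i := by
    rw [← List.ofFn_eq_map, List.prod_ofFn]
  rw [hprod] at hC
  have hβ : ∏ i, ((β i).factorial : ℝ) / (((β i : ℝ) + 1) ^ (1 - θ)) ^ β i ≤ mfact β ^ θ := by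
    rw [mfact, ← Real.finsetProd_rpow _ _ fun i _ => by positivity]
    exact Finset.prod_le_prod (fun i _ => by positivity) fun i _ => factorial_div_rpow_le hθ' _
  have hexp : Real.exp (A * (mlen β + d)) ≤ Real.exp (A * (d + 1)) ^ (mlen β + 1) := by
    rw [← Real.exp_nat_mul]
    refine Real.exp_le_exp.2 ?_
    push_cast
    have : 0 ≤ A * (mlen β * d + 1) := by positivity
    nlinarith
  have := Real.rpow_nonneg (mfact_pos β).le θ
  calc ‖mderiv ℂ β F z‖ ≤ _ := hC
    _ ≤ mfact β ^ θ * (N * Real.exp (A * (d + 1)) ^ (mlen β + 1)) := by gcongr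
    _ = _ := by ring

/-- An entire function that decays along `ℝ ^ d` and grows in a controlled way off `ℝ ^ d` restricts
to an element of the Gelfand-Shilov space. -/
theorem exists_normLE_of_entire (d : ℕ) {θ : ℝ} (hθ : 1 / 2 ≤ θ) (hθ' : θ < 1) {ε L : ℝ}
    (hε : 0 < ε) (hL : 0 ≤ L) :
    ∃ h > 0, ∃ C > 0, ∀ (F : EuclideanSpace ℂ (Fin d) → ℂ), ContDiff ℂ ∞ F → ∀ M : ℝ, 0 ≤ M →
      (∀ (x : EuclideanSpace ℝ (Fin d)) (w : EuclideanSpace ℂ (Fin d)),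
        ‖F (FBIPhase.incl x + w)‖ ≤
          M * Real.exp (-ε * ‖x‖ ^ (1 / θ) + L * ‖w‖ ^ (1 / (1 - θ)))) →
      NormLE θ h (C * M) (F ∘ FBIPhase.incl) := by
  have hθ0 : 0 < θ := by linarith
  obtain ⟨C, hC, HC⟩ := exists_norm_mderiv_le d hθ' hL
  -- The rate ε/(d+1) is spent once per coordinate; the total stays below ε‖x‖^{1/θ}, also for d =
  -- 0.
  obtain ⟨h₀, hh₀, Hh⟩ := exists_pow_le_exp hθ0 (δ := ε / (d + 1)) (by positivity)
  refine ⟨max C h₀, lt_max_of_lt_left hC, C, hC, fun F hF M hM H α β x => ?_⟩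
  have h1 := HC F hF (FBIPhase.incl x) (M * Real.exp (-ε * ‖x‖ ^ (1 / θ))) (by positivity)
    (fun w => (H x w).trans_eq (by rw [Real.exp_add]; ring)) β
  have hα : |mpow x α| * Real.exp (-ε * ‖x‖ ^ (1 / θ)) ≤ h₀ ^ mlen α * mfact α ^ θ := by
    have e1 : |mpow x α| ≤ ∏ i, (h₀ ^ α i * ((α i).factorial : ℝ) ^ θ *
        Real.exp (ε / (d + 1) * |x i| ^ (1 / θ))) := by
      rw [mpow, Finset.abs_prod]
      refine Finset.prod_le_prod (fun i _ => abs_nonneg _) fun i _ => ?_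
      rw [abs_pow]
      exact Hh (α i) |x i| (abs_nonneg _)
    have e2 : ∑ i, ε / (d + 1) * |x i| ^ (1 / θ) ≤ ε * ‖x‖ ^ (1 / θ) := by
      calc ∑ i, ε / (d + 1) * |x i| ^ (1 / θ) ≤ ∑ _i : Fin d, ε / (d + 1) * ‖x‖ ^ (1 / θ) := by
            gcongr with i
            simpa using PiLp.norm_apply_le x i
        _ = d / (d + 1) * (ε * ‖x‖ ^ (1 / θ)) := by simp; ring
        _ ≤ 1 * (ε * ‖x‖ ^ (1 / θ)) := by
            gcongr
            rw [div_le_one (by positivity)]; linarith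
        _ = _ := one_mul _
    rw [Finset.prod_mul_distrib, Finset.prod_mul_distrib, Finset.prod_pow_eq_pow_sum,
      Real.finsetProd_rpow _ _ fun i _ => by positivity, ← Real.exp_sum] at e1
    have := Real.rpow_nonneg (mfact_pos α).le θ
    calc |mpow x α| * Real.exp (-ε * ‖x‖ ^ (1 / θ))
        ≤ h₀ ^ mlen α * mfact α ^ θ * Real.exp (ε * ‖x‖ ^ (1 / θ)) *
          Real.exp (-ε * ‖x‖ ^ (1 / θ)) := by
          gcongr
          refine e1.trans ?_
          rw [mlen, mfact]
          gcongr
      _ = _ := by rw [mul_assoc, ← Real.exp_add]; simp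
  have hβ0 := Real.rpow_nonneg (mfact_pos β).le θ
  have hα0 := Real.rpow_nonneg (mfact_pos α).le θ
  rw [mderiv, FBIPhase.mderivList_comp_incl hF, norm_mul, Complex.norm_real, Real.norm_eq_abs,
    Function.comp_apply]
  calc |mpow x α| * ‖mderiv ℂ β F (FBIPhase.incl x)‖
      ≤ |mpow x α| * (M * Real.exp (-ε * ‖x‖ ^ (1 / θ)) * C ^ (mlen β + 1) * mfact β ^ θ) := by
        gcongr
    _ = C * M * C ^ mlen β * (|mpow x α| * Real.exp (-ε * ‖x‖ ^ (1 / θ))) * mfact β ^ θ := by ring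
    _ ≤ C * M * (max C h₀) ^ mlen β * ((max C h₀) ^ mlen α * mfact α ^ θ) * mfact β ^ θ := by
        have hα' : |mpow x α| * Real.exp (-ε * ‖x‖ ^ (1 / θ)) ≤
            (max C h₀) ^ mlen α * mfact α ^ θ := by
          refine hα.trans ?_
          gcongr
          exact le_max_right _ _
        refine mul_le_mul_of_nonneg_right (mul_le_mul ?_ hα' (by positivity) (by positivity)) hβ0
        gcongr
        exact le_max_left _ _
    _ = _ := by rw [pow_add]; ring

end

section

/-! ### Differentiable functions of several complex variables are analytic -/

theorem norm_torusMap_zero_one {n : ℕ} (t : Fin n → ℝ) (i : Fin n) :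
    ‖torusMap 0 (fun _ => 1) t i‖ = 1 := by
  simp [torusMap]

theorem torusMap_sub_ne_zero {n : ℕ} {z : Fin n → ℂ} (hz : ∀ i, ‖z i‖ < 1) (t : Fin n → ℝ)
    (i : Fin n) : torusMap 0 (fun _ => 1) t i - z i ≠ 0 := by
  intro h
  have := norm_torusMap_zero_one t i
  rw [sub_eq_zero.1 h] at this
  exact (hz i).ne this

theorem continuous_torusMap {n : ℕ} (c : Fin n → ℂ) (R : Fin n → ℝ) :
    Continuous (torusMap c R) := by
  unfold torusMap; fun_prop

theorem continuous_torusMap_apply {n : ℕ} (i : Fin n) :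
    Continuous fun t => torusMap 0 (fun _ => 1) t i := by
  unfold torusMap; fun_prop

/-- Cauchy's integral formula on the unit polydisc. -/
theorem torusIntegral_cauchy (n : ℕ) (f : (Fin n → ℂ) → ℂ) (hf : Differentiable ℂ f)
    (z : Fin n → ℂ) (hz : ∀ i, ‖z i‖ < 1) :
    (∯ w in T(0, fun _ => 1), (∏ i, (w i - z i)⁻¹) * f w) =
      (2 * Real.pi * Complex.I) ^ n * f z := by
  induction n with
  | zero =>
    rw [torusIntegral_dim0]
    simp [Subsingleton.elim (0 : Fin 0 → ℂ) z]
  | succ n ih =>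
    rw [torusIntegral_succ]
    · have inner : ∀ x : ℂ, (∯ y in T((0 : Fin (n + 1) → ℂ) ∘ Fin.succ, (fun _ => 1) ∘ Fin.succ),
          (∏ i, ((Fin.cons x y : Fin (n + 1) → ℂ) i - z i)⁻¹) * f (Fin.cons x y)) =
          (x - z 0)⁻¹ • ((2 * Real.pi * Complex.I) ^ n * f (Fin.cons x (Fin.tail z))) := by
        intro x
        have hd : Differentiable ℂ fun y : Fin n → ℂ => f (Fin.cons x y) := by
          refine hf.comp ?_
          rw [differentiable_pi]
          intro i
          refine Fin.cases ?_ (fun j => ?_) i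
          · simp
          · simpa using differentiable_apply j
        have := ih (fun y => f (Fin.cons x y)) hd (Fin.tail z) fun i => hz i.succ
        rw [← this, smul_eq_mul, ← torusIntegral_const_mul]
        congr 1
        funext y
        rw [Fin.prod_univ_succ]
        simp [Fin.tail, mul_assoc]
      simp only [inner, Pi.zero_apply]
      have hd : Differentiable ℂ fun x : ℂ =>
          (2 * Real.pi * Complex.I) ^ n * f (Fin.cons x (Fin.tail z)) := by
        refine (hf.comp ?_).const_mul _
        rw [differentiable_pi]
        intro i
        refine Fin.cases ?_ (fun j => ?_) i
        · simp
        · simp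
      have := DifferentiableOn.circleIntegral_sub_inv_smul (R := 1) (c := 0) (w := z 0)
        (hd.differentiableOn) (by simpa using hz 0)
      rw [this, Fin.cons_self_tail, smul_eq_mul]
      ring
    · have hcont : Continuous fun t : Fin (n + 1) → ℝ =>
          (∏ i, (torusMap 0 (fun _ => 1) t i - z i)⁻¹) * f (torusMap 0 (fun _ => 1) t) := by
        refine Continuous.mul ?_ (hf.continuous.comp (continuous_torusMap _ _))
        refine continuous_finsetProd _ fun i _ => Continuous.inv₀ ?_ fun t =>
          torusMap_sub_ne_zero hz t i
        exact (continuous_torusMap_apply i).fun_sub continuous_const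
      exact hcont.continuousOn.integrableOn_compact isCompact_Icc

/-- Cauchy's formula reads f(z) = const · Λ(G(z)⁻¹), where G(z) = ∏(W_i - z_i) takes values in the
Banach algebra C(K, ℂ) of the torus and Λ integrates against f. Since G is a polynomial in z with
G(0) a unit, analyticity of f follows from that of inversion at units, without summing a power
series. -/
theorem analyticAt_zero_of_differentiable {n : ℕ} {f : (Fin n → ℂ) → ℂ}
    (hf : Differentiable ℂ f) : AnalyticAt ℂ f 0 := by
  let K : Set (Fin n → ℝ) := Set.Icc 0 fun _ => 2 * Real.pi
  have : CompactSpace K := isCompact_iff_compactSpace.1 isCompact_Icc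
  let μ : Measure K := Measure.comap Subtype.val volume
  have : IsFiniteMeasure μ := ⟨by
    rw [comap_subtype_coe_apply measurableSet_Icc, Set.image_univ, Subtype.range_coe]
    exact isCompact_Icc.measure_lt_top⟩
  let W : Fin n → C(K, ℂ) := fun i =>
    ⟨fun t => torusMap 0 (fun _ => 1) t.1 i,
      (continuous_torusMap_apply i).comp continuous_subtype_val⟩
  let m : C(K, ℂ) :=
    ⟨fun t => (∏ i, (1 : ℂ) * Complex.exp (t.1 i * Complex.I) * Complex.I) *
      f (torusMap 0 (fun _ => 1) t.1), by
      refine Continuous.mul ?_ (hf.continuous.comp ((continuous_torusMap _ _).comp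
        continuous_subtype_val))
      refine continuous_finsetProd _ fun i _ => ?_
      have : Continuous fun t : K => t.1 i := (continuous_apply i).comp continuous_subtype_val
      have h2 : Continuous fun s : ℝ => (1 : ℂ) * Complex.exp (s * Complex.I) * Complex.I := by
        fun_prop
      exact h2.comp this⟩
  have hint : ∀ g : C(K, ℂ), Integrable (fun t : K => g t) μ := fun g =>
    (integrable_const ‖g‖).mono' g.continuous.aestronglyMeasurable
      (Filter.Eventually.of_forall fun t => g.norm_coe_le_norm t)
  let Λ : C(K, ℂ) →L[ℂ] ℂ := LinearMap.mkContinuous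
    { toFun := fun g => ∫ t : K, (g * m) t ∂μ
      map_add' := fun g h => by
        rw [← integral_add (hint _) (hint _)]
        congr 1; funext t; simp [add_mul]
      map_smul' := fun c g => by
        rw [RingHom.id_apply, ← integral_smul]
        congr 1; funext t; simp }
    (‖m‖ * μ.real Set.univ) (fun g => by
      refine (norm_integral_le_of_norm_le_const (C := ‖g‖ * ‖m‖)
        (Filter.Eventually.of_forall fun t => ?_)).trans_eq (by ring)
      exact ((g * m).norm_coe_le_norm t).trans (norm_mul_le _ _))
  let G : (Fin n → ℂ) → C(K, ℂ) := fun z => ∏ i, (W i - z i • 1)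
  have hGan : AnalyticAt ℂ G 0 := by
    refine Finset.analyticAt_fun_prod _ fun i _ => analyticAt_const.sub ?_
    exact ((ContinuousLinearMap.proj (R := ℂ) (φ := fun _ : Fin n => ℂ) i).analyticAt 0).smul
      analyticAt_const
  have hunit : ∀ z : Fin n → ℂ, (∀ i, ‖z i‖ < 1) → ∃ u : C(K, ℂ)ˣ, (u : C(K, ℂ)) = G z ∧
      ∀ t : K, ((u⁻¹ : C(K, ℂ)ˣ) : C(K, ℂ)) t = ∏ i, (torusMap 0 (fun _ => 1) t.1 i - z i)⁻¹ := by
    intro z hz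
    let H : C(K, ℂ) := ⟨fun t => ∏ i, (torusMap 0 (fun _ => 1) t.1 i - z i)⁻¹, by
      refine continuous_finsetProd _ fun i _ => Continuous.inv₀ ?_ fun t =>
          torusMap_sub_ne_zero hz t.1 i
      exact ((continuous_torusMap_apply i).comp continuous_subtype_val).fun_sub continuous_const⟩
    have hGH : G z * H = 1 := by
      ext t
      simp only [G, H, W, ContinuousMap.mul_apply, ContinuousMap.coe_prod, Finset.prod_apply,
        ContinuousMap.sub_apply, ContinuousMap.coe_mk, ContinuousMap.smul_apply,
        ContinuousMap.one_apply, smul_eq_mul, mul_one]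
      rw [← Finset.prod_mul_distrib]
      exact Finset.prod_eq_one fun i _ => mul_inv_cancel₀ (torusMap_sub_ne_zero hz t.1 i)
    exact ⟨⟨G z, H, hGH, by rw [mul_comm]; exact hGH⟩, rfl, fun t => rfl⟩
  have hinv : AnalyticAt ℂ (fun z => Ring.inverse (G z)) 0 := by
    obtain ⟨u, hu, -⟩ := hunit 0 (by simp)
    have := analyticAt_inverse (𝕜 := ℂ) u
    rw [hu] at this
    exact this.comp hGan
  have hfin : AnalyticAt ℂ (fun z => ((2 * Real.pi * Complex.I) ^ n)⁻¹ *
      Λ (Ring.inverse (G z))) 0 :=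
    analyticAt_const.mul ((Λ.analyticAt _).comp hinv)
  refine hfin.congr ?_
  have hev : ∀ᶠ z : Fin n → ℂ in nhds 0, ∀ i, ‖z i‖ < 1 := by
    rw [Filter.eventually_all]
    intro i
    have : Continuous fun z : Fin n → ℂ => ‖z i‖ := by fun_prop
    exact this.continuousAt.eventually_lt continuousAt_const (by simp)
  filter_upwards [hev] with z hz
  obtain ⟨u, hu, hui⟩ := hunit z hz
  have h2 : ((2 : ℂ) * Real.pi * Complex.I) ^ n ≠ 0 :=
    pow_ne_zero _ Complex.two_pi_I_ne_zero
  rw [inv_mul_eq_iff_eq_mul₀ h2, ← torusIntegral_cauchy n f hf z hz, ← hu, Ring.inverse_unit,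
    torusIntegral]
  change ∫ t : K, _ ∂μ = _
  rw [← integral_subtype_comap measurableSet_Icc]
  refine integral_congr_ae (Filter.Eventually.of_forall fun t => ?_)
  simp only [ContinuousMap.mul_apply, hui, m, ContinuousMap.coe_mk, smul_eq_mul,
    Complex.ofReal_one]
  ring

theorem analyticOnNhd_of_differentiable {d : ℕ} {f : EuclideanSpace ℂ (Fin d) → ℂ}
    (hf : Differentiable ℂ f) : AnalyticOnNhd ℂ f Set.univ := by
  intro z _
  let e := EuclideanSpace.equiv (Fin d) ℂ
  have h1 : Differentiable ℂ fun w : Fin d → ℂ => f (z + e.symm w) :=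
    hf.comp ((differentiable_const z).add e.symm.differentiable)
  have h2 := analyticAt_zero_of_differentiable h1
  have h3 : AnalyticAt ℂ (fun w => e (w - z)) z :=
    ((e : EuclideanSpace ℂ (Fin d) →L[ℂ] (Fin d → ℂ)).analyticAt _).comp
      (analyticAt_id.sub analyticAt_const)
  have h4 := AnalyticAt.fun_comp (by simpa using h2) h3
  refine h4.congr (Filter.Eventually.of_forall fun w => ?_)
  simp

theorem contDiff_of_differentiable {d : ℕ} {f : EuclideanSpace ℂ (Fin d) → ℂ}
    (hf : Differentiable ℂ f) : ContDiff ℂ ∞ f :=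
  (analyticOnNhd_of_differentiable hf).contDiff

end

section

/-! ### Gaussian wave packets -/

section Vectors

variable {d : ℕ}

/-- The coordinatewise imaginary part. -/
def imv (ζ : EuclideanSpace ℂ (Fin d)) : EuclideanSpace ℝ (Fin d) :=
  WithLp.toLp 2 fun i => (ζ i).im

theorem imv_apply (ζ : EuclideanSpace ℂ (Fin d)) (i : Fin d) : imv ζ i = (ζ i).im := rfl

theorem norm_imv_le (ζ : EuclideanSpace ℂ (Fin d)) : ‖imv ζ‖ ≤ ‖ζ‖ := by
  rw [EuclideanSpace.norm_eq, EuclideanSpace.norm_eq]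
  gcongr with i
  exact Complex.abs_im_le_norm (ζ i)

theorem exists_norm_mulVec_le {𝕜 : Type*} [RCLike 𝕜] (M : Matrix (Fin d) (Fin d) 𝕜) :
    ∃ K ≥ 0, ∀ v : EuclideanSpace 𝕜 (Fin d), ‖WithLp.toLp 2 (M *ᵥ v.ofLp)‖ ≤ K * ‖v‖ :=
  ⟨‖LinearMap.toContinuousLinearMap (Matrix.toEuclideanLin M)‖, norm_nonneg _, fun v =>
    (LinearMap.toContinuousLinearMap (Matrix.toEuclideanLin M)).le_opNorm v⟩

theorem norm_dotProduct_le (ζ w : EuclideanSpace ℂ (Fin d)) :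
    ‖ζ.ofLp ⬝ᵥ w.ofLp‖ ≤ ‖ζ‖ * ‖w‖ := by
  have h : ζ.ofLp ⬝ᵥ w.ofLp = inner ℂ (WithLp.toLp 2 fun i => star (ζ i)) w := by
    simp [PiLp.inner_apply, dotProduct, mul_comm]
  rw [h]
  refine (norm_inner_le_norm _ _).trans_eq ?_
  congr 1
  simp [EuclideanSpace.norm_eq]

end Vectors

variable {d : ℕ}

/-- The dual quadratic weight `½ ⟨S⁻¹ η, η⟩`. -/
def wt (S : Matrix (Fin d) (Fin d) ℝ) (η : EuclideanSpace ℝ (Fin d)) : ℝ :=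
  (1 / 2) * ((S⁻¹ *ᵥ η.ofLp) ⬝ᵥ η.ofLp)

/-- The point `-S⁻¹ η`, where `y ↦ -⟨η, y⟩ - ½ ⟨S y, y⟩` is maximal. -/
def cen (S : Matrix (Fin d) (Fin d) ℝ) (η : EuclideanSpace ℝ (Fin d)) :
    EuclideanSpace ℝ (Fin d) :=
  WithLp.toLp 2 (-(S⁻¹ *ᵥ η.ofLp))

theorem continuous_wt (S : Matrix (Fin d) (Fin d) ℝ) : Continuous (wt S) := by
  unfold wt; fun_prop

theorem symm_dotProduct {S : Matrix (Fin d) (Fin d) ℝ} (hS : S.PosDef) (v w : Fin d → ℝ) :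
    (S *ᵥ v) ⬝ᵥ w = (S *ᵥ w) ⬝ᵥ v := by
  have h : Sᵀ = S := by
    rw [← Matrix.conjTranspose_eq_transpose_of_trivial]; exact hS.isHermitian.eq
  rw [dotProduct_comm, Matrix.dotProduct_mulVec, ← Matrix.mulVec_transpose, h]

theorem mulVec_cen {S : Matrix (Fin d) (Fin d) ℝ} (hS : S.PosDef) (η : EuclideanSpace ℝ (Fin d)) :
    S *ᵥ (cen S η).ofLp = -η.ofLp := by
  have : IsUnit S.det := (Matrix.isUnit_iff_isUnit_det S).1 hS.isUnit
  simp [cen, Matrix.mulVec_neg, Matrix.mul_nonsing_inv S this]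

/-- The left side is the logarithm of the modulus of a packet at a real point. The identity exhibits
its maximum `wt S η`, which is the source of Φ, and Gaussian decay about `cen S η`. -/
theorem complete_square {S : Matrix (Fin d) (Fin d) ℝ} (hS : S.PosDef)
    (η y : EuclideanSpace ℝ (Fin d)) :
    -(η.ofLp ⬝ᵥ y.ofLp) - (1 / 2) * ((S *ᵥ y.ofLp) ⬝ᵥ y.ofLp) =
      wt S η - (1 / 2) * ((S *ᵥ (y - cen S η).ofLp) ⬝ᵥ (y - cen S η).ofLp) := by
  have h1 := mulVec_cen hS η
  have h2 : wt S η = (1 / 2) * ((S *ᵥ (cen S η).ofLp) ⬝ᵥ (cen S η).ofLp) := by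
    rw [h1, wt, cen]
    simp [dotProduct_comm]
  have h3 : (S *ᵥ y.ofLp) ⬝ᵥ (cen S η).ofLp = -(η.ofLp ⬝ᵥ y.ofLp) := by
    rw [symm_dotProduct hS, h1, neg_dotProduct]
  rw [h2, WithLp.ofLp_sub, Matrix.mulVec_sub, sub_dotProduct, dotProduct_sub, dotProduct_sub,
    h3, symm_dotProduct hS (cen S η).ofLp y.ofLp, h3]
  ring

/-- The Gaussian wave packet `w ↦ exp (i ⟨ζ, w⟩ + (i / 2) ⟨C w, w⟩)`. -/
def gker (C : Matrix (Fin d) (Fin d) ℂ) (ζ w : EuclideanSpace ℂ (Fin d)) : ℂ :=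
  Complex.exp (Complex.I * (ζ.ofLp ⬝ᵥ w.ofLp + (1 / 2) * ((C *ᵥ w.ofLp) ⬝ᵥ w.ofLp)))

variable (C : Matrix (Fin d) (Fin d) ℂ)

theorem contDiff_gker (ζ : EuclideanSpace ℂ (Fin d)) : ContDiff ℂ ∞ (gker C ζ) := by
  unfold gker dotProduct Matrix.mulVec dotProduct
  fun_prop

theorem continuous_gker :
    Continuous fun p : EuclideanSpace ℂ (Fin d) × EuclideanSpace ℂ (Fin d) => gker C p.1 p.2 := by
  unfold gker dotProduct Matrix.mulVec dotProduct
  fun_prop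

/-- A shift of frequency is multiplication by an exponential. Real shifts thereby bring in the
Fourier transform, and complex ones reduce Taylor expansion in ζ to that of exp. -/
theorem gker_add (ζ τ w : EuclideanSpace ℂ (Fin d)) :
    gker C (ζ + τ) w = Complex.exp (Complex.I * (τ.ofLp ⬝ᵥ w.ofLp)) * gker C ζ w := by
  rw [gker, gker, ← Complex.exp_add, WithLp.ofLp_add, add_dotProduct]
  congr 1
  ring

theorem half_mul_im (u : ℂ) : ((1 / 2) * u).im = u.im / 2 := by
  rw [show (1 / 2 : ℂ) = ((1 / 2 : ℝ) : ℂ) by norm_num, Complex.im_ofReal_mul]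
  ring

theorem im_quad_incl (x : EuclideanSpace ℝ (Fin d)) :
    ((C *ᵥ (incl x).ofLp) ⬝ᵥ (incl x).ofLp).im =
      ((C.map Complex.im) *ᵥ x.ofLp) ⬝ᵥ x.ofLp := by
  simp [dotProduct, Matrix.mulVec, FBIPhase.incl_apply, Complex.im_sum]

theorem im_dotProduct_incl (ζ : EuclideanSpace ℂ (Fin d)) (x : EuclideanSpace ℝ (Fin d)) :
    (ζ.ofLp ⬝ᵥ (incl x).ofLp).im = (imv ζ).ofLp ⬝ᵥ x.ofLp := by
  simp [dotProduct, FBIPhase.incl_apply, Complex.im_sum, imv]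

theorem norm_gker (ζ w : EuclideanSpace ℂ (Fin d)) :
    ‖gker C ζ w‖ = Real.exp (-(ζ.ofLp ⬝ᵥ w.ofLp).im - (1 / 2) * ((C *ᵥ w.ofLp) ⬝ᵥ w.ofLp).im) := by
  rw [gker, Complex.norm_exp, Complex.I_mul_re, Complex.add_im, half_mul_im]
  congr 1
  ring

variable {C}

theorem norm_gker_incl (hC : (C.map Complex.im).PosDef) (ζ : EuclideanSpace ℂ (Fin d))
    (y : EuclideanSpace ℝ (Fin d)) :
    ‖gker C ζ (incl y)‖ = Real.exp (wt (C.map Complex.im) (imv ζ) - (1 / 2) *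
      (((C.map Complex.im) *ᵥ (y - cen (C.map Complex.im) (imv ζ)).ofLp) ⬝ᵥ
        (y - cen (C.map Complex.im) (imv ζ)).ofLp)) := by
  rw [norm_gker, im_dotProduct_incl, im_quad_incl, complete_square hC]

theorem norm_gker_incl_le (hC : (C.map Complex.im).PosDef) (ζ : EuclideanSpace ℂ (Fin d))
    (y : EuclideanSpace ℝ (Fin d)) :
    ‖gker C ζ (incl y)‖ ≤ Real.exp (wt (C.map Complex.im) (imv ζ)) := by
  rw [norm_gker_incl hC]
  obtain ⟨c, hc, H⟩ := FBIPhase.exists_coercive hC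
  have h1 := H (y - cen (C.map Complex.im) (imv ζ))
  refine Real.exp_le_exp.2 ?_
  have : 0 ≤ c * ‖y - cen (C.map Complex.im) (imv ζ)‖ ^ 2 := by positivity
  linarith

theorem exists_norm_cen_le (S : Matrix (Fin d) (Fin d) ℝ) :
    ∃ K ≥ 0, ∀ η : EuclideanSpace ℝ (Fin d), ‖cen S η‖ ≤ K * ‖η‖ := by
  obtain ⟨K, hK, H⟩ := exists_norm_mulVec_le S⁻¹
  refine ⟨K, hK, fun η => ?_⟩
  rw [cen, WithLp.toLp_neg, norm_neg]
  exact H η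

/-- Lets decay in the position y near the centre of a packet be read as decay in the frequency η. -/
theorem exists_norm_le_cen {S : Matrix (Fin d) (Fin d) ℝ} (hS : S.PosDef) :
    ∃ K ≥ 0, ∀ η : EuclideanSpace ℝ (Fin d), ‖η‖ ≤ K * ‖cen S η‖ := by
  obtain ⟨K, hK, H⟩ := exists_norm_mulVec_le S
  refine ⟨K, hK, fun η => ?_⟩
  have := H (cen S η)
  rwa [mulVec_cen hS, WithLp.toLp_neg, norm_neg] at this

/-- The wave packet is localized near its centre, also off the real space. -/
theorem exists_norm_gker_le (hC : (C.map Complex.im).PosDef) {θ : ℝ} (hθ : 1 / 2 ≤ θ)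
    (hθ' : θ < 1) :
    ∃ c > 0, ∀ ε > 0, ∃ L ≥ 0, ∀ (ζ : EuclideanSpace ℂ (Fin d)) (x : EuclideanSpace ℝ (Fin d))
      (w : EuclideanSpace ℂ (Fin d)),
      ‖gker C ζ (incl x + w)‖ ≤ Real.exp (wt (C.map Complex.im) (imv ζ) + ε * ‖ζ‖ ^ (1 / θ) -
        c * ‖x - cen (C.map Complex.im) (imv ζ)‖ ^ 2 + L * (1 + ‖w‖ ^ (1 / (1 - θ)))) := by
  obtain ⟨c, hc, Hc⟩ := FBIPhase.exists_coercive hC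
  obtain ⟨K, hK, HK⟩ := FBIPhase.norm_bilin_le C
  obtain ⟨K₀, hK₀, HK₀⟩ := exists_norm_cen_le (C.map Complex.im)
  refine ⟨c / 4, by positivity, fun ε hε => ?_⟩
  -- The cross term ‖ζ‖‖w‖ has coefficient 1 from ⟨ζ, w⟩ and K·K₀ from ⟨Cx, w⟩, because x is within
  -- ‖x - x₀‖ of a centre of norm at most K₀‖ζ‖.
  obtain ⟨Y, hY, HY⟩ := exists_young hθ hθ' hε (1 + K * K₀)
  refine ⟨Y + K ^ 2 / c + K, by positivity, fun ζ x w => ?_⟩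
  set x₀ := cen (C.map Complex.im) (imv ζ) with hx₀
  rw [norm_gker]
  refine Real.exp_le_exp.2 ?_
  have e : -(ζ.ofLp ⬝ᵥ (incl x + w).ofLp).im -
      (1 / 2) * ((C *ᵥ (incl x + w).ofLp) ⬝ᵥ (incl x + w).ofLp).im =
      (-(ζ.ofLp ⬝ᵥ (incl x).ofLp).im - (1 / 2) * ((C *ᵥ (incl x).ofLp) ⬝ᵥ (incl x).ofLp).im) -
      (ζ.ofLp ⬝ᵥ w.ofLp).im - (1 / 2) * ((C *ᵥ (incl x).ofLp) ⬝ᵥ w.ofLp).im -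
      (1 / 2) * ((C *ᵥ w.ofLp) ⬝ᵥ (incl x).ofLp).im - (1 / 2) * ((C *ᵥ w.ofLp) ⬝ᵥ w.ofLp).im := by
    simp only [WithLp.ofLp_add, Matrix.mulVec_add, dotProduct_add, add_dotProduct, Complex.add_im]
    ring
  rw [e, im_dotProduct_incl, im_quad_incl, complete_square hC, ← hx₀]
  have t : ∀ u : ℂ, -u.im ≤ ‖u‖ := fun u => (neg_le_abs _).trans (Complex.abs_im_le_norm u)
  have h1 := (t _).trans (norm_dotProduct_le ζ w)
  have h2 := (t _).trans (HK (incl x) w)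
  have h3 := (t _).trans (HK w (incl x))
  have h4 := (t _).trans (HK w w)
  rw [FBIPhase.norm_incl] at h2 h3
  have h5 := Hc (x - x₀)
  have h6 : ‖x‖ ≤ ‖x - x₀‖ + K₀ * ‖ζ‖ := by
    have h := norm_add_le (x - x₀) x₀
    rw [sub_add_cancel] at h
    have h' : ‖x₀‖ ≤ K₀ * ‖ζ‖ := (HK₀ _).trans (by gcongr; exact norm_imv_le ζ)
    linarith
  have h7 : K * ‖x‖ * ‖w‖ ≤ K * (‖x - x₀‖ + K₀ * ‖ζ‖) * ‖w‖ := by gcongr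
  have h8 : K * ‖x - x₀‖ * ‖w‖ ≤ c / 4 * ‖x - x₀‖ ^ 2 + K ^ 2 / c * ‖w‖ ^ 2 := by
    have h : c / 4 * ‖x - x₀‖ ^ 2 + K ^ 2 / c * ‖w‖ ^ 2 - K * ‖x - x₀‖ * ‖w‖ =
        (c * ‖x - x₀‖ - 2 * K * ‖w‖) ^ 2 / (4 * c) := by
      field_simp; ring
    have : 0 ≤ (c * ‖x - x₀‖ - 2 * K * ‖w‖) ^ 2 / (4 * c) := by positivity
    linarith
  have h9 := HY ‖ζ‖ ‖w‖ (norm_nonneg _) (norm_nonneg _)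
  have h10 := sq_le_one_add_rpow hθ hθ' (norm_nonneg w)
  set Q := ‖w‖ ^ (1 / (1 - θ))
  have h11 : (K ^ 2 / c + K) * ‖w‖ ^ 2 ≤ (K ^ 2 / c + K) * (1 + Q) := by gcongr
  nlinarith

/-- Gaussian decay about the centre is traded for decay about the origin. The price is a multiple of
‖cen‖^{1/θ} ≤ R‖ζ‖^{1/θ}, which fits into the allowance ε if the new rate ε' is small. -/
theorem exists_norm_gker_le_decay (hC : (C.map Complex.im).PosDef) {θ : ℝ} (hθ : 1 / 2 ≤ θ)
    (hθ' : θ < 1) {ε : ℝ} (hε : 0 < ε) :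
    ∃ ε' > 0, ∃ L ≥ 0, ∀ (ζ : EuclideanSpace ℂ (Fin d)) (x : EuclideanSpace ℝ (Fin d))
      (w : EuclideanSpace ℂ (Fin d)),
      ‖gker C ζ (incl x + w)‖ ≤ Real.exp (wt (C.map Complex.im) (imv ζ) + ε * ‖ζ‖ ^ (1 / θ) -
        ε' * ‖x‖ ^ (1 / θ) + L * (1 + ‖w‖ ^ (1 / (1 - θ)))) := by
  obtain ⟨c, hc, Hc⟩ := exists_norm_gker_le hC hθ hθ'
  obtain ⟨L, hL, HL⟩ := Hc (ε / 2) (by positivity)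
  obtain ⟨K₀, hK₀, HK₀⟩ := exists_norm_cen_le (C.map Complex.im)
  set R := K₀ ^ (1 / θ) with hR
  have hR0 : 0 ≤ R := by positivity
  obtain ⟨δ, hδ, hδ1, hδ2⟩ : ∃ δ > 0, 4 * δ ≤ c ∧ 4 * δ * R ≤ ε / 2 := by
    refine ⟨min (c / 4) (ε / (8 * (R + 1))), by positivity, ?_, ?_⟩
    · linarith [min_le_left (c / 4) (ε / (8 * (R + 1)))]
    · have h := min_le_right (c / 4) (ε / (8 * (R + 1)))
      calc 4 * min (c / 4) (ε / (8 * (R + 1))) * R ≤ 4 * (ε / (8 * (R + 1))) * R := by gcongr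
        _ = ε / 2 * (R / (R + 1)) := by field_simp; ring
        _ ≤ ε / 2 * 1 := by gcongr; rw [div_le_one (by positivity)]; linarith
        _ = _ := mul_one _
  refine ⟨δ, hδ, L + c, by positivity, fun ζ x w => (HL ζ x w).trans (Real.exp_le_exp.2 ?_)⟩
  set x₀ := cen (C.map Complex.im) (imv ζ) with hx₀
  have h1 := norm_add_rpow_le hθ (x - x₀) x₀
  rw [sub_add_cancel] at h1
  have h2 := rpow_le_one_add_sq hθ (norm_nonneg (x - x₀))
  have h3 : ‖x₀‖ ^ (1 / θ) ≤ R * ‖ζ‖ ^ (1 / θ) := by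
    rw [hR, ← Real.mul_rpow hK₀ (norm_nonneg _)]
    have : ‖x₀‖ ≤ K₀ * ‖ζ‖ := (HK₀ _).trans (by gcongr; exact norm_imv_le ζ)
    gcongr
  have h4 : δ * ‖x‖ ^ (1 / θ) ≤ 4 * δ * (1 + ‖x - x₀‖ ^ 2) + 4 * δ * R * ‖ζ‖ ^ (1 / θ) := by
    calc δ * ‖x‖ ^ (1 / θ) ≤ δ * (4 * (1 + ‖x - x₀‖ ^ 2 + R * ‖ζ‖ ^ (1 / θ))) := by
          gcongr; linarith
      _ = _ := by ring
  have h5 : 4 * δ * (1 + ‖x - x₀‖ ^ 2) ≤ c * (1 + ‖x - x₀‖ ^ 2) := by gcongr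
  have h6 : 4 * δ * R * ‖ζ‖ ^ (1 / θ) ≤ ε / 2 * ‖ζ‖ ^ (1 / θ) := by gcongr
  have h7 : 0 ≤ c * ‖w‖ ^ (1 / (1 - θ)) := by positivity
  linarith

/-- The polynomial factor ‖w‖^n is absorbed in n! e^{‖w‖}. What remains is exponential of order one
in w, which is harmless against e^{-ε|x|^{1/θ}} because 1/θ > 1. -/
theorem norm_exp_dotProduct_sub_sum_le (n : ℕ) {τ : EuclideanSpace ℂ (Fin d)} (hτ : ‖τ‖ ≤ 1)
    (w : EuclideanSpace ℂ (Fin d)) :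
    ‖Complex.exp (Complex.I * (τ.ofLp ⬝ᵥ w.ofLp)) -
      ∑ m ∈ Finset.range n, (Complex.I * (τ.ofLp ⬝ᵥ w.ofLp)) ^ m / m.factorial‖ ≤
      ‖τ‖ ^ n * (n.factorial * Real.exp (2 * ‖w‖)) := by
  refine (Complex.norm_exp_sub_sum_le_norm_mul_exp _ n).trans ?_
  have h1 : ‖Complex.I * (τ.ofLp ⬝ᵥ w.ofLp)‖ ≤ ‖τ‖ * ‖w‖ := by
    simpa using norm_dotProduct_le τ w
  have h2 : ‖τ‖ * ‖w‖ ≤ ‖w‖ := mul_le_of_le_one_left (norm_nonneg _) hτ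
  have h3 := Real.pow_div_factorial_le_exp ‖w‖ (norm_nonneg _) n
  rw [div_le_iff₀ (by positivity)] at h3
  calc _ ≤ (‖τ‖ * ‖w‖) ^ n * Real.exp ‖w‖ := by gcongr; exact h1.trans h2
    _ = ‖τ‖ ^ n * (‖w‖ ^ n * Real.exp ‖w‖) := by ring
    _ ≤ ‖τ‖ ^ n * ((Real.exp ‖w‖ * n.factorial) * Real.exp ‖w‖) := by gcongr
    _ = _ := by rw [two_mul, Real.exp_add]; ring

/-- Taylor remainders of `ζ ↦ gker C ζ` with values in the Gelfand-Shilov space. -/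
theorem exists_norm_taylor_gker_le (hC : (C.map Complex.im).PosDef) {θ : ℝ} (hθ : 1 / 2 ≤ θ)
    (hθ' : θ < 1) {ε : ℝ} (hε : 0 < ε) :
    ∃ ε' > 0, ∃ L ≥ 0, ∀ (n : ℕ) (ζ τ : EuclideanSpace ℂ (Fin d)), ‖τ‖ ≤ 1 →
      ∀ (x : EuclideanSpace ℝ (Fin d)) (w : EuclideanSpace ℂ (Fin d)),
      ‖(Complex.exp (Complex.I * (τ.ofLp ⬝ᵥ (incl x + w).ofLp)) -
        ∑ m ∈ Finset.range n, (Complex.I * (τ.ofLp ⬝ᵥ (incl x + w).ofLp)) ^ m / m.factorial) *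
        gker C ζ (incl x + w)‖ ≤ ‖τ‖ ^ n * n.factorial *
        Real.exp (L + wt (C.map Complex.im) (imv ζ) + ε * ‖ζ‖ ^ (1 / θ)) *
        Real.exp (-ε' * ‖x‖ ^ (1 / θ) + L * ‖w‖ ^ (1 / (1 - θ))) := by
  obtain ⟨δ, hδ, L, hL, H⟩ := exists_norm_gker_le_decay hC hθ hθ' hε
  -- Half of the decay δ pays for the linear exponent 2‖x‖ of the Taylor remainder.
  obtain ⟨Y, hY, HY⟩ := exists_young hθ hθ' (half_pos hδ) 2
  refine ⟨δ / 2, half_pos hδ, L + Y + 2, by positivity, fun n ζ τ hτ x w => ?_⟩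
  rw [norm_mul]
  have h1 := norm_exp_dotProduct_sub_sum_le n hτ (incl x + w)
  have h2 := H ζ x w
  have h3 : 2 * ‖incl x + w‖ ≤ δ / 2 * ‖x‖ ^ (1 / θ) + Y + 2 * (1 + ‖w‖ ^ (1 / (1 - θ))) := by
    have a1 := norm_add_le (incl x) w
    rw [FBIPhase.norm_incl] at a1
    have a2 := HY ‖x‖ 1 (norm_nonneg _) zero_le_one
    simp only [mul_one, Real.one_rpow] at a2
    have a3 := rpow_le_one_add_rpow (norm_nonneg w) zero_le_one
      (one_le_two.trans (two_le_conj_exponent hθ hθ'))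
    rw [Real.rpow_one] at a3
    linarith
  have hq : 0 ≤ Y * ‖w‖ ^ (1 / (1 - θ)) := by positivity
  set X := wt (C.map Complex.im) (imv ζ) + ε * ‖ζ‖ ^ (1 / θ) - δ * ‖x‖ ^ (1 / θ) +
    L * (1 + ‖w‖ ^ (1 / (1 - θ))) with hX
  calc _ ≤ ‖τ‖ ^ n * (n.factorial * Real.exp (2 * ‖incl x + w‖)) * Real.exp X :=
        mul_le_mul h1 h2 (norm_nonneg _) (by positivity)
    _ = ‖τ‖ ^ n * n.factorial * (Real.exp (2 * ‖incl x + w‖) * Real.exp X) := by ring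
    _ ≤ ‖τ‖ ^ n * n.factorial *
        (Real.exp (L + Y + 2 + wt (C.map Complex.im) (imv ζ) + ε * ‖ζ‖ ^ (1 / θ)) *
        Real.exp (-(δ / 2) * ‖x‖ ^ (1 / θ) + (L + Y + 2) * ‖w‖ ^ (1 / (1 - θ)))) := by
        refine mul_le_mul_of_nonneg_left ?_ (by positivity)
        rw [← Real.exp_add, ← Real.exp_add]
        exact Real.exp_le_exp.2 (by linarith)
    _ = _ := by ring

end

section

/-! ### Iterated derivatives in one coordinate -/

section Coordinate

variable {𝕜 : Type*} [RCLike 𝕜] [NormedSpace 𝕜 ℂ] {d : ℕ}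

theorem mderivList_single (l : List (Fin d)) (hl : l.Nodup) (j : Fin d) (n : ℕ)
    (f : EuclideanSpace 𝕜 (Fin d) → ℂ) :
    mderivList 𝕜 l (Pi.single j n) f = if j ∈ l then (pderiv 𝕜 j)^[n] f else f := by
  induction l with
  | nil => simp [mderivList]
  | cons i l ih =>
    obtain ⟨hi, hl⟩ := List.nodup_cons.1 hl
    change (pderiv 𝕜 i)^[(Pi.single j n : Fin d → ℕ) i] (mderivList 𝕜 l (Pi.single j n) f) = _
    rw [ih hl]
    by_cases h : j = i
    · subst h
      simp [hi]
    · have h' : i ≠ j := fun e => h e.symm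
      simp [h, h']

theorem mderiv_single (j : Fin d) (n : ℕ) (f : EuclideanSpace 𝕜 (Fin d) → ℂ) :
    mderiv 𝕜 (Pi.single j n) f = (pderiv 𝕜 j)^[n] f := by
  rw [mderiv, mderivList_single _ (List.nodup_finRange d)]
  simp

theorem mderiv_zero (f : EuclideanSpace 𝕜 (Fin d) → ℂ) : mderiv 𝕜 0 f = f := by
  have : ∀ l : List (Fin d), mderivList 𝕜 l 0 f = f := by
    intro l
    induction l with
    | nil => rfl
    | cons i l ih => change (pderiv 𝕜 i)^[0] (mderivList 𝕜 l 0 f) = f; exact ih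
  exact this _

theorem mlen_single (j : Fin d) (n : ℕ) : mlen (Pi.single j n) = n := by
  simp [mlen]

theorem mfact_single (j : Fin d) (n : ℕ) : mfact (Pi.single j n) = n.factorial := by
  rw [mfact, Finset.prod_eq_single j]
  · simp
  · intro i _ hi; simp [hi]
  · simp

theorem mpow_single (x : EuclideanSpace ℝ (Fin d)) (j : Fin d) (n : ℕ) :
    mpow x (Pi.single j n) = x j ^ n := by
  rw [mpow, Finset.prod_eq_single j]
  · simp
  · intro i _ hi; simp [hi]
  · simp

theorem mlen_zero : mlen (0 : Fin d → ℕ) = 0 := by simp [mlen]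

theorem mfact_zero : mfact (0 : Fin d → ℕ) = 1 := by simp [mfact]

theorem iterate_pderiv_eq_iteratedDeriv {G : EuclideanSpace ℝ (Fin d) → ℂ} (hG : ContDiff ℝ ∞ G)
    (i : Fin d) (n : ℕ) (w : EuclideanSpace ℝ (Fin d)) (t : ℝ) :
    (pderiv ℝ i)^[n] G (w + t • EuclideanSpace.single i 1) =
      iteratedDeriv n (fun s : ℝ => G (w + s • EuclideanSpace.single i 1)) t := by
  induction n generalizing t with
  | zero => simp
  | succ n ih =>
    rw [iteratedDeriv_succ, Function.iterate_succ_apply', ← funext ih]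
    have h1 : HasDerivAt
        (fun s : ℝ => w + s • (EuclideanSpace.single i 1 : EuclideanSpace ℝ (Fin d)))
        (EuclideanSpace.single i 1) t := by
      simpa using ((hasDerivAt_id t).smul_const
        (EuclideanSpace.single i 1 : EuclideanSpace ℝ (Fin d))).const_add w
    exact ((((contDiff_iterate hG i n).differentiable (by simp) _).hasFDerivAt).comp_hasDerivAt t
      h1).deriv.symm

/-- Leibniz' rule for iterated derivatives in one coordinate. -/
theorem iterate_pderiv_mul {f g : EuclideanSpace ℝ (Fin d) → ℂ} (hf : ContDiff ℝ ∞ f)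
    (hg : ContDiff ℝ ∞ g) (j : Fin d) (n : ℕ) (x : EuclideanSpace ℝ (Fin d)) :
    (pderiv ℝ j)^[n] (fun y => f y * g y) x = ∑ i ∈ Finset.range (n + 1),
      (n.choose i : ℂ) * (pderiv ℝ j)^[i] f x * (pderiv ℝ j)^[n - i] g x := by
  have hline : ContDiff ℝ ∞ fun s : ℝ => x + s • EuclideanSpace.single j (1 : ℝ) := by fun_prop
  have h0 := fun {G : EuclideanSpace ℝ (Fin d) → ℂ} (hG : ContDiff ℝ ∞ G) (m : ℕ) =>
    iterate_pderiv_eq_iteratedDeriv hG j m x 0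
  simp only [zero_smul, add_zero] at h0
  rw [h0 (hf.mul hg), iteratedDeriv_fun_mul]
  · exact Finset.sum_congr rfl fun i _ => by rw [h0 hf, h0 hg]
  · exact ((hf.comp hline).contDiffAt).of_le (by exact_mod_cast le_top)
  · exact ((hg.comp hline).contDiffAt).of_le (by exact_mod_cast le_top)

end Coordinate

variable {d : ℕ}

/-! ### Oscillatory integrals -/

theorem contDiff_osc (ξ : EuclideanSpace ℝ (Fin d)) :
    ContDiff ℝ ∞ fun y : EuclideanSpace ℝ (Fin d) =>
      Complex.exp (Complex.I * ((incl ξ).ofLp ⬝ᵥ (incl y).ofLp)) := by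
  have h : ContDiff ℂ ∞ fun w : EuclideanSpace ℂ (Fin d) =>
      Complex.exp (Complex.I * ((incl ξ).ofLp ⬝ᵥ w.ofLp)) := by
    unfold dotProduct; fun_prop
  exact (h.restrict_scalars ℝ).comp incl.contDiff

theorem dotProduct_incl (ξ y : EuclideanSpace ℝ (Fin d)) :
    (incl ξ).ofLp ⬝ᵥ (incl y).ofLp = ((ξ.ofLp ⬝ᵥ y.ofLp : ℝ) : ℂ) := by
  simp [dotProduct, FBIPhase.incl_apply]

theorem norm_osc (ξ y : EuclideanSpace ℝ (Fin d)) :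
    ‖Complex.exp (Complex.I * ((incl ξ).ofLp ⬝ᵥ (incl y).ofLp))‖ = 1 := by
  rw [dotProduct_incl, mul_comm, Complex.norm_exp_ofReal_mul_I]

theorem pderiv_osc (ξ : EuclideanSpace ℝ (Fin d)) (j : Fin d) (y : EuclideanSpace ℝ (Fin d)) :
    pderiv ℝ j (fun y => Complex.exp (Complex.I * ((incl ξ).ofLp ⬝ᵥ (incl y).ofLp))) y =
      Complex.I * ξ j * Complex.exp (Complex.I * ((incl ξ).ofLp ⬝ᵥ (incl y).ofLp)) := by
  have h1 := iterate_pderiv_eq_iteratedDeriv (contDiff_osc ξ) j 1 y 0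
  simp only [zero_smul, add_zero, Function.iterate_one, iteratedDeriv_one] at h1
  rw [h1]
  have e : (fun s : ℝ => Complex.exp (Complex.I * ((incl ξ).ofLp ⬝ᵥ
      (incl (y + s • EuclideanSpace.single j (1 : ℝ))).ofLp))) =
      fun s : ℝ => Complex.exp (Complex.I * ((incl ξ).ofLp ⬝ᵥ (incl y).ofLp) +
        Complex.I * ξ j * s) := by
    funext s
    congr 1
    rw [map_add, map_smul, FBIPhase.incl_single, WithLp.ofLp_add, WithLp.ofLp_smul, dotProduct_add,
      dotProduct_smul, mul_add]
    simp [FBIPhase.incl_apply]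
    ring
  rw [e]
  have h2 : HasDerivAt (fun s : ℝ => Complex.I * ((incl ξ).ofLp ⬝ᵥ (incl y).ofLp) +
      Complex.I * ξ j * (s : ℂ)) (Complex.I * ξ j) 0 := by
    simpa using ((Complex.ofRealCLM.hasDerivAt (x := (0 : ℝ))).const_mul
      (Complex.I * (ξ j : ℂ))).const_add (Complex.I * ((incl ξ).ofLp ⬝ᵥ (incl y).ofLp))
  rw [h2.cexp.deriv]
  simp [mul_comm]

theorem integral_osc_mul_pderiv {G : EuclideanSpace ℝ (Fin d) → ℂ} (hG : ContDiff ℝ ∞ G)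
    (ξ : EuclideanSpace ℝ (Fin d)) (j : Fin d) (h0 : Integrable G)
    (h1 : Integrable (pderiv ℝ j G)) :
    ∫ y, Complex.exp (Complex.I * ((incl ξ).ofLp ⬝ᵥ (incl y).ofLp)) * pderiv ℝ j G y =
      -(Complex.I * ξ j) *
        ∫ y, Complex.exp (Complex.I * ((incl ξ).ofLp ⬝ᵥ (incl y).ofLp)) * G y := by
  have hosc := contDiff_osc ξ
  set e : EuclideanSpace ℝ (Fin d) → ℂ :=
    fun y => Complex.exp (Complex.I * ((incl ξ).ofLp ⬝ᵥ (incl y).ofLp)) with he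
  have hbd : ∀ {H : EuclideanSpace ℝ (Fin d) → ℂ}, Integrable H →
      Integrable fun y => e y * H y := fun hH =>
    hH.bdd_mul (c := 1) hosc.continuous.aestronglyMeasurable
      (Filter.Eventually.of_forall fun y => (norm_osc ξ y).le)
  have hd : ∀ y, fderiv ℝ e y (EuclideanSpace.single j 1) = Complex.I * ξ j * e y :=
    pderiv_osc ξ j
  have := integral_mul_fderiv_eq_neg_fderiv_mul_of_integrable (μ := volume) (f := e) (g := G)
    (v := EuclideanSpace.single j (1 : ℝ)) ?_ (hbd h1) (hbd h0)
    (fun x _ => hosc.differentiable (by simp) x) (fun x _ => hG.differentiable (by simp) x)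
  · simp only [hd] at this
    change ∫ y, e y * fderiv ℝ G y (EuclideanSpace.single j 1) = _
    rw [this, neg_mul, ← integral_const_mul]
    simp only [mul_assoc, he]
  · simp only [hd, mul_assoc]
    exact ((hbd h0).const_mul _).const_mul _

/-- Repeated integration by parts in a single coordinate; the moment criterion
`exists_decay_of_moments` asks for nothing more. -/
theorem pow_mul_norm_integral_osc_le {G : EuclideanSpace ℝ (Fin d) → ℂ} (hG : ContDiff ℝ ∞ G)
    (ξ : EuclideanSpace ℝ (Fin d)) (j : Fin d)
    (hint : ∀ n : ℕ, Integrable ((pderiv ℝ j)^[n] G)) (n : ℕ) :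
    |ξ j| ^ n *
      ‖∫ y, Complex.exp (Complex.I * ((incl ξ).ofLp ⬝ᵥ (incl y).ofLp)) * G y‖ ≤
      ∫ y, ‖(pderiv ℝ j)^[n] G y‖ := by
  have key : |ξ j| ^ n *
      ‖∫ y, Complex.exp (Complex.I * ((incl ξ).ofLp ⬝ᵥ (incl y).ofLp)) * G y‖ =
      ‖∫ y, Complex.exp (Complex.I * ((incl ξ).ofLp ⬝ᵥ (incl y).ofLp)) *
        (pderiv ℝ j)^[n] G y‖ := by
    induction n with
    | zero => simp
    | succ n ih =>
      have := integral_osc_mul_pderiv (contDiff_iterate hG j n) ξ j (hint n)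
        (by simpa [Function.iterate_succ_apply'] using hint (n + 1))
      rw [Function.iterate_succ_apply', this, norm_mul, ← ih, pow_succ]
      simp
      ring
  rw [key]
  refine (norm_integral_le_integral_norm _).trans_eq ?_
  simp only [norm_mul, norm_osc, one_mul]

/-! ### Integrability of stretched exponentials -/

theorem exists_exp_neg_le {θ : ℝ} (hθ : 1 / 2 ≤ θ) (hθ' : θ < 1) {ε : ℝ} (hε : 0 < ε) (n : ℕ) :
    ∃ K : ℝ, ∀ t : ℝ, 0 ≤ t → Real.exp (-ε * t ^ (1 / θ)) ≤ K * (1 + t) ^ (-(n : ℝ)) := by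
  obtain ⟨Y, hY, HY⟩ := exists_young hθ hθ' hε 1
  refine ⟨Real.exp (Y + 1) * n.factorial, fun t ht => ?_⟩
  have h1 := HY t 1 ht zero_le_one
  simp only [mul_one, one_mul, Real.one_rpow] at h1
  have h2 := Real.pow_div_factorial_le_exp (1 + t) (by positivity) n
  rw [div_le_iff₀ (by positivity)] at h2
  rw [Real.rpow_neg (by positivity), Real.rpow_natCast, ← div_eq_mul_inv,
    le_div_iff₀ (by positivity)]
  calc Real.exp (-ε * t ^ (1 / θ)) * (1 + t) ^ n
      ≤ Real.exp (Y - t) * (Real.exp (1 + t) * n.factorial) := by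
        gcongr; linarith
    _ = Real.exp (Y + 1) * n.factorial := by
        rw [← mul_assoc, ← Real.exp_add]; congr 2; ring

theorem integrable_exp_neg_norm_rpow {V : Type*} [NormedAddCommGroup V] [NormedSpace ℝ V]
    [FiniteDimensional ℝ V] [MeasurableSpace V] [BorelSpace V] (μ : Measure V)
    [μ.IsAddHaarMeasure] {θ : ℝ} (hθ : 1 / 2 ≤ θ) (hθ' : θ < 1) {ε : ℝ} (hε : 0 < ε) :
    Integrable (fun x : V => Real.exp (-ε * ‖x‖ ^ (1 / θ))) μ := by
  obtain ⟨K, hK⟩ := exists_exp_neg_le hθ hθ' hε (Module.finrank ℝ V + 1)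
  have h := (integrable_one_add_norm (E := V) (μ := μ)
    (r := ((Module.finrank ℝ V + 1 : ℕ) : ℝ)) (by push_cast; linarith)).const_mul K
  have hp : 0 < 1 / θ := by positivity
  refine h.mono' (Continuous.aestronglyMeasurable ?_) (Filter.Eventually.of_forall fun x => ?_)
  · have : Continuous fun x : V => ‖x‖ ^ (1 / θ) := continuous_norm.rpow_const fun _ => Or.inr hp.le
    fun_prop
  · rw [Real.norm_of_nonneg (Real.exp_nonneg _)]
    exact hK ‖x‖ (norm_nonneg x)

/-! ### Decay of the transform of a Gelfand-Shilov function -/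

/-- The moment criterion is applied to |∂^β f(y)| with M h^{|β|} β!^θ as its constant, so a single
rate ε serves all β. Only the monomials y_j^n enter. -/
theorem exists_norm_mderiv_le_of_normLE (d : ℕ) {θ h : ℝ} (hθ : 0 < θ) (hh : 0 < h) :
    ∃ ε > 0, ∀ (f : EuclideanSpace ℝ (Fin d) → ℂ) (M : ℝ), NormLE θ h M f →
      ∀ (β : Fin d → ℕ) (y : EuclideanSpace ℝ (Fin d)), ‖mderiv ℝ β f y‖ ≤
        Real.exp 1 * (M * h ^ mlen β * mfact β ^ θ) * Real.exp (-ε * ‖y‖ ^ (1 / θ)) := by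
  obtain ⟨ε, hε, H⟩ := exists_decay_of_moments d hθ hh
  refine ⟨ε, hε, fun f M hf β y => H _ _ y (norm_nonneg _) ?_ fun j n => ?_⟩
  · have := hf 0 β y
    simpa [mpow, mlen_zero, mfact_zero] using this
  · have := hf (Pi.single j n) β y
    rw [norm_mul, mpow_single, mlen_single, mfact_single, Complex.norm_real, norm_pow,
      Real.norm_eq_abs, pow_add] at this
    exact this.trans_eq (by ring)

/-- Cauchy's estimates, centred at a real point, preserve the Gaussian localization in y. The rate c
comes before ε because ε is later chosen small in terms of c. -/
theorem exists_norm_mderiv_gker_le {C : Matrix (Fin d) (Fin d) ℂ}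
    (hC : (C.map Complex.im).PosDef) {θ : ℝ} (hθ : 1 / 2 ≤ θ) (hθ' : θ < 1) :
    ∃ c > 0, ∀ ε > 0, ∃ K > 0, ∀ (ζ : EuclideanSpace ℂ (Fin d)) (β : Fin d → ℕ)
      (y : EuclideanSpace ℝ (Fin d)), ‖mderiv ℝ β (gker C ζ ∘ incl) y‖ ≤
        K ^ (mlen β + 1) * mfact β ^ θ * Real.exp (wt (C.map Complex.im) (imv ζ) +
          ε * ‖ζ‖ ^ (1 / θ) - c * ‖y - cen (C.map Complex.im) (imv ζ)‖ ^ 2) := by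
  obtain ⟨c, hc, Hc⟩ := exists_norm_gker_le hC hθ hθ'
  refine ⟨c, hc, fun ε hε => ?_⟩
  obtain ⟨L, hL, HL⟩ := Hc ε hε
  obtain ⟨K, hK, HK⟩ := exists_norm_mderiv_le d hθ' hL
  refine ⟨Real.exp L * K, by positivity, fun ζ β y => ?_⟩
  set X := wt (C.map Complex.im) (imv ζ) + ε * ‖ζ‖ ^ (1 / θ) -
    c * ‖y - cen (C.map Complex.im) (imv ζ)‖ ^ 2 with hX
  have h1 := HK (gker C ζ) (contDiff_gker C ζ) (incl y) (Real.exp (X + L)) (Real.exp_nonneg _)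
    (fun w => (HL ζ y w).trans_eq (by rw [← Real.exp_add]; congr 1; rw [hX]; ring)) β
  rw [mderiv, FBIPhase.mderivList_comp_incl (contDiff_gker C ζ), Function.comp_apply]
  refine h1.trans ?_
  have hβ0 := Real.rpow_nonneg (mfact_pos β).le θ
  have h2 : Real.exp L ≤ Real.exp L ^ (mlen β + 1) :=
    le_self_pow₀ (Real.one_le_exp hL) (by simp)
  rw [Real.exp_add, mul_pow]
  calc Real.exp X * Real.exp L * K ^ (mlen β + 1) * mfact β ^ θ
      ≤ Real.exp X * Real.exp L ^ (mlen β + 1) * K ^ (mlen β + 1) * mfact β ^ θ := by gcongr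
    _ = _ := by ring

theorem factorial_rpow_mul_le {θ : ℝ} (hθ : 0 ≤ θ) {i n : ℕ} (h : i ≤ n) :
    (i.factorial : ℝ) ^ θ * ((n - i).factorial : ℝ) ^ θ ≤ (n.factorial : ℝ) ^ θ := by
  rw [← Real.mul_rpow (by positivity) (by positivity)]
  refine Real.rpow_le_rpow (by positivity) ?_ hθ
  exact_mod_cast Nat.le_of_dvd n.factorial_pos (Nat.factorial_mul_factorial_dvd_factorial h)

/-- Since i!(n-i)! ≤ n!, the factorials leave the sum and the binomial theorem turns the rest into
(h+K)^n. -/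
theorem norm_leibniz_sum_le {θ A B h K : ℝ} (hθ : 0 ≤ θ) (hA : 0 ≤ A) (hB : 0 ≤ B) (hh : 0 ≤ h)
    (hK : 0 ≤ K) (a b : ℕ → ℂ) (ha : ∀ i, ‖a i‖ ≤ A * h ^ i * (i.factorial : ℝ) ^ θ)
    (hb : ∀ i, ‖b i‖ ≤ B * K ^ i * (i.factorial : ℝ) ^ θ) (n : ℕ) :
    ‖∑ i ∈ Finset.range (n + 1), (n.choose i : ℂ) * a i * b (n - i)‖ ≤
      A * B * (h + K) ^ n * (n.factorial : ℝ) ^ θ := by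
  refine (norm_sum_le _ _).trans ?_
  rw [add_pow, Finset.mul_sum, Finset.sum_mul]
  refine Finset.sum_le_sum fun i hi => ?_
  have hin : i ≤ n := Nat.lt_succ_iff.1 (Finset.mem_range.1 hi)
  rw [norm_mul, norm_mul, Complex.norm_natCast]
  calc (n.choose i : ℝ) * ‖a i‖ * ‖b (n - i)‖
      ≤ n.choose i * (A * h ^ i * (i.factorial : ℝ) ^ θ) *
        (B * K ^ (n - i) * ((n - i).factorial : ℝ) ^ θ) := by
        gcongr
        · exact ha i
        · exact hb (n - i)
    _ = A * B * (h ^ i * K ^ (n - i) * n.choose i) *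
        ((i.factorial : ℝ) ^ θ * ((n - i).factorial : ℝ) ^ θ) := by ring
    _ ≤ _ := by gcongr; exact factorial_rpow_mul_le hθ hin

end

section

/-! ### Complex frequencies ξ + iη and the decay of pairings with wave packets. -/

section Complexification

variable {d : ℕ}

/-- The point `ξ + i η` of `ℂ ^ d`. -/
def toC (p : EuclideanSpace ℝ (Fin d) × EuclideanSpace ℝ (Fin d)) : EuclideanSpace ℂ (Fin d) :=
  incl p.1 + Complex.I • incl p.2

/-- The coordinatewise real part. -/
def rev (ζ : EuclideanSpace ℂ (Fin d)) : EuclideanSpace ℝ (Fin d) :=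
  WithLp.toLp 2 fun i => (ζ i).re

theorem rev_apply (ζ : EuclideanSpace ℂ (Fin d)) (i : Fin d) : rev ζ i = (ζ i).re := rfl

theorem norm_rev_le (ζ : EuclideanSpace ℂ (Fin d)) : ‖rev ζ‖ ≤ ‖ζ‖ := by
  rw [EuclideanSpace.norm_eq, EuclideanSpace.norm_eq]
  gcongr with i
  exact Complex.abs_re_le_norm (ζ i)

theorem toC_apply (p : EuclideanSpace ℝ (Fin d) × EuclideanSpace ℝ (Fin d)) (i : Fin d) :
    toC p i = p.1 i + Complex.I * p.2 i := by
  simp [toC, FBIPhase.incl_apply]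

theorem imv_toC (p : EuclideanSpace ℝ (Fin d) × EuclideanSpace ℝ (Fin d)) : imv (toC p) = p.2 := by
  ext i
  simp [imv_apply, toC_apply]

theorem rev_toC (p : EuclideanSpace ℝ (Fin d) × EuclideanSpace ℝ (Fin d)) : rev (toC p) = p.1 := by
  ext i
  simp [rev_apply, toC_apply]

theorem toC_rev_imv (ζ : EuclideanSpace ℂ (Fin d)) : toC (rev ζ, imv ζ) = ζ := by
  ext i
  rw [toC_apply, rev_apply, imv_apply, mul_comm]
  exact Complex.re_add_im _

theorem continuous_toC : Continuous (toC (d := d)) := by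
  unfold toC; fun_prop

theorem norm_le_norm_toC (p : EuclideanSpace ℝ (Fin d) × EuclideanSpace ℝ (Fin d)) :
    ‖p‖ ≤ ‖toC p‖ := by
  rw [Prod.norm_def]
  refine max_le ?_ ?_
  · have := norm_rev_le (toC p); rwa [rev_toC] at this
  · have := norm_imv_le (toC p); rwa [imv_toC] at this

theorem norm_toC_rpow_le {θ : ℝ} (hθ : 1 / 2 ≤ θ)
    (p : EuclideanSpace ℝ (Fin d) × EuclideanSpace ℝ (Fin d)) :
    ‖toC p‖ ^ (1 / θ) ≤ 4 * (‖p.1‖ ^ (1 / θ) + ‖p.2‖ ^ (1 / θ)) := by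
  have := norm_add_rpow_le hθ (incl p.1) (Complex.I • incl p.2)
  simpa [toC, norm_smul, FBIPhase.norm_incl] using this

theorem integrable_exp_neg_norm_toC {θ : ℝ} (hθ : 1 / 2 ≤ θ) (hθ' : θ < 1) {ε : ℝ} (hε : 0 < ε) :
    Integrable fun p : EuclideanSpace ℝ (Fin d) × EuclideanSpace ℝ (Fin d) =>
      Real.exp (-ε * ‖toC p‖ ^ (1 / θ)) := by
  have hp : 0 < 1 / θ := by positivity
  have : (volume : Measure (EuclideanSpace ℝ (Fin d) × EuclideanSpace ℝ (Fin d))).IsAddHaarMeasure :=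
    Measure.prod.instIsAddHaarMeasure volume volume
  refine (integrable_exp_neg_norm_rpow
    (volume : Measure (EuclideanSpace ℝ (Fin d) × EuclideanSpace ℝ (Fin d))) hθ hθ' hε).mono'
    (Continuous.aestronglyMeasurable ?_) (Filter.Eventually.of_forall fun p => ?_)
  · have : Continuous fun p : EuclideanSpace ℝ (Fin d) × EuclideanSpace ℝ (Fin d) =>
        ‖toC p‖ ^ (1 / θ) := continuous_toC.norm.rpow_const fun _ => Or.inr hp.le
    fun_prop
  · rw [Real.norm_of_nonneg (Real.exp_nonneg _)]
    refine Real.exp_le_exp.2 ?_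
    have : ‖p‖ ^ (1 / θ) ≤ ‖toC p‖ ^ (1 / θ) := by gcongr; exact norm_le_norm_toC p
    nlinarith

end Complexification

variable {d : ℕ} {C : Matrix (Fin d) (Fin d) ℂ}

/-- Decay of the derivatives of `f` times a wave packet of zero frequency. -/
theorem exists_norm_iterate_pderiv_mul_gker_le (hC : (C.map Complex.im).PosDef) {θ : ℝ}
    (hθ : 1 / 2 ≤ θ) (hθ' : θ < 1) {h : ℝ} (hh : 0 < h) :
    ∃ ε > 0, ∃ δ > 0, ∃ K > 0, ∃ H > 0, ∀ (f : EuclideanSpace ℝ (Fin d) → ℂ) (M : ℝ),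
      ContDiff ℝ ∞ f → NormLE θ h M f → ∀ η y : EuclideanSpace ℝ (Fin d),
      ‖f y * gker C (toC (0, η)) (incl y)‖ ≤
        K * M * Real.exp (wt (C.map Complex.im) η - ε * ‖η‖ ^ (1 / θ)) *
          Real.exp (-δ * ‖y‖ ^ (1 / θ)) ∧
      ∀ (j : Fin d) (n : ℕ),
      ‖(pderiv ℝ j)^[n] (fun y => f y * gker C (toC (0, η)) (incl y)) y‖ ≤
        K * M * Real.exp (wt (C.map Complex.im) η - ε * ‖η‖ ^ (1 / θ)) * H ^ n *
          (n.factorial : ℝ) ^ θ * Real.exp (-δ * ‖y‖ ^ (1 / θ)) := by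
  have hθ0 : 0 < θ := by linarith
  obtain ⟨ε₀, hε₀, H₀⟩ := exists_norm_mderiv_le_of_normLE d hθ0 hh
  obtain ⟨c, hc, Hc⟩ := exists_norm_mderiv_gker_le hC hθ hθ'
  obtain ⟨K₁, hK₁, HK₁⟩ := exists_norm_le_cen hC
  set R := K₁ ^ (1 / θ) with hR
  have hR0 : 0 ≤ R := by positivity
  -- The estimate for the packet loses e^{ε|η|^{1/θ}} and a gain of the same size is wanted, so
  -- 2ε|η|^{1/θ} must be paid. With |η| ≤ K₁|cen| and |cen| controlled by |y| and |y - cen|, half of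
  -- the decay of f pays the first part and the Gaussian pays the second.
  obtain ⟨ε, hε, hε1, hε2⟩ : ∃ ε > 0, 8 * ε * R ≤ ε₀ / 2 ∧ 8 * ε * R ≤ c := by
    have key : 8 * (min (ε₀ / 2) c / (8 * (R + 1))) * R ≤ min (ε₀ / 2) c := by
      have hm : 0 ≤ min (ε₀ / 2) c := by positivity
      calc 8 * (min (ε₀ / 2) c / (8 * (R + 1))) * R = min (ε₀ / 2) c * (R / (R + 1)) := by
            field_simp
        _ ≤ min (ε₀ / 2) c * 1 := by
            gcongr; rw [div_le_one (by positivity)]; linarith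
        _ = _ := mul_one _
    exact ⟨min (ε₀ / 2) c / (8 * (R + 1)), by positivity, key.trans (min_le_left _ _),
      key.trans (min_le_right _ _)⟩
  obtain ⟨K, hK, HK⟩ := Hc ε hε
  refine ⟨ε, hε, ε₀ / 2, by positivity, Real.exp 1 * K * Real.exp c, by positivity, h + K,
    by positivity, fun f M hf hM η y => ?_⟩
  have hM0 := hM.nonneg
  set S := C.map Complex.im with hS
  set ζ := toC ((0 : EuclideanSpace ℝ (Fin d)), η) with hζ
  have hη : imv ζ = η := imv_toC _
  have hnζ : ‖ζ‖ = ‖η‖ := by simp [hζ, toC, norm_smul, FBIPhase.norm_incl]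
  set X := wt S η + ε * ‖η‖ ^ (1 / θ) - c * ‖y - cen S η‖ ^ 2 with hX
  have hexp : Real.exp (-ε₀ * ‖y‖ ^ (1 / θ)) * Real.exp X ≤
      Real.exp c * Real.exp (wt S η - ε * ‖η‖ ^ (1 / θ)) *
        Real.exp (-(ε₀ / 2) * ‖y‖ ^ (1 / θ)) := by
    rw [← Real.exp_add, ← Real.exp_add, ← Real.exp_add]
    refine Real.exp_le_exp.2 ?_
    have h1 : ‖η‖ ^ (1 / θ) ≤ R * ‖cen S η‖ ^ (1 / θ) := by
      rw [hR, ← Real.mul_rpow hK₁ (norm_nonneg _)]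
      have := HK₁ η
      gcongr
    have h2 := norm_add_rpow_le hθ y (cen S η - y)
    rw [add_sub_cancel, norm_sub_rev] at h2
    have h3 := rpow_le_one_add_sq hθ (norm_nonneg (y - cen S η))
    have h4 : 2 * ε * ‖η‖ ^ (1 / θ) ≤
        8 * ε * R * ‖y‖ ^ (1 / θ) + 8 * ε * R * (1 + ‖y - cen S η‖ ^ 2) := by
      calc 2 * ε * ‖η‖ ^ (1 / θ)
          ≤ 2 * ε * (R * (4 * (‖y‖ ^ (1 / θ) + (1 + ‖y - cen S η‖ ^ 2)))) := by
            gcongr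
            exact h1.trans (by gcongr; exact h2.trans (by gcongr))
        _ = _ := by ring
    have h5 : 8 * ε * R * ‖y‖ ^ (1 / θ) ≤ ε₀ / 2 * ‖y‖ ^ (1 / θ) := by gcongr
    have h6 : 8 * ε * R * (1 + ‖y - cen S η‖ ^ 2) ≤ c * (1 + ‖y - cen S η‖ ^ 2) := by gcongr
    linarith
  have hfb := fun β => H₀ f M hM β y
  have hkb : ∀ β, ‖mderiv ℝ β (gker C ζ ∘ incl) y‖ ≤
      K ^ (mlen β + 1) * mfact β ^ θ * Real.exp X := by
    intro β
    have := HK ζ β y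
    rwa [hη, hnζ] at this
  refine ⟨?_, fun j n => ?_⟩
  · have h1 := hfb 0
    have h2 := hkb 0
    rw [mderiv_zero, mlen_zero, mfact_zero] at h1 h2
    simp only [pow_zero, mul_one, Real.one_rpow, zero_add, pow_one] at h1 h2
    rw [norm_mul]
    calc ‖f y‖ * ‖gker C ζ (incl y)‖
        ≤ (Real.exp 1 * M * Real.exp (-ε₀ * ‖y‖ ^ (1 / θ))) * (K * Real.exp X) :=
          mul_le_mul h1 h2 (norm_nonneg _) (by positivity)
      _ = Real.exp 1 * K * M * (Real.exp (-ε₀ * ‖y‖ ^ (1 / θ)) * Real.exp X) := by ring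
      _ ≤ Real.exp 1 * K * M * (Real.exp c * Real.exp (wt S η - ε * ‖η‖ ^ (1 / θ)) *
        Real.exp (-(ε₀ / 2) * ‖y‖ ^ (1 / θ))) := by gcongr
      _ = _ := by ring
  · have hk : ContDiff ℝ ∞ (gker C ζ ∘ incl) :=
      ((contDiff_gker C ζ).restrict_scalars ℝ).comp incl.contDiff
    have e := iterate_pderiv_mul hf hk j n y
    simp only [Function.comp_apply] at e
    rw [e]
    refine (norm_leibniz_sum_le hθ0.le (A := Real.exp 1 * M * Real.exp (-ε₀ * ‖y‖ ^ (1 / θ)))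
      (B := K * Real.exp X) (h := h) (K := K) (by positivity) (by positivity) hh.le hK.le
      (fun i => (pderiv ℝ j)^[i] f y) (fun i => (pderiv ℝ j)^[i] (gker C ζ ∘ incl) y) ?_ ?_
      n).trans ?_
    · intro i
      have := hfb (Pi.single j i)
      rw [mderiv_single, mlen_single, mfact_single] at this
      exact this.trans_eq (by ring)
    · intro i
      have := hkb (Pi.single j i)
      rw [mderiv_single, mlen_single, mfact_single] at this
      exact this.trans_eq (by rw [pow_succ]; ring)
    · calc _ = Real.exp 1 * K * M * (h + K) ^ n * (n.factorial : ℝ) ^ θ *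
            (Real.exp (-ε₀ * ‖y‖ ^ (1 / θ)) * Real.exp X) := by ring
        _ ≤ Real.exp 1 * K * M * (h + K) ^ n * (n.factorial : ℝ) ^ θ *
            (Real.exp c * Real.exp (wt S η - ε * ‖η‖ ^ (1 / θ)) *
              Real.exp (-(ε₀ / 2) * ‖y‖ ^ (1 / θ))) := by gcongr
        _ = _ := by ring

/-- The pairing of a Gelfand-Shilov function with a wave packet decays. -/
theorem exists_norm_integral_mul_gker_le (hC : (C.map Complex.im).PosDef) {θ : ℝ}
    (hθ : 1 / 2 ≤ θ) (hθ' : θ < 1) {h : ℝ} (hh : 0 < h) :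
    ∃ ε > 0, ∃ K > 0, ∀ (f : EuclideanSpace ℝ (Fin d) → ℂ) (M : ℝ),
      ContDiff ℝ ∞ f → NormLE θ h M f → ∀ ζ : EuclideanSpace ℂ (Fin d),
      ‖∫ y, f y * gker C ζ (incl y)‖ ≤
        K * M * Real.exp (wt (C.map Complex.im) (imv ζ) - ε * ‖ζ‖ ^ (1 / θ)) := by
  have hθ0 : 0 < θ := by linarith
  obtain ⟨ε, hε, δ, hδ, K, hK, H, hH, HH⟩ :=
    exists_norm_iterate_pderiv_mul_gker_le hC hθ hθ' hh
  obtain ⟨ε₁, hε₁, H₁⟩ := exists_decay_of_moments d hθ0 hH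
  have hint := integrable_exp_neg_norm_rpow
    (volume : Measure (EuclideanSpace ℝ (Fin d))) hθ hθ' hδ
  set J := ∫ y : EuclideanSpace ℝ (Fin d), Real.exp (-δ * ‖y‖ ^ (1 / θ)) with hJ
  have hJ0 : 0 ≤ J := integral_nonneg fun y => Real.exp_nonneg _
  -- ε is the rate in η and ε₁ the rate in ξ; dividing by 4 merges them into a rate in ‖ξ + iη‖. `J
  -- + 1` keeps the constant positive.
  refine ⟨min ε ε₁ / 4, by positivity, Real.exp 1 * (K * (J + 1)), by positivity,
    fun f M hf hM ζ => ?_⟩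
  have hM0 := hM.nonneg
  obtain ⟨p, rfl⟩ : ∃ p, toC p = ζ := ⟨_, toC_rev_imv ζ⟩
  obtain ⟨ξ, η⟩ := p
  rw [imv_toC]
  set G : EuclideanSpace ℝ (Fin d) → ℂ := fun y => f y * gker C (toC (0, η)) (incl y) with hG
  have hGs : ContDiff ℝ ∞ G :=
    hf.mul (((contDiff_gker C _).restrict_scalars ℝ).comp incl.contDiff)
  -- The real part of the frequency splits off as a character. The decay in η is already contained
  -- in the bounds for G, and integrations by parts supply that in ξ.
  have e : (∫ y, f y * gker C (toC (ξ, η)) (incl y)) =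
      ∫ y, Complex.exp (Complex.I * ((incl ξ).ofLp ⬝ᵥ (incl y).ofLp)) * G y := by
    congr 1
    funext y
    have : toC (ξ, η) = toC (0, η) + incl ξ := by simp [toC, add_comm]
    rw [this, gker_add, hG]
    ring
  rw [e]
  set E := Real.exp (wt (C.map Complex.im) η - ε * ‖η‖ ^ (1 / θ)) with hE
  have hb := fun y => HH f M hf hM η y
  have hGint : ∀ (j : Fin d) (n : ℕ), Integrable ((pderiv ℝ j)^[n] G) := fun j n =>
    (hint.const_mul (K * M * E * H ^ n * (n.factorial : ℝ) ^ θ)).mono'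
      (contDiff_iterate hGs j n).continuous.aestronglyMeasurable
      (Filter.Eventually.of_forall fun y => (hb y).2 j n)
  have h1 := H₁ (K * (J + 1) * M * E)
    ‖∫ y, Complex.exp (Complex.I * ((incl ξ).ofLp ⬝ᵥ (incl y).ofLp)) * G y‖ ξ (norm_nonneg _) ?_ ?_
  · refine h1.trans ?_
    have h2 := norm_toC_rpow_le hθ (ξ, η)
    simp only at h2
    calc _ = Real.exp 1 * (K * (J + 1)) * M * (E * Real.exp (-ε₁ * ‖ξ‖ ^ (1 / θ))) := by ring
      _ ≤ _ := by
        refine mul_le_mul_of_nonneg_left ?_ (by positivity)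
        rw [hE, ← Real.exp_add]
        refine Real.exp_le_exp.2 ?_
        have a1 : min ε ε₁ * ‖η‖ ^ (1 / θ) ≤ ε * ‖η‖ ^ (1 / θ) := by gcongr; exact min_le_left _ _
        have a2 : min ε ε₁ * ‖ξ‖ ^ (1 / θ) ≤ ε₁ * ‖ξ‖ ^ (1 / θ) := by
          gcongr; exact min_le_right _ _
        have a3 : min ε ε₁ / 4 * ‖toC (ξ, η)‖ ^ (1 / θ) ≤
            min ε ε₁ / 4 * (4 * (‖ξ‖ ^ (1 / θ) + ‖η‖ ^ (1 / θ))) := by gcongr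
        linarith
  · refine (norm_integral_le_of_norm_le (hint.const_mul (K * M * E))
      (Filter.Eventually.of_forall fun y => ?_)).trans ?_
    · rw [norm_mul, norm_osc, one_mul]
      exact (hb y).1
    · rw [integral_const_mul, ← hJ]
      have : 0 ≤ K * M * E := by positivity
      nlinarith
  · intro j n
    refine (pow_mul_norm_integral_osc_le hGs ξ j (hGint j) n).trans ?_
    refine (integral_mono (hGint j n).norm
      (hint.const_mul (K * M * E * H ^ n * (n.factorial : ℝ) ^ θ)) fun y => (hb y).2 j n).trans ?_
    rw [integral_const_mul, ← hJ]
    have : 0 ≤ K * M * E * H ^ n * (n.factorial : ℝ) ^ θ := by positivity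
    nlinarith

end

section

variable {d : ℕ} {C : Matrix (Fin d) (Fin d) ℂ}

/-! ### Wave packets as elements of the Gelfand-Shilov space -/

theorem comp_incl_mem_space {θ : ℝ} (hθ : 1 / 2 ≤ θ) (hθ' : θ < 1) {ε L M : ℝ} (hε : 0 < ε)
    (hL : 0 ≤ L) (hM : 0 ≤ M) {F : EuclideanSpace ℂ (Fin d) → ℂ} (hF : ContDiff ℂ ∞ F)
    (H : ∀ (x : EuclideanSpace ℝ (Fin d)) (w : EuclideanSpace ℂ (Fin d)), ‖F (incl x + w)‖ ≤
      M * Real.exp (-ε * ‖x‖ ^ (1 / θ) + L * ‖w‖ ^ (1 / (1 - θ)))) :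
    F ∘ incl ∈ Space d θ := by
  obtain ⟨h, hh, K, hK, HK⟩ := exists_normLE_of_entire d hθ hθ' hε hL
  exact ⟨(hF.restrict_scalars ℝ).comp incl.contDiff, h, hh, K * M, HK F hF M hM H⟩

theorem gker_mem_space (hC : (C.map Complex.im).PosDef) {θ : ℝ} (hθ : 1 / 2 ≤ θ) (hθ' : θ < 1)
    (ζ : EuclideanSpace ℂ (Fin d)) : gker C ζ ∘ incl ∈ Space d θ := by
  obtain ⟨ε, hε, L, hL, H⟩ := exists_norm_gker_le_decay hC hθ hθ' one_pos
  refine comp_incl_mem_space hθ hθ' hε hL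
    (M := Real.exp (wt (C.map Complex.im) (imv ζ) + 1 * ‖ζ‖ ^ (1 / θ) + L)) (Real.exp_nonneg _)
    (contDiff_gker C ζ) fun x w => (H ζ x w).trans_eq ?_
  rw [← Real.exp_add]
  congr 1
  ring

/-- The wave packet `y ↦ gker C ζ y` as an element of the Gelfand-Shilov space. -/
def packet (hC : (C.map Complex.im).PosDef) {θ : ℝ} (hθ : 1 / 2 ≤ θ) (hθ' : θ < 1)
    (ζ : EuclideanSpace ℂ (Fin d)) : Space d θ :=
  ⟨gker C ζ ∘ incl, gker_mem_space hC hθ hθ' ζ⟩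

/-- The space S_{θ,h} depends on ε but not on ζ. This uniformity is what allows a single bound K_h
of an ultradistribution to be applied to all packets. -/
theorem exists_normLE_gker (hC : (C.map Complex.im).PosDef) {θ : ℝ} (hθ : 1 / 2 ≤ θ) (hθ' : θ < 1)
    {ε : ℝ} (hε : 0 < ε) :
    ∃ h > 0, ∃ K > 0, ∀ ζ : EuclideanSpace ℂ (Fin d), NormLE θ h
      (K * Real.exp (wt (C.map Complex.im) (imv ζ) + ε * ‖ζ‖ ^ (1 / θ))) (gker C ζ ∘ incl) := by
  obtain ⟨ε', hε', L, hL, H⟩ := exists_norm_gker_le_decay hC hθ hθ' hε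
  obtain ⟨h, hh, K, hK, HK⟩ := exists_normLE_of_entire d hθ hθ' hε' hL
  refine ⟨h, hh, K * Real.exp L, by positivity, fun ζ => ?_⟩
  rw [mul_assoc]
  refine HK _ (contDiff_gker C ζ) _ (by positivity) fun x w => (H ζ x w).trans_eq ?_
  rw [← Real.exp_add, ← Real.exp_add]
  congr 1
  ring

theorem exists_norm_dual_packet_le (hC : (C.map Complex.im).PosDef) {θ : ℝ} (hθ : 1 / 2 ≤ θ)
    (hθ' : θ < 1) (u : Dual d θ) {ε : ℝ} (hε : 0 < ε) :
    ∃ K > 0, ∀ ζ : EuclideanSpace ℂ (Fin d), ‖u.1 (packet hC hθ hθ' ζ)‖ ≤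
      K * Real.exp (wt (C.map Complex.im) (imv ζ) + ε * ‖ζ‖ ^ (1 / θ)) := by
  obtain ⟨h, hh, K, hK, HK⟩ := exists_normLE_gker hC hθ hθ' hε
  obtain ⟨K', HK'⟩ := u.2 h hh
  refine ⟨(|K'| + 1) * K, by positivity, fun ζ => (HK' _ _ (HK ζ)).trans ?_⟩
  rw [mul_assoc]
  gcongr
  have := le_abs_self K'
  linarith

/-! ### Differentiability of the pairing with wave packets -/

/-- The remainder of the Taylor expansion of order `n` of `ζ ↦ gker C ζ w` with increment `τ`. -/
def taylorRem (C : Matrix (Fin d) (Fin d) ℂ) (n : ℕ) (ζ τ w : EuclideanSpace ℂ (Fin d)) : ℂ :=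
  (Complex.exp (Complex.I * (τ.ofLp ⬝ᵥ w.ofLp)) -
    ∑ m ∈ Finset.range n, (Complex.I * (τ.ofLp ⬝ᵥ w.ofLp)) ^ m / m.factorial) * gker C ζ w

theorem contDiff_taylorRem (n : ℕ) (ζ τ : EuclideanSpace ℂ (Fin d)) :
    ContDiff ℂ ∞ (taylorRem C n ζ τ) := by
  have h : ContDiff ℂ ∞ fun w : EuclideanSpace ℂ (Fin d) => Complex.I * (τ.ofLp ⬝ᵥ w.ofLp) := by
    unfold dotProduct; fun_prop
  unfold taylorRem
  exact (h.cexp.sub (ContDiff.sum fun m _ => (h.pow m).div_const _)).mul (contDiff_gker C ζ)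

theorem taylorRem_one (ζ τ w : EuclideanSpace ℂ (Fin d)) :
    taylorRem C 1 ζ τ w = gker C (ζ + τ) w - gker C ζ w := by
  rw [taylorRem, gker_add]
  simp
  ring

theorem taylorRem_two (ζ τ w : EuclideanSpace ℂ (Fin d)) :
    taylorRem C 2 ζ τ w = gker C (ζ + τ) w - gker C ζ w -
      Complex.I * (τ.ofLp ⬝ᵥ w.ofLp) * gker C ζ w := by
  rw [taylorRem, gker_add]
  simp [Finset.sum_range_succ]
  ring

theorem taylorRem_mem_space (hC : (C.map Complex.im).PosDef) {θ : ℝ} (hθ : 1 / 2 ≤ θ) (hθ' : θ < 1)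
    (n : ℕ) (ζ : EuclideanSpace ℂ (Fin d)) {τ : EuclideanSpace ℂ (Fin d)} (hτ : ‖τ‖ ≤ 1) :
    taylorRem C n ζ τ ∘ incl ∈ Space d θ := by
  obtain ⟨ε, hε, L, hL, H⟩ := exists_norm_taylor_gker_le hC hθ hθ' one_pos
  exact comp_incl_mem_space hθ hθ' hε hL (by positivity) (contDiff_taylorRem n ζ τ)
    fun x w => H n ζ τ hτ x w

theorem exists_norm_dual_taylorRem_le (hC : (C.map Complex.im).PosDef) {θ : ℝ} (hθ : 1 / 2 ≤ θ)
    (hθ' : θ < 1) (u : Dual d θ) (n : ℕ) (ζ : EuclideanSpace ℂ (Fin d)) :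
    ∃ K, ∀ (τ : EuclideanSpace ℂ (Fin d)) (hτ : ‖τ‖ ≤ 1),
      ‖u.1 ⟨_, taylorRem_mem_space hC hθ hθ' n ζ hτ⟩‖ ≤ K * ‖τ‖ ^ n := by
  obtain ⟨ε, hε, L, hL, H⟩ := exists_norm_taylor_gker_le hC hθ hθ' one_pos
  obtain ⟨h, hh, K, hK, HK⟩ := exists_normLE_of_entire d hθ hθ' hε hL
  obtain ⟨K', HK'⟩ := u.2 h hh
  refine ⟨K' * (K * (n.factorial *
    Real.exp (L + wt (C.map Complex.im) (imv ζ) + 1 * ‖ζ‖ ^ (1 / θ)))), fun τ hτ => ?_⟩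
  refine (HK' _ _ (HK _ (contDiff_taylorRem n ζ τ) _ (by positivity)
    fun x w => H n ζ τ hτ x w)).trans_eq ?_
  ring

/-- The second Taylor remainder of ζ ↦ packet is O(‖τ‖²) in one S_{θ,h}, so u may be applied to the
expansion term by term. -/
theorem differentiable_dual_packet (hC : (C.map Complex.im).PosDef) {θ : ℝ} (hθ : 1 / 2 ≤ θ)
    (hθ' : θ < 1) (u : Dual d θ) : Differentiable ℂ fun ζ => u.1 (packet hC hθ hθ' ζ) := by
  intro ζ
  have hnorm : ∀ i : Fin d, ‖(EuclideanSpace.single i 1 : EuclideanSpace ℂ (Fin d))‖ ≤ 1 := by simp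
  -- The first remainder minus the second, in the direction e_i, is the coefficient i y_i e^{…} of
  -- the linear term; in this form its membership in `Space` is already known.
  let D : Fin d → Space d θ := fun i =>
    ⟨_, taylorRem_mem_space hC hθ hθ' 1 ζ (hnorm i)⟩ -
      ⟨_, taylorRem_mem_space hC hθ hθ' 2 ζ (hnorm i)⟩
  have hD : ∀ i y, (D i).1 y = Complex.I * (incl y i) * gker C ζ (incl y) := by
    intro i y
    change taylorRem C 1 ζ _ (incl y) - taylorRem C 2 ζ _ (incl y) = _
    rw [taylorRem_one, taylorRem_two]
    simp
  let ℓ : EuclideanSpace ℂ (Fin d) →L[ℂ] ℂ :=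
    ∑ i, (u.1 (D i)) • (EuclideanSpace.proj (𝕜 := ℂ) i : EuclideanSpace ℂ (Fin d) →L[ℂ] ℂ)
  obtain ⟨K, HK⟩ := exists_norm_dual_taylorRem_le hC hθ hθ' u 2 ζ
  refine HasFDerivAt.differentiableAt (f' := ℓ) ?_
  rw [hasFDerivAt_iff_isLittleO_nhds_zero]
  have hO : (fun τ => u.1 (packet hC hθ hθ' (ζ + τ)) - u.1 (packet hC hθ hθ' ζ) - ℓ τ)
      =O[nhds 0] fun τ : EuclideanSpace ℂ (Fin d) => ‖τ‖ ^ 2 := by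
    refine Asymptotics.IsBigO.of_bound K ?_
    filter_upwards [Metric.closedBall_mem_nhds (0 : EuclideanSpace ℂ (Fin d)) one_pos] with τ hτ
    have hτ' : ‖τ‖ ≤ 1 := by simpa using hτ
    have e : u.1 (packet hC hθ hθ' (ζ + τ)) - u.1 (packet hC hθ hθ' ζ) - ℓ τ =
        u.1 ⟨_, taylorRem_mem_space hC hθ hθ' 2 ζ hτ'⟩ := by
      have e1 : ℓ τ = u.1 (∑ i, τ i • D i) := by
        simp [ℓ, map_sum, mul_comm]
      rw [e1, ← map_sub, ← map_sub]
      congr 1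
      refine Subtype.ext (funext fun y => ?_)
      simp only [Submodule.coe_sub, Pi.sub_apply, Submodule.coe_sum, Submodule.coe_smul,
        Finset.sum_apply, Pi.smul_apply, hD, smul_eq_mul, packet, Function.comp_apply]
      rw [taylorRem_two]
      congr 1
      simp only [dotProduct, Finset.mul_sum, Finset.sum_mul]
      exact Finset.sum_congr rfl fun i _ => by ring
    rw [e]
    simpa using HK τ hτ'
  refine hO.trans_isLittleO ?_
  exact Asymptotics.isLittleO_norm_pow_id one_lt_two

/-! ### Cauchy estimates for entire functions of controlled growth -/

theorem exists_mderiv_estimate {θ : ℝ} (hθ' : θ < 1) {U : EuclideanSpace ℂ (Fin d) → ℂ}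
    (hU : Differentiable ℂ U) {X : EuclideanSpace ℂ (Fin d) → ℝ} {M L : ℝ} (hM : 0 ≤ M)
    (hL : 0 ≤ L) (H : ∀ z w, ‖U (z + w)‖ ≤
      M * Real.exp (X z + L * ‖w‖ ^ (1 / (1 - θ)))) :
    ∃ K > 0, ∀ (α : Fin d → ℕ) (z : EuclideanSpace ℂ (Fin d)),
      ‖mderiv ℂ α U z‖ ≤ K ^ (mlen α + 1) * mfact α ^ θ * Real.exp (X z) := by
  obtain ⟨K, hK, HK⟩ := exists_norm_mderiv_le d hθ' hL
  refine ⟨(M + 1) * K, by positivity, fun α z => ?_⟩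
  have h1 := HK U (contDiff_of_differentiable hU) z (M * Real.exp (X z)) (by positivity)
    (fun w => (H z w).trans_eq (by rw [Real.exp_add]; ring)) α
  refine h1.trans ?_
  have hβ0 := Real.rpow_nonneg (mfact_pos α).le θ
  have h2 : M ≤ (M + 1) ^ (mlen α + 1) :=
    (by linarith : M ≤ M + 1).trans (le_self_pow₀ (by linarith) (by simp))
  rw [mul_pow]
  calc M * Real.exp (X z) * K ^ (mlen α + 1) * mfact α ^ θ
      ≤ (M + 1) ^ (mlen α + 1) * Real.exp (X z) * K ^ (mlen α + 1) * mfact α ^ θ := by gcongr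
    _ = _ := by ring

end

section

variable {d : ℕ}

/-! ### Reduction of a general phase to wave packets -/

section Phase

variable (φ : FBIPhase d)

/-- The frequency `B z` of the wave packet that belongs to `z`. -/
def freq (z : EuclideanSpace ℂ (Fin d)) : EuclideanSpace ℂ (Fin d) :=
  WithLp.toLp 2 (φ.B *ᵥ z.ofLp)

/-- The inverse `ζ ↦ B⁻¹ ζ` of `freq`. -/
def freqInv (ζ : EuclideanSpace ℂ (Fin d)) : EuclideanSpace ℂ (Fin d) :=
  WithLp.toLp 2 (φ.B⁻¹ *ᵥ ζ.ofLp)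

/-- The holomorphic factor `exp ((i / 2) ⟨A z, z⟩)`. -/
def hol (z : EuclideanSpace ℂ (Fin d)) : ℂ :=
  Complex.exp (Complex.I * ((1 / 2) * ((φ.A *ᵥ z.ofLp) ⬝ᵥ z.ofLp)))

theorem isUnit_det_B : IsUnit φ.B.det := isUnit_iff_ne_zero.2 φ.det_B

theorem freq_freqInv (ζ : EuclideanSpace ℂ (Fin d)) : freq φ (freqInv φ ζ) = ζ := by
  simp [freq, freqInv, Matrix.mul_nonsing_inv _ (isUnit_det_B φ)]

theorem freqInv_freq (z : EuclideanSpace ℂ (Fin d)) : freqInv φ (freq φ z) = z := by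
  simp [freq, freqInv, Matrix.nonsing_inv_mul _ (isUnit_det_B φ)]

theorem differentiable_freq : Differentiable ℂ (freq φ) :=
  (LinearMap.toContinuousLinearMap (Matrix.toEuclideanLin φ.B)).differentiable

theorem differentiable_freqInv : Differentiable ℂ (freqInv φ) :=
  (LinearMap.toContinuousLinearMap (Matrix.toEuclideanLin φ.B⁻¹)).differentiable

theorem freq_add (z w : EuclideanSpace ℂ (Fin d)) : freq φ (z + w) = freq φ z + freq φ w := by
  simp [freq, Matrix.mulVec_add]

theorem differentiable_hol : Differentiable ℂ (hol φ) := by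
  unfold hol dotProduct Matrix.mulVec dotProduct
  fun_prop

theorem hol_ne_zero (z : EuclideanSpace ℂ (Fin d)) : hol φ z ≠ 0 := Complex.exp_ne_zero _

theorem norm_hol (z : EuclideanSpace ℂ (Fin d)) :
    ‖hol φ z‖ = Real.exp (-(1 / 2) * ((φ.A *ᵥ z.ofLp) ⬝ᵥ z.ofLp).im) := by
  rw [hol, Complex.norm_exp, Complex.I_mul_re, half_mul_im]
  congr 1
  ring

theorem exp_val_eq (z : EuclideanSpace ℂ (Fin d)) (y : EuclideanSpace ℝ (Fin d)) :
    Complex.exp (Complex.I * φ.val z y) = hol φ z * gker φ.C (freq φ z) (incl y) := by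
  rw [hol, gker, ← Complex.exp_add]
  congr 1
  have : φ.val z y = (1 / 2) * ((φ.A *ᵥ z.ofLp) ⬝ᵥ z.ofLp) + (φ.B *ᵥ z.ofLp) ⬝ᵥ (incl y).ofLp +
    (1 / 2) * ((φ.C *ᵥ (incl y).ofLp) ⬝ᵥ (incl y).ofLp) := rfl
  rw [this, freq]
  ring

theorem kernel_eq {θ : ℝ} (hθ : 1 / 2 ≤ θ) (hθ' : θ < 1) (z : EuclideanSpace ℂ (Fin d)) :
    φ.kernel hθ z = hol φ z • packet φ.posDef_C hθ hθ' (freq φ z) :=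
  Subtype.ext (funext fun y => exp_val_eq φ z y)

theorem transform_eq {θ : ℝ} (hθ : 1 / 2 ≤ θ) (hθ' : θ < 1) (u : Dual d θ)
    (z : EuclideanSpace ℂ (Fin d)) : φ.transform hθ u z =
      φ.const * (hol φ z * u.1 (packet φ.posDef_C hθ hθ' (freq φ z))) := by
  rw [FBIPhase.transform, kernel_eq φ hθ hθ', map_smul, smul_eq_mul]

theorem const_pos : 0 < φ.const := by
  have := φ.posDef_C.det_pos
  have := norm_pos_iff.2 φ.det_B
  have := Real.pi_pos
  unfold FBIPhase.const
  positivity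

theorem neg_im_val (z : EuclideanSpace ℂ (Fin d)) (y : EuclideanSpace ℝ (Fin d)) :
    -(φ.val z y).im = -(1 / 2) * ((φ.A *ᵥ z.ofLp) ⬝ᵥ z.ofLp).im +
      (wt (φ.C.map Complex.im) (imv (freq φ z)) - (1 / 2) * (((φ.C.map Complex.im) *ᵥ
        (y - cen (φ.C.map Complex.im) (imv (freq φ z))).ofLp) ⬝ᵥ
          (y - cen (φ.C.map Complex.im) (imv (freq φ z))).ofLp)) := by
  have h := congrArg norm (exp_val_eq φ z y)
  rw [norm_mul, norm_hol, norm_gker_incl φ.posDef_C, ← Real.exp_add, Complex.norm_exp,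
    Complex.I_mul_re] at h
  exact Real.exp_injective h

/-- The supremum is attained at y = `cen`. The first summand is log ‖hol φ z‖, so division by `hol`
removes A from the problem. -/
theorem weight_eq (z : EuclideanSpace ℂ (Fin d)) :
    φ.weight z = -(1 / 2) * ((φ.A *ᵥ z.ofLp) ⬝ᵥ z.ofLp).im +
      wt (φ.C.map Complex.im) (imv (freq φ z)) := by
  obtain ⟨c, hc, Hc⟩ := FBIPhase.exists_coercive φ.posDef_C
  have hle : ∀ y, -(φ.val z y).im ≤ -(1 / 2) * ((φ.A *ᵥ z.ofLp) ⬝ᵥ z.ofLp).im +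
      wt (φ.C.map Complex.im) (imv (freq φ z)) := by
    intro y
    rw [neg_im_val]
    have h1 := Hc (y - cen (φ.C.map Complex.im) (imv (freq φ z)))
    have : 0 ≤ c * ‖y - cen (φ.C.map Complex.im) (imv (freq φ z))‖ ^ 2 := by positivity
    linarith
  refine le_antisymm (ciSup_le hle) ?_
  refine le_trans (le_of_eq ?_) (le_ciSup (f := fun y => -(φ.val z y).im)
    ⟨_, Set.forall_mem_range.2 hle⟩ (cen (φ.C.map Complex.im) (imv (freq φ z))))
  simp only [neg_im_val]
  simp

/-- The dictionary between bounds e^{wt + t} for packets in ζ = Bz and bounds e^{t + Φ} for the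
transform in z. -/
theorem norm_hol_mul_exp (z : EuclideanSpace ℂ (Fin d)) (t : ℝ) :
    ‖hol φ z‖ * Real.exp (wt (φ.C.map Complex.im) (imv (freq φ z)) + t) =
      Real.exp (t + φ.weight z) := by
  rw [norm_hol, ← Real.exp_add, weight_eq]
  congr 1
  ring

theorem exists_wt_add_le (S : Matrix (Fin d) (Fin d) ℝ) :
    ∃ K ≥ 0, ∀ η η' : EuclideanSpace ℝ (Fin d),
      wt S (η + η') ≤ wt S η + K * (‖η‖ * ‖η'‖ + ‖η'‖ ^ 2) := by
  obtain ⟨K, hK, HK⟩ := exists_norm_mulVec_le S⁻¹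
  have hb : ∀ v w : EuclideanSpace ℝ (Fin d), (S⁻¹ *ᵥ v.ofLp) ⬝ᵥ w.ofLp ≤ K * ‖v‖ * ‖w‖ := by
    intro v w
    have h : (S⁻¹ *ᵥ v.ofLp) ⬝ᵥ w.ofLp = inner ℝ (WithLp.toLp 2 (S⁻¹ *ᵥ v.ofLp)) w := by
      simp [PiLp.inner_apply, dotProduct, mul_comm]
    rw [h]
    exact (real_inner_le_norm _ _).trans (by gcongr; exact HK v)
  refine ⟨K, hK, fun η η' => ?_⟩
  have e : wt S (η + η') = wt S η + (1 / 2) * ((S⁻¹ *ᵥ η.ofLp) ⬝ᵥ η'.ofLp) +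
      (1 / 2) * ((S⁻¹ *ᵥ η'.ofLp) ⬝ᵥ η.ofLp) + (1 / 2) * ((S⁻¹ *ᵥ η'.ofLp) ⬝ᵥ η'.ofLp) := by
    simp only [wt, WithLp.ofLp_add, Matrix.mulVec_add, dotProduct_add, add_dotProduct]
    ring
  rw [e]
  have h1 := hb η η'
  have h2 := hb η' η
  have h3 := hb η' η'
  have : 0 ≤ K * ‖η'‖ * ‖η'‖ := by positivity
  nlinarith

theorem exists_norm_freq_le : ∃ K ≥ 0, ∀ z, ‖freq φ z‖ ≤ K * ‖z‖ := exists_norm_mulVec_le φ.B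

theorem exists_norm_freqInv_le : ∃ K ≥ 0, ∀ z, ‖freqInv φ z‖ ≤ K * ‖z‖ :=
  exists_norm_mulVec_le φ.B⁻¹

theorem exists_weight_add_le : ∃ K ≥ 0, ∀ z w : EuclideanSpace ℂ (Fin d),
    φ.weight (z + w) ≤ φ.weight z + K * (‖z‖ * ‖w‖ + ‖w‖ ^ 2) := by
  obtain ⟨K₁, hK₁, H₁⟩ := FBIPhase.norm_bilin_le φ.A
  obtain ⟨K₂, hK₂, H₂⟩ := exists_wt_add_le (φ.C.map Complex.im)
  obtain ⟨b, hb, Hb⟩ := exists_norm_freq_le φ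
  refine ⟨K₁ + K₂ * b ^ 2, by positivity, fun z w => ?_⟩
  rw [weight_eq, weight_eq, freq_add]
  have e : imv (freq φ z + freq φ w) = imv (freq φ z) + imv (freq φ w) := by
    ext i; simp [imv_apply]
  rw [e]
  have h1 := H₂ (imv (freq φ z)) (imv (freq φ w))
  have n1 := (norm_imv_le (freq φ z)).trans (Hb z)
  have n2 := (norm_imv_le (freq φ w)).trans (Hb w)
  have h2 : K₂ * (‖imv (freq φ z)‖ * ‖imv (freq φ w)‖ + ‖imv (freq φ w)‖ ^ 2) ≤
      K₂ * (b * ‖z‖ * (b * ‖w‖) + (b * ‖w‖) ^ 2) := by gcongr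
  have t : ∀ u : ℂ, -u.im ≤ ‖u‖ := fun u => (neg_le_abs _).trans (Complex.abs_im_le_norm u)
  have h3 := (t _).trans (H₁ z w)
  have h4 := (t _).trans (H₁ w z)
  have h5 := (t _).trans (H₁ w w)
  have h6 : ((φ.A *ᵥ (z + w).ofLp) ⬝ᵥ (z + w).ofLp).im = ((φ.A *ᵥ z.ofLp) ⬝ᵥ z.ofLp).im +
      ((φ.A *ᵥ z.ofLp) ⬝ᵥ w.ofLp).im + ((φ.A *ᵥ w.ofLp) ⬝ᵥ z.ofLp).im +
      ((φ.A *ᵥ w.ofLp) ⬝ᵥ w.ofLp).im := by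
    simp only [WithLp.ofLp_add, Matrix.mulVec_add, dotProduct_add, add_dotProduct, Complex.add_im]
    ring
  rw [h6]
  have : 0 ≤ K₁ * ‖w‖ * ‖w‖ := by positivity
  nlinarith

/-- Φ is quadratic, so its increment is O(‖z‖‖w‖ + ‖w‖²). Young's inequality handles the first term
and 1/(1-θ) ≥ 2 the second. -/
theorem exists_weight_add_le_young {θ : ℝ} (hθ : 1 / 2 ≤ θ) (hθ' : θ < 1) {ε : ℝ} (hε : 0 < ε) :
    ∃ L ≥ 0, ∀ z w : EuclideanSpace ℂ (Fin d),
      φ.weight (z + w) ≤ φ.weight z + ε * ‖z‖ ^ (1 / θ) + L * (1 + ‖w‖ ^ (1 / (1 - θ))) := by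
  obtain ⟨K, hK, H⟩ := exists_weight_add_le φ
  obtain ⟨Y, hY, HY⟩ := exists_young hθ hθ' hε K
  refine ⟨Y + K, by positivity, fun z w => (H z w).trans ?_⟩
  have h1 := HY ‖z‖ ‖w‖ (norm_nonneg _) (norm_nonneg _)
  have h2 := sq_le_one_add_rpow hθ hθ' (norm_nonneg w)
  have h3 : K * ‖w‖ ^ 2 ≤ K * (1 + ‖w‖ ^ (1 / (1 - θ))) := by gcongr
  nlinarith

/-- Cauchy's inequalities recover all derivatives from the sup bound. Of the available ε, one half
is 4·ε/8 from the quasi-triangle inequality and the other half is the shift of Φ. -/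
theorem growthEstimate_of_norm_le {θ : ℝ} (hθ : 1 / 2 ≤ θ) (hθ' : θ < 1)
    {U : EuclideanSpace ℂ (Fin d) → ℂ} (hU : Differentiable ℂ U)
    (H : ∀ ε > 0, ∃ K > 0, ∀ z, ‖U z‖ ≤ K * Real.exp (ε * ‖z‖ ^ (1 / θ) + φ.weight z)) :
    φ.GrowthEstimate θ U := by
  intro ε hε
  obtain ⟨K, hK, HK⟩ := H (ε / 8) (by positivity)
  obtain ⟨L, hL, HL⟩ := exists_weight_add_le_young φ hθ hθ' (half_pos hε)
  refine exists_mderiv_estimate hθ' hU (X := fun z => ε * ‖z‖ ^ (1 / θ) + φ.weight z)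
    (M := K * Real.exp (L + ε)) (L := L + ε) (by positivity) (by positivity) fun z w => ?_
  refine (HK (z + w)).trans ?_
  rw [mul_assoc, ← Real.exp_add]
  refine mul_le_mul_of_nonneg_left (Real.exp_le_exp.2 ?_) hK.le
  have h1 := HL z w
  have h2 := norm_add_rpow_le hθ z w
  have h3 := rpow_le_one_add_conj_rpow hθ hθ' (norm_nonneg w)
  have h4 : ε / 8 * ‖z + w‖ ^ (1 / θ) ≤
      ε / 8 * (4 * (‖z‖ ^ (1 / θ) + (1 + ‖w‖ ^ (1 / (1 - θ))))) := by
    gcongr; linarith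
  have h5 : 0 ≤ ε * ‖w‖ ^ (1 / (1 - θ)) := by positivity
  nlinarith

/-- The quasi-triangle inequality bounds ‖z‖ by ‖z + w‖ and ‖w‖, which leaves the rate ε/4 in z; the
shift of Φ consumes half of that. -/
theorem decayEstimate_of_norm_le {θ : ℝ} (hθ : 1 / 2 ≤ θ) (hθ' : θ < 1)
    {U : EuclideanSpace ℂ (Fin d) → ℂ} (hU : Differentiable ℂ U)
    (H : ∃ ε > 0, ∃ K > 0, ∀ z, ‖U z‖ ≤ K * Real.exp (-ε * ‖z‖ ^ (1 / θ) + φ.weight z)) :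
    φ.DecayEstimate θ U := by
  obtain ⟨ε, hε, K, hK, HK⟩ := H
  obtain ⟨L, hL, HL⟩ := exists_weight_add_le_young φ hθ hθ' (ε := ε / 8) (by positivity)
  refine ⟨ε / 8, by positivity, ?_⟩
  refine exists_mderiv_estimate hθ' hU (X := fun z => -(ε / 8) * ‖z‖ ^ (1 / θ) + φ.weight z)
    (M := K * Real.exp (L + ε)) (L := L + ε) (by positivity) (by positivity) fun z w => ?_
  refine (HK (z + w)).trans ?_
  rw [mul_assoc, ← Real.exp_add]
  refine mul_le_mul_of_nonneg_left (Real.exp_le_exp.2 ?_) hK.le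
  have h1 := HL z w
  have h2 := norm_add_rpow_le hθ (z + w) (-w)
  rw [add_neg_cancel_right, norm_neg] at h2
  have h3 := rpow_le_one_add_conj_rpow hθ hθ' (norm_nonneg w)
  have h4 : ε / 4 * ‖z‖ ^ (1 / θ) ≤
      ε / 4 * (4 * (‖z + w‖ ^ (1 / θ) + (1 + ‖w‖ ^ (1 / (1 - θ))))) := by
    gcongr; linarith
  nlinarith

end Phase

/-! ### The direct estimates -/

variable (φ : FBIPhase d) {θ : ℝ} (hθ : 1 / 2 ≤ θ)

theorem differentiable_transform (hθ' : θ < 1) (u : Dual d θ) : Differentiable ℂ (φ.transform hθ u) := by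
  have e : φ.transform hθ u = fun z => φ.const *
      (hol φ z * u.1 (packet φ.posDef_C hθ hθ' (freq φ z))) :=
    funext fun z => transform_eq φ hθ hθ' u z
  rw [e]
  exact ((differentiable_hol φ).mul ((differentiable_dual_packet φ.posDef_C hθ hθ' u).comp
    (differentiable_freq φ))).const_mul _

theorem growthEstimate_transform (hθ' : θ < 1) (u : Dual d θ) :
    φ.GrowthEstimate θ (φ.transform hθ u) := by
  refine growthEstimate_of_norm_le φ hθ hθ' (differentiable_transform φ hθ hθ' u) fun ε hε => ?_
  obtain ⟨b, hb, Hb⟩ := exists_norm_freq_le φ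
  set R := b ^ (1 / θ) with hR
  have hR0 : 0 ≤ R := by positivity
  obtain ⟨K, hK, HK⟩ := exists_norm_dual_packet_le φ.posDef_C hθ hθ' u
    (ε := ε / (R + 1)) (by positivity)
  have hc := const_pos φ
  refine ⟨φ.const * K, by positivity, fun z => ?_⟩
  rw [transform_eq φ hθ hθ', norm_mul, norm_mul, Complex.norm_real, Real.norm_of_nonneg hc.le,
    ← norm_hol_mul_exp]
  have h1 : ε / (R + 1) * ‖freq φ z‖ ^ (1 / θ) ≤ ε * ‖z‖ ^ (1 / θ) := by
    have : ‖freq φ z‖ ^ (1 / θ) ≤ R * ‖z‖ ^ (1 / θ) := by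
      rw [hR, ← Real.mul_rpow hb (norm_nonneg _)]
      have := Hb z
      gcongr
    calc ε / (R + 1) * ‖freq φ z‖ ^ (1 / θ) ≤ ε / (R + 1) * (R * ‖z‖ ^ (1 / θ)) := by gcongr
      _ = ε * (R / (R + 1)) * ‖z‖ ^ (1 / θ) := by ring
      _ ≤ ε * 1 * ‖z‖ ^ (1 / θ) := by
          gcongr; rw [div_le_one (by positivity)]; linarith
      _ = _ := by ring
  calc φ.const * (‖hol φ z‖ * ‖u.1 (packet φ.posDef_C hθ hθ' (freq φ z))‖)
      ≤ φ.const * (‖hol φ z‖ * (K * Real.exp (wt (φ.C.map Complex.im) (imv (freq φ z)) +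
          ε * ‖z‖ ^ (1 / θ)))) := by
        gcongr
        refine (HK _).trans ?_
        gcongr
    _ = _ := by ring

theorem decayEstimate_transform (hθ' : θ < 1) (f : Space d θ) :
    φ.DecayEstimate θ (φ.transform hθ (Space.toDual f)) := by
  refine decayEstimate_of_norm_le φ hθ hθ' (differentiable_transform φ hθ hθ' _) ?_
  obtain ⟨hf, h, hh, M, hM⟩ := f.2
  have hM0 := hM.nonneg
  obtain ⟨b, hb, Hb⟩ := exists_norm_freqInv_le φ
  set R := b ^ (1 / θ) with hR
  have hR0 : 0 ≤ R := by positivity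
  obtain ⟨ε, hε, K, hK, HK⟩ := exists_norm_integral_mul_gker_le φ.posDef_C hθ hθ' hh
  have hc := const_pos φ
  refine ⟨ε / (R + 1), by positivity, φ.const * (K * (M + 1)), by positivity, fun z => ?_⟩
  rw [transform_eq φ hθ hθ', norm_mul, norm_mul, Complex.norm_real, Real.norm_of_nonneg hc.le,
    ← norm_hol_mul_exp]
  have h1 : ε / (R + 1) * ‖z‖ ^ (1 / θ) ≤ ε * ‖freq φ z‖ ^ (1 / θ) := by
    have : ‖z‖ ^ (1 / θ) ≤ R * ‖freq φ z‖ ^ (1 / θ) := by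
      rw [hR, ← Real.mul_rpow hb (norm_nonneg _)]
      have := Hb (freq φ z)
      rw [freqInv_freq] at this
      gcongr
    calc ε / (R + 1) * ‖z‖ ^ (1 / θ) ≤ ε / (R + 1) * (R * ‖freq φ z‖ ^ (1 / θ)) := by gcongr
      _ = ε * (R / (R + 1)) * ‖freq φ z‖ ^ (1 / θ) := by ring
      _ ≤ ε * 1 * ‖freq φ z‖ ^ (1 / θ) := by
          gcongr; rw [div_le_one (by positivity)]; linarith
      _ = _ := by ring
  have h2 : ‖(Space.toDual f).1 (packet φ.posDef_C hθ hθ' (freq φ z))‖ ≤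
      K * (M + 1) * Real.exp (wt (φ.C.map Complex.im) (imv (freq φ z)) +
        -(ε / (R + 1)) * ‖z‖ ^ (1 / θ)) := by
    refine (HK f.1 M hf hM (freq φ z)).trans ?_
    gcongr
    · linarith
    · linarith
  calc φ.const * (‖hol φ z‖ * ‖(Space.toDual f).1 (packet φ.posDef_C hθ hθ' (freq φ z))‖)
      ≤ φ.const * (‖hol φ z‖ * (K * (M + 1) * Real.exp (wt (φ.C.map Complex.im) (imv (freq φ z)) +
        -(ε / (R + 1)) * ‖z‖ ^ (1 / θ)))) := by gcongr
    _ = _ := by ring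

end

section

variable {d : ℕ} {C : Matrix (Fin d) (Fin d) ℂ}

/-! ### Superpositions of wave packets -/

theorem wt_nonneg {S : Matrix (Fin d) (Fin d) ℝ} (hS : S.PosDef) (η : EuclideanSpace ℝ (Fin d)) :
    0 ≤ wt S η := by
  obtain ⟨c, hc, Hc⟩ := FBIPhase.exists_coercive hS
  have h := complete_square hS η 0
  have h1 := Hc (0 - cen S η)
  simp only [WithLp.ofLp_zero, dotProduct_zero, Matrix.mulVec_zero] at h
  have : 0 ≤ c * ‖0 - cen S η‖ ^ 2 := by positivity
  linarith

/-- The bilinear pairing `⟨ζ, w⟩` as a continuous bilinear map. -/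
def dotL : EuclideanSpace ℂ (Fin d) →L[ℂ] EuclideanSpace ℂ (Fin d) →L[ℂ] ℂ :=
  LinearMap.mkContinuous₂
    (LinearMap.mk₂ ℂ (fun ζ w : EuclideanSpace ℂ (Fin d) => ζ.ofLp ⬝ᵥ w.ofLp)
      (fun a b c => by simp [add_dotProduct]) (fun a b c => by simp)
      (fun a b c => by simp [dotProduct_add]) (fun a b c => by simp)) 1
    (fun ζ w => by simpa using norm_dotProduct_le ζ w)

theorem dotL_apply (ζ w : EuclideanSpace ℂ (Fin d)) : dotL ζ w = ζ.ofLp ⬝ᵥ w.ofLp := rfl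

theorem norm_dotL_le (ζ : EuclideanSpace ℂ (Fin d)) : ‖dotL ζ‖ ≤ ‖ζ‖ :=
  ContinuousLinearMap.opNorm_le_bound _ (norm_nonneg _) fun w => norm_dotProduct_le ζ w

theorem gker_eq_exp_mul (ζ w : EuclideanSpace ℂ (Fin d)) :
    gker C ζ w = Complex.exp (Complex.I * dotL ζ w) * gker C 0 w := by
  have := gker_add C 0 ζ w
  rwa [zero_add] at this

theorem exists_integrable_exp_linear {θ : ℝ} (hθ : 1 / 2 ≤ θ) (hθ' : θ < 1) {ε : ℝ} (hε : 0 < ε)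
    (R : ℝ) : Integrable fun p : EuclideanSpace ℝ (Fin d) × EuclideanSpace ℝ (Fin d) =>
      Real.exp (R * ‖toC p‖ - ε * ‖toC p‖ ^ (1 / θ)) := by
  obtain ⟨Y, hY, HY⟩ := exists_young hθ hθ' (half_pos hε) R
  have hp : 0 < 1 / θ := by positivity
  refine ((integrable_exp_neg_norm_toC (d := d) hθ hθ' (half_pos hε)).const_mul
    (Real.exp Y)).mono' (Continuous.aestronglyMeasurable ?_)
    (Filter.Eventually.of_forall fun p => ?_)
  · have h1 : Continuous fun p : EuclideanSpace ℝ (Fin d) × EuclideanSpace ℝ (Fin d) =>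
        ‖toC p‖ := continuous_toC.norm
    have h2 := h1.rpow_const (p := 1 / θ) fun _ => Or.inr hp.le
    fun_prop
  · rw [Real.norm_of_nonneg (Real.exp_nonneg _), ← Real.exp_add]
    refine Real.exp_le_exp.2 ?_
    have := HY ‖toC p‖ 1 (norm_nonneg _) zero_le_one
    simp only [mul_one, Real.one_rpow] at this
    linarith

/-- A superposition of wave packets with decaying coefficients is entire. -/
theorem differentiable_superposition (hC : (C.map Complex.im).PosDef) {θ : ℝ} (hθ : 1 / 2 ≤ θ)
    (hθ' : θ < 1) {ε K : ℝ} (hε : 0 < ε)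
    {m : EuclideanSpace ℝ (Fin d) × EuclideanSpace ℝ (Fin d) → ℂ} (hm : AEStronglyMeasurable m)
    (hmb : ∀ p, ‖m p‖ ≤
      K * Real.exp (-wt (C.map Complex.im) p.2 - ε * ‖toC p‖ ^ (1 / θ))) :
    Differentiable ℂ fun w => ∫ p, m p * gker C (toC p) w := by
  -- The Gaussian in w does not depend on p and is pulled out, so only the exponential of a linear
  -- form is differentiated under the integral.
  have e : (fun w => ∫ p, m p * gker C (toC p) w) =
      fun w => (∫ p, m p * Complex.exp (Complex.I * dotL (toC p) w)) * gker C 0 w := by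
    funext w
    rw [← integral_mul_const]
    congr 1
    funext p
    rw [gker_eq_exp_mul, mul_assoc]
  rw [e]
  refine Differentiable.mul ?_ ((contDiff_gker C 0).differentiable (by simp))
  intro w₀
  have hK : 0 ≤ K := by
    have := (norm_nonneg _).trans (hmb 0)
    exact nonneg_of_mul_nonneg_left this (Real.exp_pos _)
  have hmb' : ∀ p, ‖m p‖ ≤ K * Real.exp (-ε * ‖toC p‖ ^ (1 / θ)) := fun p =>
    (hmb p).trans (by
      gcongr
      have := wt_nonneg hC p.2
      linarith)
  have hL : Continuous fun p : EuclideanSpace ℝ (Fin d) × EuclideanSpace ℝ (Fin d) =>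
      dotL (toC p) := dotL.continuous.comp continuous_toC
  have hcexp : ∀ w : EuclideanSpace ℂ (Fin d), Continuous
      fun p : EuclideanSpace ℝ (Fin d) × EuclideanSpace ℝ (Fin d) =>
        Complex.exp (Complex.I * dotL (toC p) w) := fun w => by
    have := hL.clm_apply (continuous_const (y := w))
    fun_prop
  have hexpb : ∀ (p : EuclideanSpace ℝ (Fin d) × EuclideanSpace ℝ (Fin d))
      (w : EuclideanSpace ℂ (Fin d)),
      ‖Complex.exp (Complex.I * dotL (toC p) w)‖ ≤ Real.exp (‖toC p‖ * ‖w‖) := fun p w => by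
    refine (Complex.norm_exp_le_exp_norm _).trans (Real.exp_le_exp.2 ?_)
    simpa [dotL_apply] using norm_dotProduct_le (toC p) w
  refine (hasFDerivAt_integral_of_dominated_of_fderiv_le (𝕜 := ℂ)
    (F := fun w p => m p * Complex.exp (Complex.I * dotL (toC p) w))
    (F' := fun w p => (m p * Complex.exp (Complex.I * dotL (toC p) w) * Complex.I) • dotL (toC p))
    -- In ‖w₀‖ + 2, one unit is the radius of the ball about w₀ and the other absorbs the factor
    -- ‖toC p‖ of the derivative.
    (bound := fun p => K * Real.exp ((‖w₀‖ + 2) * ‖toC p‖ - ε * ‖toC p‖ ^ (1 / θ)))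
    (x₀ := w₀) (Metric.ball_mem_nhds w₀ one_pos) ?_ ?_ ?_ ?_ ?_ ?_).differentiableAt
  · exact Filter.Eventually.of_forall fun w => hm.mul (hcexp w).aestronglyMeasurable
  · refine ((exists_integrable_exp_linear hθ hθ' hε ‖w₀‖).const_mul K).mono'
      (hm.mul (hcexp w₀).aestronglyMeasurable) (Filter.Eventually.of_forall fun p => ?_)
    rw [norm_mul]
    refine (mul_le_mul (hmb' p) (hexpb p w₀) (norm_nonneg _) (by positivity)).trans_eq ?_
    rw [mul_assoc, ← Real.exp_add]
    ring_nf
  · exact ((hm.mul (hcexp w₀).aestronglyMeasurable).mul_const _).smul hL.aestronglyMeasurable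
  · refine Filter.Eventually.of_forall fun p w hw => ?_
    have hw' : ‖w‖ ≤ ‖w₀‖ + 1 := by
      have h1 := norm_add_le w₀ (w - w₀)
      rw [add_sub_cancel] at h1
      have h2 : ‖w - w₀‖ < 1 := mem_ball_iff_norm.1 hw
      linarith
    rw [norm_smul, norm_mul, norm_mul, Complex.norm_I, mul_one]
    have h3 : ‖toC p‖ ≤ Real.exp ‖toC p‖ := by linarith [Real.add_one_le_exp ‖toC p‖]
    calc ‖m p‖ * ‖Complex.exp (Complex.I * dotL (toC p) w)‖ * ‖dotL (toC p)‖
        ≤ K * Real.exp (-ε * ‖toC p‖ ^ (1 / θ)) * Real.exp (‖toC p‖ * (‖w₀‖ + 1)) *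
          Real.exp ‖toC p‖ := by
          gcongr
          · exact hmb' p
          · exact (hexpb p w).trans (by gcongr)
          · exact (norm_dotL_le _).trans h3
      _ = _ := by
          rw [mul_assoc, mul_assoc, ← Real.exp_add, ← Real.exp_add]
          ring_nf
  · exact (exists_integrable_exp_linear hθ hθ' hε (‖w₀‖ + 2)).const_mul K
  · refine Filter.Eventually.of_forall fun p w _ => ?_
    have h1 := (((dotL (toC p)).hasFDerivAt (x := w)).const_mul Complex.I).cexp.const_mul (m p)
    refine h1.congr_fderiv ?_
    rw [smul_smul, smul_smul]

/-- The factor e^{-wt} of the density cancels the peak e^{wt} of the packet. Half of the decay ε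
compensates the growth of the packet in ζ, and the other half makes the integral converge. -/
theorem exists_norm_superposition_le (hC : (C.map Complex.im).PosDef) {θ : ℝ} (hθ : 1 / 2 ≤ θ)
    (hθ' : θ < 1) {ε K : ℝ} (hε : 0 < ε)
    {m : EuclideanSpace ℝ (Fin d) × EuclideanSpace ℝ (Fin d) → ℂ}
    (hmb : ∀ p, ‖m p‖ ≤
      K * Real.exp (-wt (C.map Complex.im) p.2 - ε * ‖toC p‖ ^ (1 / θ))) :
    ∃ ε' > 0, ∃ L ≥ 0, ∃ M ≥ 0, ∀ (x : EuclideanSpace ℝ (Fin d)) (w : EuclideanSpace ℂ (Fin d)),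
      ‖∫ p, m p * gker C (toC p) (incl x + w)‖ ≤
        M * Real.exp (-ε' * ‖x‖ ^ (1 / θ) + L * ‖w‖ ^ (1 / (1 - θ))) := by
  have hK : 0 ≤ K := by
    have := (norm_nonneg _).trans (hmb 0)
    exact nonneg_of_mul_nonneg_left this (Real.exp_pos _)
  obtain ⟨ε', hε', L, hL, H⟩ := exists_norm_gker_le_decay hC hθ hθ' (half_pos hε)
  have hint := integrable_exp_neg_norm_toC (d := d) hθ hθ' (half_pos hε)
  refine ⟨ε', hε', L, hL, K * Real.exp L * ∫ p : EuclideanSpace ℝ (Fin d) ×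
    EuclideanSpace ℝ (Fin d), Real.exp (-(ε / 2) * ‖toC p‖ ^ (1 / θ)),
    mul_nonneg (by positivity) (integral_nonneg fun p => Real.exp_nonneg _), fun x w => ?_⟩
  refine (norm_integral_le_of_norm_le (hint.const_mul (K * Real.exp L *
    Real.exp (-ε' * ‖x‖ ^ (1 / θ) + L * ‖w‖ ^ (1 / (1 - θ)))))
    (Filter.Eventually.of_forall fun p => ?_)).trans_eq ?_
  · rw [norm_mul]
    have h1 := H (toC p) x w
    rw [imv_toC] at h1
    refine (mul_le_mul (hmb p) h1 (norm_nonneg _) (by positivity)).trans_eq ?_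
    simp only [mul_assoc, ← Real.exp_add]
    congr 2
    ring
  · rw [integral_const_mul]
    ring

theorem superposition_mem_space (hC : (C.map Complex.im).PosDef) {θ : ℝ} (hθ : 1 / 2 ≤ θ)
    (hθ' : θ < 1) {ε K : ℝ} (hε : 0 < ε)
    {m : EuclideanSpace ℝ (Fin d) × EuclideanSpace ℝ (Fin d) → ℂ} (hm : AEStronglyMeasurable m)
    (hmb : ∀ p, ‖m p‖ ≤
      K * Real.exp (-wt (C.map Complex.im) p.2 - ε * ‖toC p‖ ^ (1 / θ))) :
    (fun w => ∫ p, m p * gker C (toC p) w) ∘ incl ∈ Space d θ := by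
  obtain ⟨ε', hε', L, hL, M, hM, H⟩ := exists_norm_superposition_le hC hθ hθ' hε hmb
  exact comp_incl_mem_space hθ hθ' hε' hL hM
    (contDiff_of_differentiable (differentiable_superposition hC hθ hθ' hε hm hmb)) H

end

section

open scoped ENNReal

variable {d : ℕ} {C : Matrix (Fin d) (Fin d) ℂ}

/-! ### Ultradistributions commute with superpositions of wave packets -/

section Weighted

/-- The Banach space of bounded functions on `ℝ ^ d × ℂ ^ d`. -/
abbrev Bdd (d : ℕ) : Type :=
  lp (fun _ : EuclideanSpace ℝ (Fin d) × EuclideanSpace ℂ (Fin d) => ℂ) ∞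

/-- The weight `exp (-ε |x| ^ (1 / θ) + L |w| ^ (1 / (1 - θ)))`. -/
def bwt (θ ε L : ℝ) (q : EuclideanSpace ℝ (Fin d) × EuclideanSpace ℂ (Fin d)) : ℝ :=
  Real.exp (-ε * ‖q.1‖ ^ (1 / θ) + L * ‖q.2‖ ^ (1 / (1 - θ)))

theorem bwt_pos (θ ε L : ℝ) (q : EuclideanSpace ℝ (Fin d) × EuclideanSpace ℂ (Fin d)) :
    0 < bwt θ ε L q := Real.exp_pos _

theorem bwt_ne_zero (θ ε L : ℝ) (q : EuclideanSpace ℝ (Fin d) × EuclideanSpace ℂ (Fin d)) :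
    (bwt θ ε L q : ℂ) ≠ 0 := by exact_mod_cast (bwt_pos θ ε L q).ne'

theorem norm_div_bwt_le {θ ε L M : ℝ} {F : EuclideanSpace ℂ (Fin d) → ℂ}
    (H : ∀ (x : EuclideanSpace ℝ (Fin d)) (w : EuclideanSpace ℂ (Fin d)), ‖F (incl x + w)‖ ≤
      M * Real.exp (-ε * ‖x‖ ^ (1 / θ) + L * ‖w‖ ^ (1 / (1 - θ))))
    (q : EuclideanSpace ℝ (Fin d) × EuclideanSpace ℂ (Fin d)) :
    ‖F (incl q.1 + q.2) / (bwt θ ε L q : ℂ)‖ ≤ M := by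
  rw [norm_div, Complex.norm_real, Real.norm_of_nonneg (bwt_pos _ _ _ _).le,
    div_le_iff₀ (bwt_pos _ _ _ _)]
  exact H q.1 q.2

/-- A function of controlled growth, divided by the weight. -/
def toBdd {θ ε L M : ℝ} (F : EuclideanSpace ℂ (Fin d) → ℂ)
    (H : ∀ (x : EuclideanSpace ℝ (Fin d)) (w : EuclideanSpace ℂ (Fin d)), ‖F (incl x + w)‖ ≤
      M * Real.exp (-ε * ‖x‖ ^ (1 / θ) + L * ‖w‖ ^ (1 / (1 - θ)))) : Bdd d :=
  ⟨fun q => F (incl q.1 + q.2) / (bwt θ ε L q : ℂ), memℓp_infty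
    ⟨M, Set.forall_mem_range.2 fun q => norm_div_bwt_le H q⟩⟩

/-- The function on `ℂ ^ d` that a bounded function represents. -/
def ofBdd (θ ε L : ℝ) (b : Bdd d) (w : EuclideanSpace ℂ (Fin d)) : ℂ :=
  bwt θ ε L (0, w) * b (0, w)

/-- The subspace of bounded functions that represent entire functions. -/
def entireBdd (d : ℕ) (θ ε L : ℝ) : Submodule ℂ (Bdd d) where
  carrier := {b | ContDiff ℂ ∞ (ofBdd θ ε L b) ∧ ∀ q, ofBdd θ ε L b (incl q.1 + q.2) =
    bwt θ ε L q * b q}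
  zero_mem' := by
    have : ofBdd θ ε L (0 : Bdd d) = 0 := by
      funext w
      simp [ofBdd]
    refine ⟨by rw [this]; exact contDiff_const, fun q => ?_⟩
    rw [this]
    simp
  add_mem' := by
    rintro a b ⟨ha, ha'⟩ ⟨hb, hb'⟩
    have : ofBdd θ ε L (a + b) = ofBdd θ ε L a + ofBdd θ ε L b := by
      funext w
      simp [ofBdd, mul_add]
    refine ⟨by rw [this]; exact ha.add hb, fun q => ?_⟩
    rw [this, Pi.add_apply, ha', hb', lp.coeFn_add, Pi.add_apply, mul_add]
  smul_mem' := by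
    rintro c b ⟨hb, hb'⟩
    have : ofBdd θ ε L (c • b) = c • ofBdd θ ε L b := by
      funext w
      simp [ofBdd, mul_left_comm]
    refine ⟨by rw [this]; exact hb.const_smul c, fun q => ?_⟩
    rw [this, Pi.smul_apply, hb', lp.coeFn_smul, Pi.smul_apply, smul_eq_mul, smul_eq_mul,
      mul_left_comm]

theorem norm_ofBdd_le {θ ε L : ℝ} (b : entireBdd d θ ε L) (x : EuclideanSpace ℝ (Fin d))
    (w : EuclideanSpace ℂ (Fin d)) : ‖ofBdd θ ε L b.1 (incl x + w)‖ ≤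
      ‖b‖ * Real.exp (-ε * ‖x‖ ^ (1 / θ) + L * ‖w‖ ^ (1 / (1 - θ))) := by
  rw [b.2.2 (x, w), norm_mul, Complex.norm_real, Real.norm_of_nonneg (bwt_pos _ _ _ _).le, mul_comm]
  exact mul_le_mul_of_nonneg_right (lp.norm_apply_le_norm ENNReal.top_ne_zero b.1 (x, w))
    (bwt_pos _ _ _ _).le

/-- Restriction to `ℝ ^ d` of the entire function that a bounded function represents. -/
def restrictBdd {θ : ℝ} (hθ : 1 / 2 ≤ θ) (hθ' : θ < 1) {ε L : ℝ} (hε : 0 < ε) (hL : 0 ≤ L) :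
    entireBdd d θ ε L →ₗ[ℂ] Space d θ where
  toFun b := ⟨ofBdd θ ε L b.1 ∘ incl,
    comp_incl_mem_space hθ hθ' hε hL (norm_nonneg b) b.2.1 (norm_ofBdd_le b)⟩
  map_add' a b := Subtype.ext (funext fun y => by simp [ofBdd, mul_add])
  map_smul' c b := Subtype.ext (funext fun y => by simp [ofBdd, mul_left_comm])

/-- Extension by Hahn–Banach puts the functional on the complete space `Bdd d`, where Bochner
integrals exist, so neither a topology on `Space` nor closedness of `entireBdd` is needed. -/
theorem exists_extension_dual {θ : ℝ} (hθ : 1 / 2 ≤ θ) (hθ' : θ < 1) {ε L : ℝ} (hε : 0 < ε)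
    (hL : 0 ≤ L) (u : Dual d θ) :
    ∃ g : Bdd d →L[ℂ] ℂ, ∀ b : entireBdd d θ ε L, g b.1 = u.1 (restrictBdd hθ hθ' hε hL b) := by
  obtain ⟨h, hh, K, hK, HK⟩ := exists_normLE_of_entire d hθ hθ' hε hL
  obtain ⟨K', HK'⟩ := u.2 h hh
  obtain ⟨g, hg, -⟩ := exists_extension_norm_eq (entireBdd d θ ε L)
    (LinearMap.mkContinuous (u.1 ∘ₗ restrictBdd hθ hθ' hε hL) (K' * K) fun b => by
      rw [mul_assoc]
      exact HK' _ _ (HK _ b.2.1 ‖b‖ (norm_nonneg b) (norm_ofBdd_le b)))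
  exact ⟨g, fun b => hg b⟩

theorem toBdd_apply {θ ε L M : ℝ} (F : EuclideanSpace ℂ (Fin d) → ℂ)
    (H : ∀ (x : EuclideanSpace ℝ (Fin d)) (w : EuclideanSpace ℂ (Fin d)), ‖F (incl x + w)‖ ≤
      M * Real.exp (-ε * ‖x‖ ^ (1 / θ) + L * ‖w‖ ^ (1 / (1 - θ))))
    (q : EuclideanSpace ℝ (Fin d) × EuclideanSpace ℂ (Fin d)) :
    toBdd F H q = F (incl q.1 + q.2) / (bwt θ ε L q : ℂ) := rfl

theorem ofBdd_eq {θ ε L : ℝ} {F : EuclideanSpace ℂ (Fin d) → ℂ} {b : Bdd d}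
    (hb : ∀ q, b q = F (incl q.1 + q.2) / (bwt θ ε L q : ℂ)) : ofBdd θ ε L b = F := by
  funext w
  rw [ofBdd, hb, mul_div_cancel₀ _ (bwt_ne_zero _ _ _ _)]
  simp

theorem mem_entireBdd {θ ε L : ℝ} {F : EuclideanSpace ℂ (Fin d) → ℂ} (hF : ContDiff ℂ ∞ F)
    {b : Bdd d} (hb : ∀ q, b q = F (incl q.1 + q.2) / (bwt θ ε L q : ℂ)) :
    b ∈ entireBdd d θ ε L := by
  refine ⟨by rw [ofBdd_eq hb]; exact hF, fun q => ?_⟩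
  rw [ofBdd_eq hb, hb, mul_div_cancel₀ _ (bwt_ne_zero _ _ _ _)]

end Weighted

/-- Divided by the weight, the packets form a continuous family in the Banach space `Bdd d`, and
m(p) times the packet is Bochner integrable. A continuous functional that extends u commutes with
the integral, and evaluation at points identifies the integral with the superposition. -/
theorem dual_superposition (hC : (C.map Complex.im).PosDef) {θ : ℝ} (hθ : 1 / 2 ≤ θ)
    (hθ' : θ < 1) {ε K : ℝ} (hε : 0 < ε)
    {m : EuclideanSpace ℝ (Fin d) × EuclideanSpace ℝ (Fin d) → ℂ} (hm : AEStronglyMeasurable m)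
    (hmb : ∀ p, ‖m p‖ ≤
      K * Real.exp (-wt (C.map Complex.im) p.2 - ε * ‖toC p‖ ^ (1 / θ)))
    (u : Dual d θ) :
    u.1 ⟨_, superposition_mem_space hC hθ hθ' hε hm hmb⟩ =
      ∫ p, m p * u.1 (packet hC hθ hθ' (toC p)) := by
  obtain ⟨δ, hδ, L, hL, H⟩ := exists_norm_taylor_gker_le hC hθ hθ' (half_pos hε)
  set S := C.map Complex.im with hS
  let A : EuclideanSpace ℂ (Fin d) → ℝ := fun ζ =>
    Real.exp (L + wt S (imv ζ) + ε / 2 * ‖ζ‖ ^ (1 / θ))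
  have hk : ∀ ζ x w, ‖gker C ζ (incl x + w)‖ ≤
      A ζ * Real.exp (-δ * ‖x‖ ^ (1 / θ) + L * ‖w‖ ^ (1 / (1 - θ))) := by
    intro ζ x w
    -- The remainder of order 0 with zero increment is the packet itself.
    have := H 0 ζ 0 (by simp) x w
    simpa [A] using this
  let κ : EuclideanSpace ℂ (Fin d) → Bdd d := fun ζ => toBdd (gker C ζ) (hk ζ)
  have hκn : ∀ ζ, ‖κ ζ‖ ≤ A ζ := fun ζ =>
    lp.norm_le_of_forall_le (Real.exp_nonneg _) fun q => norm_div_bwt_le (hk ζ) q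
  have hκc : Continuous κ := by
    rw [continuous_iff_continuousAt]
    intro ζ
    -- The remainder of order 1 is the difference of two packets, so its bound is a local Lipschitz
    -- estimate in `Bdd d`. Continuity gives the strong measurability needed for the Bochner
    -- integral.
    have hlip : ∀ᶠ ζ' in nhds ζ, ‖κ ζ' - κ ζ‖ ≤ A ζ * ‖ζ' - ζ‖ := by
      filter_upwards [Metric.closedBall_mem_nhds ζ one_pos] with ζ' hζ'
      have hτ : ‖ζ' - ζ‖ ≤ 1 := by simpa [dist_eq_norm] using hζ'
      refine lp.norm_le_of_forall_le (by positivity) fun q => ?_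
      have e : (κ ζ' - κ ζ) q = taylorRem C 1 ζ (ζ' - ζ) (incl q.1 + q.2) / (bwt θ δ L q : ℂ) := by
        rw [lp.coeFn_sub, Pi.sub_apply, toBdd_apply, toBdd_apply, taylorRem_one, add_sub_cancel,
          sub_div]
      rw [e]
      refine norm_div_bwt_le (F := taylorRem C 1 ζ (ζ' - ζ)) (fun x w => ?_) q
      refine (H 1 ζ (ζ' - ζ) hτ x w).trans_eq ?_
      simp only [pow_one, Nat.factorial_one, Nat.cast_one, mul_one]
      ring
    rw [ContinuousAt, tendsto_iff_norm_sub_tendsto_zero]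
    refine squeeze_zero' (Filter.Eventually.of_forall fun _ => norm_nonneg _) hlip ?_
    have : Continuous fun ζ' : EuclideanSpace ℂ (Fin d) => A ζ * ‖ζ' - ζ‖ := by fun_prop
    simpa using this.tendsto ζ
  have hint : Integrable fun p => m p • κ (toC p) := by
    have hK : 0 ≤ K := by
      have := (norm_nonneg _).trans (hmb 0)
      exact nonneg_of_mul_nonneg_left this (Real.exp_pos _)
    refine ((integrable_exp_neg_norm_toC (d := d) hθ hθ' (half_pos hε)).const_mul
      (K * Real.exp L)).mono' (hm.smul (hκc.comp continuous_toC).aestronglyMeasurable)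
      (Filter.Eventually.of_forall fun p => ?_)
    rw [norm_smul]
    refine (mul_le_mul (hmb p) (hκn (toC p)) (norm_nonneg _) (by positivity)).trans_eq ?_
    simp only [A, imv_toC, mul_assoc, ← Real.exp_add]
    congr 2
    ring
  obtain ⟨g, hg⟩ := exists_extension_dual hθ hθ' hδ hL u
  have hκg : ∀ ζ, g (κ ζ) = u.1 (packet hC hθ hθ' ζ) := by
    intro ζ
    rw [hg ⟨κ ζ, mem_entireBdd (contDiff_gker C ζ) fun q => rfl⟩]
    congr 1
    exact Subtype.ext (by
      change ofBdd θ δ L (κ ζ) ∘ incl = gker C ζ ∘ incl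
      rw [ofBdd_eq fun q => rfl])
  set b := ∫ p, m p • κ (toC p) with hb
  have hbq : ∀ q, b q = (∫ p, m p * gker C (toC p) (incl q.1 + q.2)) / (bwt θ δ L q : ℂ) := by
    intro q
    have h1 := (lp.evalCLM ℂ (fun _ : EuclideanSpace ℝ (Fin d) × EuclideanSpace ℂ (Fin d) => ℂ)
      ∞ q).integral_comp_comm hint
    have h2 : (lp.evalCLM ℂ (fun _ : EuclideanSpace ℝ (Fin d) × EuclideanSpace ℂ (Fin d) => ℂ)
      ∞ q) b = b q := rfl
    rw [← h2, hb, ← h1, ← integral_div]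
    congr 1
    funext p
    change m p • (κ (toC p) q) = _
    rw [toBdd_apply, smul_eq_mul, mul_div_assoc]
  have hF : ContDiff ℂ ∞ fun w => ∫ p, m p * gker C (toC p) w :=
    contDiff_of_differentiable (differentiable_superposition hC hθ hθ' hε hm hmb)
  have hgb : g b = u.1 ⟨_, superposition_mem_space hC hθ hθ' hε hm hmb⟩ := by
    rw [hg ⟨b, mem_entireBdd hF hbq⟩]
    congr 1
    exact Subtype.ext (by
      change ofBdd θ δ L b ∘ incl = _
      rw [ofBdd_eq (F := fun w => ∫ p, m p * gker C (toC p) w) hbq])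
  rw [← hgb, hb, ← g.integral_comp_comm hint]
  congr 1
  funext p
  rw [map_smul, hκg, smul_eq_mul]

end

section

variable {d : ℕ} {C : Matrix (Fin d) (Fin d) ℂ}

/-! ### Complex conjugates of wave packets -/

/-- The matrix `-conj C` of the conjugate wave packets. -/
def conjC (C : Matrix (Fin d) (Fin d) ℂ) : Matrix (Fin d) (Fin d) ℂ :=
  -(C.map (starRingEnd ℂ))

theorem conjC_im (C : Matrix (Fin d) (Fin d) ℂ) :
    (conjC C).map Complex.im = C.map Complex.im := by
  ext i j
  simp [conjC]

theorem posDef_conjC (hC : (C.map Complex.im).PosDef) : ((conjC C).map Complex.im).PosDef := by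
  rwa [conjC_im]

/-- The reflection `ζ ↦ -conj ζ` in the imaginary directions. -/
def reflv (ζ : EuclideanSpace ℂ (Fin d)) : EuclideanSpace ℂ (Fin d) :=
  WithLp.toLp 2 fun i => -(starRingEnd ℂ) (ζ i)

theorem reflv_apply (ζ : EuclideanSpace ℂ (Fin d)) (i : Fin d) :
    reflv ζ i = -(starRingEnd ℂ) (ζ i) := rfl

theorem reflv_toC (p : EuclideanSpace ℝ (Fin d) × EuclideanSpace ℝ (Fin d)) :
    reflv (toC p) = toC (-p.1, p.2) := by
  ext i
  simp [reflv_apply, toC_apply]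
  ring

theorem imv_reflv (ζ : EuclideanSpace ℂ (Fin d)) : imv (reflv ζ) = imv ζ := by
  ext i
  simp [imv_apply, reflv_apply]

theorem norm_reflv (ζ : EuclideanSpace ℂ (Fin d)) : ‖reflv ζ‖ = ‖ζ‖ := by
  simp [EuclideanSpace.norm_eq, reflv_apply]

/-- On real points the conjugate of a packet is again a packet, with a matrix of the same imaginary
part. All packet estimates therefore hold for it with the same weight `wt`. -/
theorem gker_conjC (ζ : EuclideanSpace ℂ (Fin d)) (y : EuclideanSpace ℝ (Fin d)) :
    gker (conjC C) (reflv ζ) (incl y) = (starRingEnd ℂ) (gker C ζ (incl y)) := by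
  rw [gker, gker, ← Complex.exp_conj]
  congr 1
  simp [conjC, dotProduct, Matrix.mulVec, reflv_apply, FBIPhase.incl_apply, Finset.mul_sum,
    Finset.sum_mul, map_ofNat]
  ring

/-- The pairing of `f` with the conjugate of a wave packet. -/
def coeff (C : Matrix (Fin d) (Fin d) ℂ) (f : EuclideanSpace ℝ (Fin d) → ℂ)
    (ζ : EuclideanSpace ℂ (Fin d)) : ℂ :=
  ∫ y, f y * gker (conjC C) (reflv ζ) (incl y)

theorem exists_norm_coeff_le (hC : (C.map Complex.im).PosDef) {θ : ℝ}
    (hθ : 1 / 2 ≤ θ) (hθ' : θ < 1) {h : ℝ} (hh : 0 < h) :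
    ∃ ε > 0, ∃ K > 0, ∀ (f : EuclideanSpace ℝ (Fin d) → ℂ) (M : ℝ),
      ContDiff ℝ ∞ f → NormLE θ h M f → ∀ ζ : EuclideanSpace ℂ (Fin d),
      ‖coeff C f ζ‖ ≤
        K * M * Real.exp (wt (C.map Complex.im) (imv ζ) - ε * ‖ζ‖ ^ (1 / θ)) := by
  obtain ⟨ε, hε, K, hK, H⟩ := exists_norm_integral_mul_gker_le (posDef_conjC hC) hθ hθ' hh
  refine ⟨ε, hε, K, hK, fun f M hf hM ζ => ?_⟩
  have := H f M hf hM (reflv ζ)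
  rwa [imv_reflv, norm_reflv, conjC_im] at this

theorem continuous_gker_comp {X : Type*} [TopologicalSpace X] (C : Matrix (Fin d) (Fin d) ℂ)
    {f g : X → EuclideanSpace ℂ (Fin d)} (hf : Continuous f) (hg : Continuous g) :
    Continuous fun x => gker C (f x) (g x) := by
  have := (continuous_gker C).comp (hf.prodMk hg)
  exact this

theorem continuous_reflv : Continuous (reflv (d := d)) := by
  refine (PiLp.continuous_toLp 2 _).comp (continuous_pi fun i => ?_)
  exact (Complex.continuous_conj.comp (by fun_prop)).neg

theorem continuous_gker_reflv_toC_incl (C : Matrix (Fin d) (Fin d) ℂ) :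
    Continuous fun q : (EuclideanSpace ℝ (Fin d) × EuclideanSpace ℝ (Fin d)) ×
      EuclideanSpace ℝ (Fin d) => gker C (reflv (toC q.1)) (incl q.2) := by
  refine continuous_gker_comp C ?_ ?_
  · exact continuous_reflv.comp (continuous_toC.comp continuous_fst)
  · exact incl.continuous.comp continuous_snd

theorem aestronglyMeasurable_coeff {f : EuclideanSpace ℝ (Fin d) → ℂ} (hf : Continuous f) :
    AEStronglyMeasurable fun p : EuclideanSpace ℝ (Fin d) × EuclideanSpace ℝ (Fin d) =>
      coeff C f (toC p) := by
  refine StronglyMeasurable.aestronglyMeasurable ?_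
  refine StronglyMeasurable.integral_prod_right (f := fun
    (p : EuclideanSpace ℝ (Fin d) × EuclideanSpace ℝ (Fin d)) (y : EuclideanSpace ℝ (Fin d)) =>
      f y * gker (conjC C) (reflv (toC p)) (incl y)) ?_
  exact Continuous.stronglyMeasurable
    ((hf.comp continuous_snd).mul (continuous_gker_reflv_toC_incl (conjC C)))

/-! ### The inversion formula -/

theorem exists_wt_ge {S : Matrix (Fin d) (Fin d) ℝ} (hS : S.PosDef) :
    ∃ c > 0, ∀ η, c * ‖η‖ ^ 2 ≤ wt S η := by
  obtain ⟨c, hc, Hc⟩ := FBIPhase.exists_coercive hS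
  obtain ⟨K, hK, HK⟩ := exists_norm_le_cen hS
  refine ⟨c / (2 * (K + 1) ^ 2), by positivity, fun η => ?_⟩
  have h := complete_square hS η 0
  have h1 := Hc (0 - cen S η)
  simp only [WithLp.ofLp_zero, dotProduct_zero, Matrix.mulVec_zero] at h
  rw [zero_sub, norm_neg] at h1
  have h2 : ‖η‖ ≤ (K + 1) * ‖cen S η‖ := (HK η).trans (by gcongr; linarith)
  have h3 : ‖η‖ ^ 2 ≤ (K + 1) ^ 2 * ‖cen S η‖ ^ 2 := by rw [← mul_pow]; gcongr
  calc c / (2 * (K + 1) ^ 2) * ‖η‖ ^ 2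
      ≤ c / (2 * (K + 1) ^ 2) * ((K + 1) ^ 2 * ‖cen S η‖ ^ 2) := by gcongr
    _ = c * ‖cen S η‖ ^ 2 / 2 := by field_simp
    _ ≤ wt S η := by
        rw [zero_sub] at h
        linarith

theorem integrable_exp_neg_wt {S : Matrix (Fin d) (Fin d) ℝ} (hS : S.PosDef) {a : ℝ} (ha : 0 < a) :
    Integrable fun η : EuclideanSpace ℝ (Fin d) => Real.exp (-a * wt S η) := by
  obtain ⟨c, hc, Hc⟩ := exists_wt_ge hS
  have h0 : (1 / 2 : ℝ) ≤ 1 / 2 := le_rfl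
  refine ((integrable_exp_neg_norm_rpow (volume : Measure (EuclideanSpace ℝ (Fin d))) h0
    (by norm_num) (ε := a * c) (by positivity))).mono' ?_ (Filter.Eventually.of_forall fun η => ?_)
  · have := continuous_wt S
    exact Continuous.aestronglyMeasurable (by fun_prop)
  · rw [Real.norm_of_nonneg (Real.exp_nonneg _)]
    refine Real.exp_le_exp.2 ?_
    have h1 : ‖η‖ ^ (1 / (1 / 2 : ℝ)) = ‖η‖ ^ 2 := by
      rw [show (1 / (1 / 2 : ℝ)) = ((2 : ℕ) : ℝ) by norm_num, Real.rpow_natCast]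
    rw [h1]
    have := Hc η
    nlinarith

/-- Integrating the squared modulus of the wave packets over the imaginary directions. -/
theorem integral_normSq_gker (hC : (C.map Complex.im).PosDef) (y : EuclideanSpace ℝ (Fin d)) :
    ∫ η : EuclideanSpace ℝ (Fin d), Real.exp (-2 * wt (C.map Complex.im) η) *
      ‖gker C (toC (0, η)) (incl y)‖ ^ 2 =
      ∫ η : EuclideanSpace ℝ (Fin d), Real.exp (-2 * wt (C.map Complex.im) η) := by
  set S := C.map Complex.im with hS
  -- The integrand is the Gaussian e^{-2wt} translated by Sy, so its integral over η does not depend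
  -- on y.
  have e : ∀ η, Real.exp (-2 * wt S η) * ‖gker C (toC (0, η)) (incl y)‖ ^ 2 =
      Real.exp (-2 * wt S (η + WithLp.toLp 2 (S *ᵥ y.ofLp))) := by
    intro η
    rw [norm_gker_incl hC, imv_toC, ← Real.exp_nat_mul, ← Real.exp_add]
    congr 1
    have h1 := complete_square hC (η + WithLp.toLp 2 (S *ᵥ y.ofLp)) 0
    have hunit : IsUnit S.det := (Matrix.isUnit_iff_isUnit_det S).1 hC.isUnit
    have h2 : (0 : EuclideanSpace ℝ (Fin d)) - cen S (η + WithLp.toLp 2 (S *ᵥ y.ofLp)) =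
        y - cen S η := by
      ext i
      simp [cen, Matrix.mulVec_add, Matrix.nonsing_inv_mul S hunit]
      ring
    rw [h2] at h1
    simp only [WithLp.ofLp_zero, dotProduct_zero, Matrix.mulVec_zero] at h1
    push_cast
    linarith
  simp only [e]
  exact integral_add_right_eq_self (fun η => Real.exp (-2 * wt S η)) _

theorem inner_eq_dotProduct (x y : EuclideanSpace ℝ (Fin d)) :
    inner ℝ x y = x.ofLp ⬝ᵥ y.ofLp := by
  simp [PiLp.inner_apply, dotProduct, mul_comm]

theorem gker_toC (ξ η : EuclideanSpace ℝ (Fin d)) (y : EuclideanSpace ℝ (Fin d)) :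
    gker C (toC (ξ, η)) (incl y) =
      Complex.exp (((ξ.ofLp ⬝ᵥ y.ofLp : ℝ) : ℂ) * Complex.I) * gker C (toC (0, η)) (incl y) := by
  have : toC (ξ, η) = toC (0, η) + incl ξ := by simp [toC, add_comm]
  rw [this, gker_add, dotProduct_incl, mul_comm Complex.I]

/-- Fourier inversion for the pairings with wave packets. -/
theorem integral_coeff_mul_gker (hC : (C.map Complex.im).PosDef) {θ : ℝ} (hθ : 1 / 2 ≤ θ)
    (hθ' : θ < 1) (f : Space d θ) (η y : EuclideanSpace ℝ (Fin d)) :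
    ∫ ξ : EuclideanSpace ℝ (Fin d), coeff C f.1 (toC (ξ, η)) * gker C (toC (ξ, η)) (incl y) =
      ((2 * Real.pi) ^ d : ℝ) * (f.1 y * (‖gker C (toC (0, η)) (incl y)‖ ^ 2 : ℝ)) := by
  obtain ⟨hf, h, hh, M, hM⟩ := f.2
  obtain ⟨ε, hε, K, hK, HK⟩ := exists_norm_coeff_le hC hθ hθ' hh
  set F : EuclideanSpace ℝ (Fin d) → ℂ :=
    fun y => f.1 y * (starRingEnd ℂ) (gker C (toC (0, η)) (incl y)) with hF
  have hkc : Continuous fun y => gker C (toC (0, η)) (incl y) :=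
    (contDiff_gker C _).continuous.comp incl.continuous
  have hFc : Continuous F := hf.continuous.mul (Complex.continuous_conj.comp hkc)
  have hFi : Integrable F := by
    refine (Space.integrable f).mul_bdd (c := Real.exp (wt (C.map Complex.im) η))
      (Complex.continuous_conj.comp hkc).aestronglyMeasurable
      (Filter.Eventually.of_forall fun y => ?_)
    have := norm_gker_incl_le hC (toC (0, η)) y
    rw [imv_toC] at this
    simpa using this
  -- For fixed η the coefficient, as a function of ξ = 2πv, is the Fourier transform of f times the
  -- conjugate packet of frequency iη.
  have hFF : ∀ v, FourierTransform.fourier F v = coeff C f.1 (toC ((2 * Real.pi) • v, η)) := by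
    intro v
    rw [Real.fourier_eq', coeff]
    congr 1
    funext y
    rw [gker_conjC, gker_toC, hF, smul_eq_mul, map_mul, ← Complex.exp_conj, map_mul,
      Complex.conj_I, Complex.conj_ofReal, inner_eq_dotProduct]
    rw [show (((2 * Real.pi) • v).ofLp ⬝ᵥ y.ofLp) = 2 * Real.pi * (y.ofLp ⬝ᵥ v.ofLp) by
      rw [WithLp.ofLp_smul, smul_dotProduct, smul_eq_mul, dotProduct_comm]]
    rw [mul_left_comm]
    congr 2
    push_cast
    ring_nf
  have hpi : 0 < 2 * Real.pi := Real.two_pi_pos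
  have hFFi : Integrable (FourierTransform.fourier F) := by
    have hcont : Continuous (FourierTransform.fourier F) :=
      VectorFourier.fourierIntegral_continuous Real.continuous_fourierChar
        (by exact continuous_inner) hFi
    refine ((integrable_exp_neg_norm_rpow (volume : Measure (EuclideanSpace ℝ (Fin d))) hθ hθ'
      hε).const_mul (K * M * Real.exp (wt (C.map Complex.im) η))).mono'
      hcont.aestronglyMeasurable (Filter.Eventually.of_forall fun v => ?_)
    rw [hFF]
    have h1 := HK f.1 M hf hM (toC ((2 * Real.pi) • v, η))
    rw [imv_toC] at h1
    refine h1.trans ?_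
    have hM0 := hM.nonneg
    rw [mul_assoc (K * M), ← Real.exp_add]
    refine mul_le_mul_of_nonneg_left (Real.exp_le_exp.2 ?_) (by positivity)
    have h2 : ‖v‖ ≤ ‖toC ((2 * Real.pi) • v, η)‖ := by
      have h3 := norm_rev_le (toC ((2 * Real.pi) • v, η))
      rw [rev_toC, norm_smul, Real.norm_of_nonneg hpi.le] at h3
      have h4 : 1 ≤ 2 * Real.pi := by linarith [Real.pi_gt_three]
      nlinarith [norm_nonneg v]
    have h3 : ‖v‖ ^ (1 / θ) ≤ ‖toC ((2 * Real.pi) • v, η)‖ ^ (1 / θ) := by gcongr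
    nlinarith
  have hinv := congrFun (hFc.fourierInv_fourier_eq hFi hFFi) y
  rw [Real.fourierInv_eq'] at hinv
  -- The substitution ξ = 2πv produces the factor (2π)^d.
  have hscale := Measure.integral_comp_smul (volume : Measure (EuclideanSpace ℝ (Fin d)))
    (fun ξ => coeff C f.1 (toC (ξ, η)) * gker C (toC (ξ, η)) (incl y)) (2 * Real.pi)
  have e1 : (∫ v : EuclideanSpace ℝ (Fin d), coeff C f.1 (toC ((2 * Real.pi) • v, η)) *
      gker C (toC ((2 * Real.pi) • v, η)) (incl y)) = F y * gker C (toC (0, η)) (incl y) := by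
    rw [← hinv, ← integral_mul_const]
    congr 1
    funext v
    rw [hFF, gker_toC, inner_eq_dotProduct, WithLp.ofLp_smul, smul_dotProduct, smul_eq_mul,
      smul_eq_mul]
    ring
  rw [e1] at hscale
  simp only [finrank_euclideanSpace, Fintype.card_fin] at hscale
  have h2 : F y * gker C (toC (0, η)) (incl y) =
      f.1 y * (‖gker C (toC (0, η)) (incl y)‖ ^ 2 : ℝ) := by
    rw [hF]
    simp only
    rw [mul_assoc, mul_comm ((starRingEnd ℂ) _), Complex.mul_conj, Complex.normSq_eq_norm_sq]
  rw [← h2, hscale, abs_of_pos (by positivity), Complex.real_smul, ← mul_assoc,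
    ← Complex.ofReal_mul, mul_inv_cancel₀ (by positivity), Complex.ofReal_one, one_mul]

/-- For fixed η Fourier inversion in ξ returns f(y) times the squared modulus of the packet. The
weight e^{-2wt} makes the integral of that modulus over η independent of y, which leaves a positive
constant. -/
theorem exists_inversion (hC : (C.map Complex.im).PosDef) {θ : ℝ} (hθ : 1 / 2 ≤ θ)
    (hθ' : θ < 1) : ∃ c : ℝ, 0 < c ∧ ∀ (f : Space d θ) (y : EuclideanSpace ℝ (Fin d)),
      ∫ p : EuclideanSpace ℝ (Fin d) × EuclideanSpace ℝ (Fin d),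
        (coeff C f.1 (toC p) * Real.exp (-2 * wt (C.map Complex.im) p.2)) *
          gker C (toC p) (incl y) = c * f.1 y := by
  set S := C.map Complex.im with hS
  refine ⟨(2 * Real.pi) ^ d * ∫ η : EuclideanSpace ℝ (Fin d), Real.exp (-2 * wt S η),
    mul_pos (by positivity) (integral_exp_pos (integrable_exp_neg_wt hC two_pos)), fun f y => ?_⟩
  obtain ⟨hf, h, hh, M, hM⟩ := f.2
  obtain ⟨ε, hε, K, hK, HK⟩ := exists_norm_coeff_le hC hθ hθ' hh
  have hint : Integrable (fun p : EuclideanSpace ℝ (Fin d) × EuclideanSpace ℝ (Fin d) =>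
      (coeff C f.1 (toC p) * Real.exp (-2 * wt S p.2)) * gker C (toC p) (incl y))
      (volume.prod volume) := by
    have hc1 : Continuous fun p : EuclideanSpace ℝ (Fin d) × EuclideanSpace ℝ (Fin d) =>
        ((Real.exp (-2 * wt S p.2) : ℝ) : ℂ) := by
      have := (continuous_wt S).comp (continuous_snd (X := EuclideanSpace ℝ (Fin d)))
      simp only [Function.comp_def] at this
      fun_prop
    have hc2 : Continuous fun p : EuclideanSpace ℝ (Fin d) × EuclideanSpace ℝ (Fin d) =>
        gker C (toC p) (incl y) := by
      exact continuous_gker_comp C continuous_toC continuous_const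
    refine ((integrable_exp_neg_norm_toC (d := d) hθ hθ' hε).const_mul (K * M)).mono'
      (((aestronglyMeasurable_coeff hf.continuous).mul hc1.aestronglyMeasurable).mul
        hc2.aestronglyMeasurable) (Filter.Eventually.of_forall fun p => ?_)
    have h1 := HK f.1 M hf hM (toC p)
    have h2 := norm_gker_incl_le hC (toC p) y
    rw [imv_toC] at h1 h2
    have hM0 := hM.nonneg
    rw [norm_mul, norm_mul, Complex.norm_real, Real.norm_of_nonneg (Real.exp_nonneg _)]
    calc _ ≤ K * M * Real.exp (wt S p.2 - ε * ‖toC p‖ ^ (1 / θ)) * Real.exp (-2 * wt S p.2) *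
          Real.exp (wt S p.2) := by gcongr
      _ = _ := by
          simp only [mul_assoc, ← Real.exp_add]
          ring_nf
  have h3 := integral_prod_symm _ hint
  refine Eq.trans h3 ?_
  have h4 : ∀ η : EuclideanSpace ℝ (Fin d), (∫ ξ : EuclideanSpace ℝ (Fin d),
      (coeff C f.1 (toC (ξ, η)) * Real.exp (-2 * wt S η)) * gker C (toC (ξ, η)) (incl y)) =
      (((2 * Real.pi) ^ d : ℝ) * f.1 y) *
        ((Real.exp (-2 * wt S η) * ‖gker C (toC (0, η)) (incl y)‖ ^ 2 : ℝ) : ℂ) := by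
    intro η
    have h5 := integral_coeff_mul_gker hC hθ hθ' f η y
    have h6 : (∫ ξ : EuclideanSpace ℝ (Fin d),
        (coeff C f.1 (toC (ξ, η)) * Real.exp (-2 * wt S η)) * gker C (toC (ξ, η)) (incl y)) =
        Real.exp (-2 * wt S η) * ∫ ξ : EuclideanSpace ℝ (Fin d),
          coeff C f.1 (toC (ξ, η)) * gker C (toC (ξ, η)) (incl y) := by
      rw [← integral_const_mul]
      congr 1
      funext ξ
      ring
    rw [h6, h5]
    push_cast
    ring
  simp only [h4]
  rw [integral_const_mul, integral_complex_ofReal, integral_normSq_gker hC]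
  push_cast
  ring

/-! ### Injectivity -/

/-- By inversion a nonzero multiple of any f is a superposition of packets, and u and v both commute
with that superposition. -/
theorem dual_ext_of_packet (hC : (C.map Complex.im).PosDef) {θ : ℝ} (hθ : 1 / 2 ≤ θ)
    (hθ' : θ < 1) {u v : Dual d θ}
    (huv : ∀ ζ, u.1 (packet hC hθ hθ' ζ) = v.1 (packet hC hθ hθ' ζ)) : u = v := by
  refine Subtype.ext (LinearMap.ext fun f => ?_)
  obtain ⟨c, hc, Hc⟩ := exists_inversion hC hθ hθ'
  obtain ⟨hf, h, hh, M, hM⟩ := f.2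
  obtain ⟨ε, hε, K, hK, HK⟩ := exists_norm_coeff_le hC hθ hθ' hh
  set S := C.map Complex.im with hS
  let m : EuclideanSpace ℝ (Fin d) × EuclideanSpace ℝ (Fin d) → ℂ := fun p =>
    coeff C f.1 (toC p) * Real.exp (-2 * wt S p.2)
  have hm : AEStronglyMeasurable m := by
    have hc1 : Continuous fun p : EuclideanSpace ℝ (Fin d) × EuclideanSpace ℝ (Fin d) =>
        ((Real.exp (-2 * wt S p.2) : ℝ) : ℂ) := by
      have := (continuous_wt S).comp (continuous_snd (X := EuclideanSpace ℝ (Fin d)))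
      simp only [Function.comp_def] at this
      fun_prop
    exact (aestronglyMeasurable_coeff hf.continuous).mul hc1.aestronglyMeasurable
  have hmb : ∀ p, ‖m p‖ ≤ (K * M) * Real.exp (-wt S p.2 - ε * ‖toC p‖ ^ (1 / θ)) := by
    intro p
    have h1 := HK f.1 M hf hM (toC p)
    rw [imv_toC] at h1
    rw [norm_mul, Complex.norm_real, Real.norm_of_nonneg (Real.exp_nonneg _)]
    calc _ ≤ K * M * Real.exp (wt S p.2 - ε * ‖toC p‖ ^ (1 / θ)) * Real.exp (-2 * wt S p.2) := by
          gcongr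
      _ = _ := by
          simp only [mul_assoc, ← Real.exp_add]
          ring_nf
  have e : (⟨_, superposition_mem_space hC hθ hθ' hε hm hmb⟩ : Space d θ) = (c : ℂ) • f :=
    Subtype.ext (funext fun y => Hc f y)
  have h1 := dual_superposition hC hθ hθ' hε hm hmb u
  have h2 := dual_superposition hC hθ hθ' hε hm hmb v
  simp only [huv] at h1
  rw [← h2, e, map_smul, map_smul] at h1
  exact smul_right_injective ℂ (by exact_mod_cast hc.ne') h1

/-- The coefficients of f are values of `toDual f` on conjugate packets, and inversion recovers f
from them pointwise. -/
theorem toDual_injective {θ : ℝ} (hC : (C.map Complex.im).PosDef) (hθ : 1 / 2 ≤ θ) (hθ' : θ < 1) :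
    Function.Injective (Space.toDual (d := d) (θ := θ)) := by
  intro f g hfg
  obtain ⟨c, hc, Hc⟩ := exists_inversion hC hθ hθ'
  have hcoeff : ∀ f : Space d θ, coeff C f.1 =
      fun ζ => (Space.toDual f).1 (packet (posDef_conjC hC) hθ hθ' (reflv ζ)) := fun f => rfl
  refine Subtype.ext (funext fun y => ?_)
  have h1 := Hc f y
  rw [hcoeff f, hfg, ← hcoeff g, Hc g y] at h1
  exact (mul_left_cancel₀ (by exact_mod_cast hc.ne') h1).symm

end

section

/-! ### Linear changes of variables -/

theorem integral_comp_continuousLinearEquiv {V F : Type*} [NormedAddCommGroup V] [NormedSpace ℝ V]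
    [FiniteDimensional ℝ V] [MeasurableSpace V] [BorelSpace V] (μ : Measure V)
    [μ.IsAddHaarMeasure] [NormedAddCommGroup F] [NormedSpace ℝ F] (e : V ≃L[ℝ] V) (g : V → F) :
    ∫ x, g (e x) ∂μ = |(LinearMap.det ((e : V →L[ℝ] V) : V →ₗ[ℝ] V))⁻¹| • ∫ x, g x ∂μ := by
  have hdet : LinearMap.det ((e : V →L[ℝ] V) : V →ₗ[ℝ] V) ≠ 0 :=
    (LinearEquiv.isUnit_det' e.toLinearEquiv).ne_zero
  have h1 := (e.toHomeomorph.measurableEmbedding).integral_map (μ := μ) g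
  have h2 := Measure.map_linearMap_addHaar_eq_smul_addHaar μ hdet
  have h3 : Measure.map e.toHomeomorph μ = Measure.map ((e : V →L[ℝ] V) : V →ₗ[ℝ] V) μ := rfl
  rw [h3, h2, integral_smul_measure, ENNReal.toReal_ofReal (abs_nonneg _)] at h1
  exact h1.symm

variable {d : ℕ} {C : Matrix (Fin d) (Fin d) ℂ}

/-! ### A Gaussian integral -/

/-- The complex bilinear form of the inverse of a real matrix. -/
def sinv (S : Matrix (Fin d) (Fin d) ℝ) (v w : EuclideanSpace ℂ (Fin d)) : ℂ :=
  ((S⁻¹).map Complex.ofReal *ᵥ v.ofLp) ⬝ᵥ w.ofLp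

theorem sinv_add_left (S : Matrix (Fin d) (Fin d) ℝ) (v v' w : EuclideanSpace ℂ (Fin d)) :
    sinv S (v + v') w = sinv S v w + sinv S v' w := by
  simp [sinv, Matrix.mulVec_add, add_dotProduct]

theorem sinv_smul_left (S : Matrix (Fin d) (Fin d) ℝ) (c : ℂ) (v w : EuclideanSpace ℂ (Fin d)) :
    sinv S (c • v) w = c * sinv S v w := by
  simp [sinv, Matrix.mulVec_smul, smul_dotProduct]

theorem sinv_add_right (S : Matrix (Fin d) (Fin d) ℝ) (v w w' : EuclideanSpace ℂ (Fin d)) :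
    sinv S v (w + w') = sinv S v w + sinv S v w' := by
  simp [sinv, dotProduct_add]

theorem sinv_smul_right (S : Matrix (Fin d) (Fin d) ℝ) (c : ℂ) (v w : EuclideanSpace ℂ (Fin d)) :
    sinv S v (c • w) = c * sinv S v w := by
  simp [sinv, dotProduct_smul]

theorem sinv_comm {S : Matrix (Fin d) (Fin d) ℝ} (hS : S.PosDef) (v w : EuclideanSpace ℂ (Fin d)) :
    sinv S v w = sinv S w v := by
  have h : ((S⁻¹).map Complex.ofReal)ᵀ = (S⁻¹).map Complex.ofReal := by
    have : (S⁻¹)ᵀ = S⁻¹ := by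
      rw [← Matrix.conjTranspose_eq_transpose_of_trivial]; exact hS.inv.isHermitian.eq
    rw [← Matrix.transpose_map, this]
  rw [sinv, dotProduct_comm, Matrix.dotProduct_mulVec, ← Matrix.mulVec_transpose, h, sinv]

theorem sinv_incl (S : Matrix (Fin d) (Fin d) ℝ) (η : EuclideanSpace ℝ (Fin d)) :
    sinv S (incl η) (incl η) = ((2 * wt S η : ℝ) : ℂ) := by
  simp [sinv, wt, dotProduct, Matrix.mulVec, FBIPhase.incl_apply]

theorem exists_transpose_mul_self {S : Matrix (Fin d) (Fin d) ℝ} (hS : S.PosDef) :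
    ∃ B : Matrix (Fin d) (Fin d) ℝ, S = Bᵀ * B := by
  open scoped MatrixOrder in
  obtain ⟨B, hB⟩ := CStarAlgebra.nonneg_iff_eq_star_mul_self.mp hS.posSemidef.nonneg
  exact ⟨B, by rw [hB, Matrix.star_eq_conjTranspose, Matrix.conjTranspose_eq_transpose_of_trivial]⟩

/-- With S = BᵀB the substitution v = By reduces to the standard Gaussian. Only κ ≠ 0 matters later,
so κ is left as a Jacobian times a power of π. -/
theorem exists_integral_gaussian {S : Matrix (Fin d) (Fin d) ℝ} (hS : S.PosDef) :
    ∃ κ : ℂ, κ ≠ 0 ∧ ∀ τ : EuclideanSpace ℂ (Fin d),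
      ∫ y : EuclideanSpace ℝ (Fin d), Complex.exp (Complex.I * (τ.ofLp ⬝ᵥ (incl y).ofLp) -
        (((S *ᵥ y.ofLp) ⬝ᵥ y.ofLp : ℝ) : ℂ)) = κ * Complex.exp (-(1 / 4) * sinv S τ τ) := by
  obtain ⟨B, hB⟩ := exists_transpose_mul_self hS
  have hunit : IsUnit S.det := (Matrix.isUnit_iff_isUnit_det S).1 hS.isUnit
  have hBu : IsUnit B.det := by
    rw [hB, Matrix.det_mul] at hunit
    exact isUnit_of_mul_isUnit_right hunit
  let e : (Fin d → ℝ) ≃L[ℝ] (Fin d → ℝ) :=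
    (Matrix.toLin'OfInv (Matrix.nonsing_inv_mul B hBu)
      (Matrix.mul_nonsing_inv B hBu)).toContinuousLinearEquiv
  have he : ∀ v, e v = B *ᵥ v := fun v => rfl
  have hdet : LinearMap.det ((e : (Fin d → ℝ) →L[ℝ] (Fin d → ℝ)) : (Fin d → ℝ) →ₗ[ℝ] (Fin d → ℝ)) ≠ 0 :=
    (LinearEquiv.isUnit_det' e.toLinearEquiv).ne_zero
  refine ⟨(|(LinearMap.det ((e : (Fin d → ℝ) →L[ℝ] (Fin d → ℝ)) : (Fin d → ℝ) →ₗ[ℝ] (Fin d → ℝ)))⁻¹| : ℝ) *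
    (Real.pi / 1) ^ (Fintype.card (Fin d) / 2 : ℂ), ?_, fun τ => ?_⟩
  · refine mul_ne_zero ?_ ?_
    · exact_mod_cast abs_ne_zero.2 (inv_ne_zero hdet)
    · rw [Complex.cpow_ne_zero_iff]
      left
      simp [Real.pi_ne_zero]
  -- With c = i B⁻ᵀ τ the linear term ⟨c, Bv⟩ is i⟨τ, v⟩, while ∑ c_i² = -⟨S⁻¹τ, τ⟩.
  · let c : Fin d → ℂ := Complex.I • (((B⁻¹)ᵀ.map Complex.ofReal) *ᵥ τ.ofLp)
    have h1 := GaussianFourier.integral_cexp_neg_mul_sum_add (b := 1) (by simp) c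
    have h2 := integral_comp_continuousLinearEquiv volume e
      (fun v : Fin d → ℝ => Complex.exp (-1 * ∑ i, (v i : ℂ) ^ 2 + ∑ i, c i * v i))
    rw [h1] at h2
    have h3 := (PiLp.volume_preserving_toLp (Fin d)).integral_comp
      (MeasurableEquiv.toLp 2 (Fin d → ℝ)).measurableEmbedding
      (fun y : EuclideanSpace ℝ (Fin d) => Complex.exp (Complex.I * (τ.ofLp ⬝ᵥ (incl y).ofLp) -
        (((S *ᵥ y.ofLp) ⬝ᵥ y.ofLp : ℝ) : ℂ)))
    set D : Matrix (Fin d) (Fin d) ℂ := (B⁻¹)ᵀ.map Complex.ofReal with hD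
    have hDt : Dᵀ = (B⁻¹).map Complex.ofReal := by
      rw [hD, ← Matrix.transpose_map, Matrix.transpose_transpose]
    have hDD : Dᵀ * D = (S⁻¹).map Complex.ofReal := by
      have : S⁻¹ = B⁻¹ * (B⁻¹)ᵀ := by
        rw [hB, Matrix.mul_inv_rev, Matrix.transpose_nonsing_inv]
      rw [hDt, hD, this]
      exact (Matrix.map_mul (f := Complex.ofRealHom)).symm
    have hc2 : ∑ i, c i ^ 2 = - sinv S τ τ := by
      have h4 : (D *ᵥ τ.ofLp) ⬝ᵥ (D *ᵥ τ.ofLp) = sinv S τ τ := by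
        rw [sinv, ← hDD, ← Matrix.mulVec_mulVec, Matrix.mulVec_transpose (x := D *ᵥ τ.ofLp),
          ← Matrix.dotProduct_mulVec]
      rw [← h4, dotProduct, ← Finset.sum_neg_distrib]
      refine Finset.sum_congr rfl fun i _ => ?_
      simp only [c, Pi.smul_apply, smul_eq_mul, mul_pow, Complex.I_sq]
      ring
    have hcv : ∀ v : Fin d → ℝ, ∑ i, c i * ((B *ᵥ v) i : ℂ) =
        Complex.I * (τ.ofLp ⬝ᵥ fun i => (v i : ℂ)) := by
      intro v
      have h5 : Dᵀ *ᵥ (fun i => ((B *ᵥ v) i : ℂ)) = fun i => (v i : ℂ) := by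
        have h6 := fun i => RingHom.map_mulVec Complex.ofRealHom B⁻¹ (B *ᵥ v) i
        rw [Matrix.mulVec_mulVec, Matrix.nonsing_inv_mul B hBu, Matrix.one_mulVec] at h6
        rw [hDt]
        exact funext fun i => (h6 i).symm
      have h7 : (D *ᵥ τ.ofLp) ⬝ᵥ (fun i => ((B *ᵥ v) i : ℂ)) = τ.ofLp ⬝ᵥ fun i => (v i : ℂ) := by
        rw [← h5, Matrix.dotProduct_mulVec, Matrix.vecMul_transpose]
      rw [← h7, dotProduct, Finset.mul_sum]
      refine Finset.sum_congr rfl fun i _ => ?_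
      simp only [c, Pi.smul_apply, smul_eq_mul]
      ring
    have hq : ∀ v : Fin d → ℝ, (((S *ᵥ v) ⬝ᵥ v : ℝ) : ℂ) = ∑ i, ((B *ᵥ v) i : ℂ) ^ 2 := by
      intro v
      have : (S *ᵥ v) ⬝ᵥ v = (B *ᵥ v) ⬝ᵥ (B *ᵥ v) := by
        rw [hB, ← Matrix.mulVec_mulVec, Matrix.mulVec_transpose, ← Matrix.dotProduct_mulVec]
      rw [this, dotProduct]
      push_cast
      exact Finset.sum_congr rfl fun i _ => by ring
    rw [← h3, mul_assoc]
    rw [hc2, Complex.real_smul] at h2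
    convert h2 using 1
    · congr 1
      funext v
      congr 1
      rw [he, hcv, hq]
      change Complex.I * (τ.ofLp ⬝ᵥ fun i => (v i : ℂ)) - _ = _
      ring
    · congr 3
      ring

end

section

variable {d : ℕ} {C : Matrix (Fin d) (Fin d) ℂ}

/-! ### Rotations -/

/-- The real linear map that corresponds to the multiplication by `exp (i t)` on `ℂ ^ d`. -/
def rotL (d : ℕ) (t : ℝ) : EuclideanSpace ℝ (Fin d) × EuclideanSpace ℝ (Fin d) →L[ℝ]
    EuclideanSpace ℝ (Fin d) × EuclideanSpace ℝ (Fin d) :=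
  ContinuousLinearMap.prod
    (Real.cos t • ContinuousLinearMap.fst ℝ _ _ - Real.sin t • ContinuousLinearMap.snd ℝ _ _)
    (Real.sin t • ContinuousLinearMap.fst ℝ _ _ + Real.cos t • ContinuousLinearMap.snd ℝ _ _)

theorem toC_rotL (t : ℝ) (p : EuclideanSpace ℝ (Fin d) × EuclideanSpace ℝ (Fin d)) :
    toC (rotL d t p) = Complex.exp (t * Complex.I) • toC p := by
  ext i
  rw [PiLp.smul_apply, smul_eq_mul, toC_apply, toC_apply, Complex.exp_mul_I]
  simp only [rotL, ContinuousLinearMap.prod_apply, sub_apply,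
    add_apply, smul_apply, ContinuousLinearMap.coe_fst',
    ContinuousLinearMap.coe_snd', PiLp.sub_apply, PiLp.add_apply, PiLp.smul_apply, smul_eq_mul]
  push_cast
  linear_combination (-Complex.sin t * p.2 i) * Complex.I_sq

theorem toC_injective : Function.Injective (toC (d := d)) := fun p q h => by
  rw [← Prod.mk.eta (p := p), ← Prod.mk.eta (p := q), ← rev_toC p, ← imv_toC p, h, rev_toC, imv_toC]

theorem rotL_neg_rotL (t : ℝ) (p : EuclideanSpace ℝ (Fin d) × EuclideanSpace ℝ (Fin d)) :
    rotL d (-t) (rotL d t p) = p := by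
  refine toC_injective ?_
  rw [toC_rotL, toC_rotL, smul_smul, ← Complex.exp_add]
  simp

/-- The invertible version of `rotL`. -/
def rotE (d : ℕ) (t : ℝ) : (EuclideanSpace ℝ (Fin d) × EuclideanSpace ℝ (Fin d)) ≃L[ℝ]
    EuclideanSpace ℝ (Fin d) × EuclideanSpace ℝ (Fin d) :=
  ContinuousLinearEquiv.equivOfInverse (rotL d t) (rotL d (-t)) (rotL_neg_rotL t)
    fun p => by simpa using rotL_neg_rotL (-t) p

theorem norm_toC_rotL (t : ℝ) (p : EuclideanSpace ℝ (Fin d) × EuclideanSpace ℝ (Fin d)) :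
    ‖toC (rotL d t p)‖ = ‖toC p‖ := by
  rw [toC_rotL, norm_smul, Complex.norm_exp_ofReal_mul_I, one_mul]

/-- The Jacobian factor is found by testing on a rotation-invariant Gaussian, whose integral is
positive, instead of evaluating the determinant. -/
theorem integral_comp_rotL (t : ℝ)
    (g : EuclideanSpace ℝ (Fin d) × EuclideanSpace ℝ (Fin d) → ℂ) :
    ∫ p, g (rotL d t p) = ∫ p, g p := by
  have : (volume : Measure (EuclideanSpace ℝ (Fin d) × EuclideanSpace ℝ (Fin d))).IsAddHaarMeasure :=
    Measure.prod.instIsAddHaarMeasure volume volume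
  have h1 := integral_comp_continuousLinearEquiv volume (rotE d t) g
  have h2 := integral_comp_continuousLinearEquiv volume (rotE d t)
    (fun p => Real.exp (-1 * ‖toC p‖ ^ (1 / (1 / 2 : ℝ))))
  have h3 : ∀ p, rotE d t p = rotL d t p := fun p => rfl
  simp only [h3] at h1 h2
  simp only [norm_toC_rotL, smul_eq_mul] at h2
  have h4 := integral_exp_pos (integrable_exp_neg_norm_toC (d := d) le_rfl
    (by norm_num : (1 / 2 : ℝ) < 1) one_pos)
  rw [h1]
  rw [eq_comm, mul_eq_right₀ h4.ne'] at h2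
  rw [h2, one_smul]

/-- The mean value property for a weight on `ℂ ^ d` that is invariant under rotations. -/
theorem integral_mul_of_rotation_invariant {θ : ℝ} (hθ : 1 / 2 ≤ θ) (hθ' : θ < 1) {ε K : ℝ}
    (hε : 0 < ε) {H : EuclideanSpace ℂ (Fin d) → ℂ} (hH : Differentiable ℂ H)
    {ρ : EuclideanSpace ℝ (Fin d) × EuclideanSpace ℝ (Fin d) → ℂ} (hρ : Continuous ρ)
    (hρr : ∀ t p, ρ (rotL d t p) = ρ p)
    (hb : ∀ p, ‖H (toC p) * ρ p‖ ≤ K * Real.exp (-ε * ‖toC p‖ ^ (1 / θ))) :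
    ∫ p, H (toC p) * ρ p = H 0 * ∫ p, ρ p := by
  -- The integral is averaged over the rotations e^{it}. By Fubini, for each p there appears the
  -- circle average of the entire function z ↦ H(z · toC p), which is H(0).
  let F : ℝ → EuclideanSpace ℝ (Fin d) × EuclideanSpace ℝ (Fin d) → ℂ := fun t p =>
    H (Complex.exp (t * Complex.I) • toC p) * ρ p
  have hF : ∀ t p, F t p = H (toC (rotL d t p)) * ρ (rotL d t p) := fun t p => by
    rw [hρr, toC_rotL]
  have hFc : Continuous (Function.uncurry F) := by
    have h1 : Continuous fun q : ℝ × (EuclideanSpace ℝ (Fin d) × EuclideanSpace ℝ (Fin d)) =>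
        Complex.exp (q.1 * Complex.I) • toC q.2 :=
      Continuous.smul (f := fun q : ℝ × (EuclideanSpace ℝ (Fin d) × EuclideanSpace ℝ (Fin d)) =>
        Complex.exp (q.1 * Complex.I)) (by fun_prop) (continuous_toC.comp continuous_snd)
    exact (hH.continuous.comp h1).mul (hρ.comp continuous_snd)
  have hFi : Integrable (Function.uncurry F)
      ((volume.restrict (Set.Ioc 0 (2 * Real.pi))).prod volume) := by
    refine (((integrable_exp_neg_norm_toC (d := d) hθ hθ' hε).const_mul K).comp_snd
      (volume.restrict (Set.Ioc 0 (2 * Real.pi)))).mono' hFc.aestronglyMeasurable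
      (Filter.Eventually.of_forall fun q => ?_)
    change ‖F q.1 q.2‖ ≤ _
    rw [hF]
    refine (hb _).trans_eq ?_
    rw [norm_toC_rotL]
  have hswap := integral_integral_swap hFi
  have h1 : ∀ t, ∫ p, F t p = ∫ p, H (toC p) * ρ p := fun t => by
    simp only [hF]
    exact integral_comp_rotL t fun p => H (toC p) * ρ p
  have h2 : ∀ p, ∫ t in Set.Ioc 0 (2 * Real.pi), F t p = 2 * Real.pi * (H 0 * ρ p) := by
    intro p
    have hd : Differentiable ℂ fun z : ℂ => H (z • toC p) := hH.comp (by fun_prop)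
    have h3 := (hd.diffContOnCl (s := Metric.ball 0 |1|)).circleAverage
    rw [Real.circleAverage_def, intervalIntegral.integral_of_le Real.two_pi_pos.le] at h3
    simp only [circleMap_zero, Complex.ofReal_one, one_mul, zero_smul] at h3
    have h4 : ∫ t in Set.Ioc 0 (2 * Real.pi), F t p =
        (∫ t : ℝ in Set.Ioc 0 (2 * Real.pi), H (Complex.exp (t * Complex.I) • toC p)) * ρ p :=
      integral_mul_const _ _
    rw [h4, ← h3, Complex.real_smul]
    generalize (∫ t : ℝ in Set.Ioc 0 (2 * Real.pi), H (Complex.exp (t * Complex.I) • toC p)) = J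
    have : (Real.pi : ℂ) ≠ 0 := by exact_mod_cast Real.pi_ne_zero
    push_cast
    field_simp
  simp only [h1, h2] at hswap
  rw [integral_const_mul, integral_const_mul, setIntegral_const, Real.volume_real_Ioc_of_le Real.two_pi_pos.le, sub_zero,
    Complex.real_smul] at hswap
  push_cast at hswap
  refine mul_left_cancel₀ (a := (2 * Real.pi : ℂ)) ?_ hswap
  exact_mod_cast Real.two_pi_pos.ne'

/-! ### The reproducing formula -/

/-- In the product with the conjugate packet the quadratic parts combine to (i/2)(C - C̄) = -S, so
the pairing is a real Gaussian integral with frequency χ - ζ̄. -/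
theorem coeff_gker (hC : (C.map Complex.im).PosDef) :
    ∃ κ : ℂ, κ ≠ 0 ∧ ∀ χ ζ : EuclideanSpace ℂ (Fin d), coeff C (gker C χ ∘ incl) ζ =
      κ * Complex.exp (-(1 / 4) * sinv (C.map Complex.im) (χ + reflv ζ) (χ + reflv ζ)) := by
  obtain ⟨κ, hκ, H⟩ := exists_integral_gaussian hC
  refine ⟨κ, hκ, fun χ ζ => ?_⟩
  rw [← H, coeff]
  congr 1
  funext y
  rw [Function.comp_apply, gker, gker, ← Complex.exp_add]
  congr 1
  have h1 : (conjC C *ᵥ (incl y).ofLp) ⬝ᵥ (incl y).ofLp =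
      -(starRingEnd ℂ) ((C *ᵥ (incl y).ofLp) ⬝ᵥ (incl y).ofLp) := by
    simp [conjC, dotProduct, Matrix.mulVec, FBIPhase.incl_apply]
  have h2 := Complex.sub_conj ((C *ᵥ (incl y).ofLp) ⬝ᵥ (incl y).ofLp)
  rw [im_quad_incl] at h2
  rw [h1, WithLp.ofLp_add, add_dotProduct]
  push_cast at h2
  linear_combination (Complex.I / 2) * h2 +
    ((((C.map Complex.im) *ᵥ y.ofLp) ⬝ᵥ y.ofLp : ℝ) : ℂ) * Complex.I_sq

/-- Since ζ - ζ̄ = 2i Im ζ, the weight takes the same bilinear form as the exponent in `coeff_gker`,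
and the two can be combined. -/
theorem two_mul_wt_imv (S : Matrix (Fin d) (Fin d) ℝ) (ζ : EuclideanSpace ℂ (Fin d)) :
    ((2 * wt S (imv ζ) : ℝ) : ℂ) = -(1 / 4) * sinv S (ζ + reflv ζ) (ζ + reflv ζ) := by
  have h : ζ + reflv ζ = (2 * Complex.I) • incl (imv ζ) := by
    ext i
    simp only [PiLp.add_apply, PiLp.smul_apply, reflv_apply, FBIPhase.incl_apply, imv_apply,
      smul_eq_mul]
    rw [← sub_eq_add_neg, Complex.sub_conj]
    push_cast
    ring
  rw [h, sinv_smul_left, sinv_smul_right, sinv_incl]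
  linear_combination ((2 * wt S (imv ζ) : ℝ) : ℂ) * Complex.I_sq

theorem reflv_add (ζ χ : EuclideanSpace ℂ (Fin d)) : reflv (ζ + χ) = reflv ζ + reflv χ := by
  ext i
  simp [reflv_apply]
  ring

theorem reflv_smul (c : ℂ) (ζ : EuclideanSpace ℂ (Fin d)) :
    reflv (c • ζ) = (starRingEnd ℂ) c • reflv ζ := by
  ext i
  simp [reflv_apply]

/-- The form ⟨S⁻¹(-ζ̄), ζ⟩ is real and negative definite, so the exponential of its half is a
positive Gaussian with nonzero integral. -/
theorem sinv_reflv_toC {S : Matrix (Fin d) (Fin d) ℝ} (hS : S.PosDef)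
    (p : EuclideanSpace ℝ (Fin d) × EuclideanSpace ℝ (Fin d)) :
    sinv S (reflv (toC p)) (toC p) = ((-2 * wt S p.1 - 2 * wt S p.2 : ℝ) : ℂ) := by
  have h1 : reflv (toC p) = (-1 : ℂ) • incl p.1 + Complex.I • incl p.2 := by
    ext i
    simp [reflv_apply, toC_apply, FBIPhase.incl_apply]
    ring
  have h2 := sinv_incl S p.1
  have h3 := sinv_incl S p.2
  have h4 := sinv_comm hS (incl p.1) (incl p.2)
  rw [h1, toC]
  simp only [sinv_add_left, sinv_add_right, sinv_smul_left, sinv_smul_right, h2, h3, h4]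
  push_cast
  linear_combination (2 * wt S p.2 : ℂ) * Complex.I_sq

theorem continuous_sinv (S : Matrix (Fin d) (Fin d) ℝ) {X : Type*} [TopologicalSpace X]
    {f g : X → EuclideanSpace ℂ (Fin d)} (hf : Continuous f) (hg : Continuous g) :
    Continuous fun x => sinv S (f x) (g x) := by
  unfold sinv dotProduct Matrix.mulVec dotProduct
  fun_prop

/-- The peaks e^{wt} of W and of the coefficient cancel e^{-2wt}. The arbitrarily small growth rate
of W is taken as half the decay rate of the coefficient. -/
theorem exists_norm_mul_coeff_le (hC : (C.map Complex.im).PosDef) {θ : ℝ} (hθ : 1 / 2 ≤ θ)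
    (hθ' : θ < 1) {W : EuclideanSpace ℂ (Fin d) → ℂ}
    (hWb : ∀ ε > 0, ∃ K, ∀ ζ, ‖W ζ‖ ≤
      K * Real.exp (wt (C.map Complex.im) (imv ζ) + ε * ‖ζ‖ ^ (1 / θ))) {h : ℝ} (hh : 0 < h) :
    ∃ ε > 0, ∃ K ≥ 0, ∀ (f : EuclideanSpace ℝ (Fin d) → ℂ) (M : ℝ), ContDiff ℝ ∞ f →
      NormLE θ h M f → ∀ p, ‖W (toC p) *
        (coeff C f (toC p) * Real.exp (-2 * wt (C.map Complex.im) p.2))‖ ≤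
          K * M * Real.exp (-ε * ‖toC p‖ ^ (1 / θ)) := by
  set S := C.map Complex.im with hS
  obtain ⟨ε, hε, K, hK, HK⟩ := exists_norm_coeff_le hC hθ hθ' hh
  obtain ⟨K', HK'⟩ := hWb (ε / 2) (half_pos hε)
  have hK'0 : 0 ≤ K' := nonneg_of_mul_nonneg_left ((norm_nonneg _).trans (HK' 0)) (Real.exp_pos _)
  refine ⟨ε / 2, half_pos hε, K' * K, by positivity, fun f M hf hM p => ?_⟩
  have hM0 := hM.nonneg
  have h1 := HK f M hf hM (toC p)
  have h2 := HK' (toC p)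
  rw [imv_toC] at h1 h2
  rw [norm_mul, norm_mul, Complex.norm_real, Real.norm_of_nonneg (Real.exp_nonneg _)]
  calc _ ≤ K' * Real.exp (wt S p.2 + ε / 2 * ‖toC p‖ ^ (1 / θ)) *
        (K * M * Real.exp (wt S p.2 - ε * ‖toC p‖ ^ (1 / θ)) * Real.exp (-2 * wt S p.2)) := by
        gcongr
    _ = K' * K * M * (Real.exp (wt S p.2 + ε / 2 * ‖toC p‖ ^ (1 / θ)) *
        Real.exp (wt S p.2 - ε * ‖toC p‖ ^ (1 / θ)) * Real.exp (-2 * wt S p.2)) := by ring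
    _ = _ := by
        rw [← Real.exp_add, ← Real.exp_add]
        ring_nf

/-- After translation by χ the integrand is κ H(ζ) ρ(ζ) with H entire, H(0) = W(χ), and ρ the
exponential of the Hermitian form ½⟨S⁻¹(-ζ̄), ζ⟩, which is rotation invariant. The mean value
property does the rest. -/
theorem exists_reproducing (hC : (C.map Complex.im).PosDef) {θ : ℝ} (hθ : 1 / 2 ≤ θ)
    (hθ' : θ < 1) : ∃ c : ℂ, c ≠ 0 ∧ ∀ W : EuclideanSpace ℂ (Fin d) → ℂ, Differentiable ℂ W →
      (∀ ε > 0, ∃ K, ∀ ζ, ‖W ζ‖ ≤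
        K * Real.exp (wt (C.map Complex.im) (imv ζ) + ε * ‖ζ‖ ^ (1 / θ))) →
      ∀ χ, ∫ p : EuclideanSpace ℝ (Fin d) × EuclideanSpace ℝ (Fin d), W (toC p) *
        (coeff C (gker C χ ∘ incl) (toC p) * Real.exp (-2 * wt (C.map Complex.im) p.2)) =
          c * W χ := by
  obtain ⟨κ, hκ, Hκ⟩ := coeff_gker hC
  set S := C.map Complex.im with hS
  let ρ : EuclideanSpace ℝ (Fin d) × EuclideanSpace ℝ (Fin d) → ℂ := fun p =>
    Complex.exp ((1 / 2) * sinv S (reflv (toC p)) (toC p))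
  have hρ0 : ∫ p, ρ p ≠ 0 := by
    have e : ∀ p, ρ p = ((Real.exp (-1 * wt S p.1) * Real.exp (-1 * wt S p.2) : ℝ) : ℂ) := by
      intro p
      simp only [ρ]
      rw [sinv_reflv_toC hC, ← Real.exp_add, Complex.ofReal_exp]
      congr 1
      push_cast
      ring
    simp only [e]
    rw [integral_complex_ofReal]
    have h1 := integral_prod_mul (μ := (volume : Measure (EuclideanSpace ℝ (Fin d))))
      (ν := (volume : Measure (EuclideanSpace ℝ (Fin d)))) (fun η => Real.exp (-1 * wt S η))
      (fun η => Real.exp (-1 * wt S η))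
    have h2 := integral_exp_pos (integrable_exp_neg_wt hC one_pos)
    have h3 : (volume : Measure (EuclideanSpace ℝ (Fin d) × EuclideanSpace ℝ (Fin d))) =
      volume.prod volume := rfl
    rw [h3, h1]
    exact_mod_cast (mul_pos h2 h2).ne'
  refine ⟨κ * ∫ p, ρ p, mul_ne_zero hκ hρ0, fun W hW hWb χ => ?_⟩
  let q : EuclideanSpace ℝ (Fin d) × EuclideanSpace ℝ (Fin d) := (rev χ, imv χ)
  have hq : toC q = χ := toC_rev_imv χ
  have htr : ∀ p, toC (p + q) = toC p + χ := fun p => by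
    rw [← hq]; ext i; simp [toC_apply]; ring
  let G : EuclideanSpace ℝ (Fin d) × EuclideanSpace ℝ (Fin d) → ℂ := fun p => W (toC p) *
    (coeff C (gker C χ ∘ incl) (toC p) * Real.exp (-2 * wt S p.2))
  let H : EuclideanSpace ℂ (Fin d) → ℂ := fun ζ => W (ζ + χ) *
    Complex.exp ((1 / 2) * sinv S (χ + reflv χ) ζ + (1 / 4) * sinv S ζ ζ)
  have hG : ∀ p, G (p + q) = κ * (H (toC p) * ρ p) := by
    intro p
    simp only [G, H, ρ]
    have h1 := two_mul_wt_imv S (toC (p + q))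
    rw [imv_toC] at h1
    rw [Hκ, Complex.ofReal_exp, show (-2 * wt S (p + q).2 : ℝ) = -(2 * wt S (p + q).2) by ring,
      Complex.ofReal_neg, h1, htr, reflv_add]
    set ζ := toC p
    -- The exponent is a quarter of the difference of the squares of ζ + v and v, with v = χ - ζ̄ -
    -- χ̄. The terms quadratic in ζ̄ cancel, and ζ̄ survives only in the Hermitian cross term that
    -- defines ρ.
    have h2 : Complex.exp (-(1 / 4) * sinv S (χ + (reflv ζ + reflv χ)) (χ + (reflv ζ + reflv χ))) *
        Complex.exp (-(-(1 / 4) * sinv S (ζ + χ + (reflv ζ + reflv χ))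
          (ζ + χ + (reflv ζ + reflv χ)))) =
        Complex.exp ((1 / 2) * sinv S (χ + reflv χ) ζ + (1 / 4) * sinv S ζ ζ) *
          Complex.exp ((1 / 2) * sinv S (reflv ζ) ζ) := by
      rw [← Complex.exp_add, ← Complex.exp_add]
      congr 1
      simp only [sinv_add_left, sinv_add_right]
      rw [sinv_comm hC ζ χ, sinv_comm hC ζ (reflv χ), sinv_comm hC ζ (reflv ζ)]
      ring
    linear_combination W (ζ + χ) * κ * h2
  have hHd : Differentiable ℂ H := by
    have : Differentiable ℂ fun ζ : EuclideanSpace ℂ (Fin d) =>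
        Complex.exp ((1 / 2) * sinv S (χ + reflv χ) ζ + (1 / 4) * sinv S ζ ζ) := by
      unfold sinv dotProduct Matrix.mulVec dotProduct
      fun_prop
    exact (hW.comp (by fun_prop)).mul this
  have hρc : Continuous ρ := by
    have := continuous_sinv S (continuous_reflv.comp (continuous_toC (d := d))) continuous_toC
    simp only [Function.comp_def] at this
    fun_prop
  have hρr : ∀ t p, ρ (rotL d t p) = ρ p := by
    intro t p
    simp only [ρ]
    rw [toC_rotL, reflv_smul, sinv_smul_left, sinv_smul_right, ← mul_assoc ((starRingEnd ℂ) _),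
      ← Complex.normSq_eq_conj_mul_self, Complex.normSq_eq_norm_sq, Complex.norm_exp_ofReal_mul_I]
    simp
  obtain ⟨hf, h, hh, M, hM⟩ := gker_mem_space hC hθ hθ' χ
  obtain ⟨ε, hε, K, hK, HK⟩ := exists_norm_mul_coeff_le hC hθ hθ' hWb hh
  have hM0 := hM.nonneg
  have hGb : ∀ p, ‖G p‖ ≤ K * M * Real.exp (-ε * ‖toC p‖ ^ (1 / θ)) := HK _ M hf hM
  have hb : ∀ p, ‖H (toC p) * ρ p‖ ≤ ‖κ‖⁻¹ * (K * M *
      Real.exp (ε * ‖χ‖ ^ (1 / θ))) * Real.exp (-(ε / 4) * ‖toC p‖ ^ (1 / θ)) := by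
    intro p
    have h1 : H (toC p) * ρ p = κ⁻¹ * G (p + q) := by
      rw [hG, inv_mul_cancel_left₀ hκ]
    rw [h1, norm_mul, norm_inv, mul_assoc, mul_assoc (K * M), ← Real.exp_add]
    refine mul_le_mul_of_nonneg_left ((hGb _).trans ?_) (by positivity)
    refine mul_le_mul_of_nonneg_left (Real.exp_le_exp.2 ?_) (by positivity)
    have h2 := norm_add_rpow_le hθ (toC p + χ) (-χ)
    rw [add_neg_cancel_right, norm_neg] at h2
    rw [htr]
    nlinarith
  have key := integral_mul_of_rotation_invariant hθ hθ' (show 0 < ε / 4 by positivity) hHd hρc hρr hb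
  have : (volume : Measure (EuclideanSpace ℝ (Fin d) × EuclideanSpace ℝ (Fin d))).IsAddHaarMeasure :=
    Measure.prod.instIsAddHaarMeasure volume volume
  have h1 := integral_add_right_eq_self (μ := volume) G q
  simp only [hG] at h1
  rw [integral_const_mul, key] at h1
  change ∫ p, G p = _
  rw [← h1]
  simp [H, sinv]
  ring

end

section

/-! ### Synthesis -/

section Synthesis

variable {d : ℕ} {C : Matrix (Fin d) (Fin d) ℂ}

theorem coeff_eq (hC : (C.map Complex.im).PosDef) {θ : ℝ} (hθ : 1 / 2 ≤ θ) (hθ' : θ < 1)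
    (f : Space d θ) (ζ : EuclideanSpace ℂ (Fin d)) :
    coeff C f.1 ζ = (Space.toDual f).1 (packet (posDef_conjC hC) hθ hθ' (reflv ζ)) := rfl

theorem toDual_comm {θ : ℝ} (f g : Space d θ) : (Space.toDual f).1 g = (Space.toDual g).1 f :=
  integral_congr_ae (Filter.Eventually.of_forall fun y => mul_comm (f.1 y) (g.1 y))

theorem coeff_add (hC : (C.map Complex.im).PosDef) {θ : ℝ} (hθ : 1 / 2 ≤ θ) (hθ' : θ < 1)
    (f g : Space d θ) (ζ : EuclideanSpace ℂ (Fin d)) :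
    coeff C (f + g).1 ζ = coeff C f.1 ζ + coeff C g.1 ζ := by
  simp only [coeff_eq hC hθ hθ', toDual_comm _ (packet _ _ _ _), map_add]

theorem coeff_smul (hC : (C.map Complex.im).PosDef) {θ : ℝ} (hθ : 1 / 2 ≤ θ) (hθ' : θ < 1)
    (c : ℂ) (f : Space d θ) (ζ : EuclideanSpace ℂ (Fin d)) :
    coeff C (c • f).1 ζ = c * coeff C f.1 ζ := by
  simp only [coeff_eq hC hθ hθ', toDual_comm _ (packet _ _ _ _), map_smul, smul_eq_mul]

theorem continuous_ofReal_exp_wt (S : Matrix (Fin d) (Fin d) ℝ) :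
    Continuous fun p : EuclideanSpace ℝ (Fin d) × EuclideanSpace ℝ (Fin d) =>
      ((Real.exp (-2 * wt S p.2) : ℝ) : ℂ) := by
  have := (continuous_wt S).comp (continuous_snd (X := EuclideanSpace ℝ (Fin d)))
  simp only [Function.comp_def] at this
  fun_prop

/-- The superposition of the conjugate wave packets with the density `W`, as a functional. -/
theorem exists_dual_of_growth (hC : (C.map Complex.im).PosDef) {θ : ℝ} (hθ : 1 / 2 ≤ θ)
    (hθ' : θ < 1) {W : EuclideanSpace ℂ (Fin d) → ℂ} (hW : Continuous W)
    (hWb : ∀ ε > 0, ∃ K, ∀ ζ, ‖W ζ‖ ≤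
      K * Real.exp (wt (C.map Complex.im) (imv ζ) + ε * ‖ζ‖ ^ (1 / θ))) :
    ∃ u : Dual d θ, ∀ f : Space d θ, u.1 f =
      ∫ p : EuclideanSpace ℝ (Fin d) × EuclideanSpace ℝ (Fin d), W (toC p) *
        (coeff C f.1 (toC p) * Real.exp (-2 * wt (C.map Complex.im) p.2)) := by
  have hint : ∀ f : Space d θ, Integrable fun p : EuclideanSpace ℝ (Fin d) ×
      EuclideanSpace ℝ (Fin d) => W (toC p) *
        (coeff C f.1 (toC p) * Real.exp (-2 * wt (C.map Complex.im) p.2)) := by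
    intro f
    obtain ⟨hf, h, hh, M, hM⟩ := f.2
    obtain ⟨ε, hε, K, hK, HK⟩ := exists_norm_mul_coeff_le hC hθ hθ' hWb hh
    exact ((integrable_exp_neg_norm_toC hθ hθ' hε).const_mul (K * M)).mono'
      ((hW.comp continuous_toC).aestronglyMeasurable.mul
        ((aestronglyMeasurable_coeff hf.continuous).mul
          (continuous_ofReal_exp_wt _).aestronglyMeasurable))
      (Filter.Eventually.of_forall (HK f.1 M hf hM))
  let u : Module.Dual ℂ (Space d θ) :=
    { toFun := fun f => ∫ p : EuclideanSpace ℝ (Fin d) × EuclideanSpace ℝ (Fin d), W (toC p) *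
        (coeff C f.1 (toC p) * Real.exp (-2 * wt (C.map Complex.im) p.2))
      map_add' := fun f g => by
        rw [← integral_add (hint f) (hint g)]
        congr 1
        funext p
        rw [coeff_add hC hθ hθ']
        ring
      map_smul' := fun c f => by
        rw [RingHom.id_apply, smul_eq_mul, ← integral_const_mul]
        congr 1
        funext p
        rw [coeff_smul hC hθ hθ']
        ring }
  refine ⟨⟨u, fun h hh => ?_⟩, fun f => rfl⟩
  obtain ⟨ε, hε, K, hK, HK⟩ := exists_norm_mul_coeff_le hC hθ hθ' hWb hh
  refine ⟨K * ∫ p : EuclideanSpace ℝ (Fin d) × EuclideanSpace ℝ (Fin d),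
    Real.exp (-ε * ‖toC p‖ ^ (1 / θ)), fun f M hM => ?_⟩
  have h1 := norm_integral_le_of_norm_le
    ((integrable_exp_neg_norm_toC (d := d) hθ hθ' hε).const_mul (K * M))
    (Filter.Eventually.of_forall (HK f.1 M f.2.1 hM))
  rw [integral_const_mul] at h1
  exact h1.trans_eq (by ring)

theorem integral_comp_neg_fst (g : EuclideanSpace ℝ (Fin d) × EuclideanSpace ℝ (Fin d) → ℂ) :
    ∫ p : EuclideanSpace ℝ (Fin d) × EuclideanSpace ℝ (Fin d), g (-p.1, p.2) = ∫ p, g p := by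
  have h1 : MeasurePreserving (Prod.map (fun x : EuclideanSpace ℝ (Fin d) => -x)
      (id : EuclideanSpace ℝ (Fin d) → EuclideanSpace ℝ (Fin d)))
      (volume.prod volume) (volume.prod volume) :=
    (Measure.measurePreserving_neg volume).prod (MeasurePreserving.id volume)
  exact h1.integral_comp (((Homeomorph.neg (EuclideanSpace ℝ (Fin d))).prodCongr
    (Homeomorph.refl (EuclideanSpace ℝ (Fin d)))).measurableEmbedding) g

/-- For a decaying density the superposition of the conjugate wave packets is a function. -/
theorem exists_space_of_decay (hC : (C.map Complex.im).PosDef) {θ : ℝ} (hθ : 1 / 2 ≤ θ)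
    (hθ' : θ < 1) {W : EuclideanSpace ℂ (Fin d) → ℂ} (hW : Continuous W) {ε K : ℝ} (hε : 0 < ε)
    (hWb : ∀ ζ, ‖W ζ‖ ≤ K * Real.exp (wt (C.map Complex.im) (imv ζ) - ε * ‖ζ‖ ^ (1 / θ))) :
    ∃ f : Space d θ, ∀ g : Space d θ, (Space.toDual f).1 g =
      ∫ p : EuclideanSpace ℝ (Fin d) × EuclideanSpace ℝ (Fin d), W (toC p) *
        (coeff C g.1 (toC p) * Real.exp (-2 * wt (C.map Complex.im) p.2)) := by
  set S := C.map Complex.im with hS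
  -- W is reflected because the conjugate packet of ζ has frequency -ζ̄; integrating over the
  -- packets of `conjC C` at `toC p` thus calls for W at `reflv (toC p)`.
  let m : EuclideanSpace ℝ (Fin d) × EuclideanSpace ℝ (Fin d) → ℂ := fun p =>
    W (reflv (toC p)) * Real.exp (-2 * wt S p.2)
  have hm : AEStronglyMeasurable m :=
    ((hW.comp (continuous_reflv.comp continuous_toC)).mul
      (continuous_ofReal_exp_wt S)).aestronglyMeasurable
  have hmb : ∀ p, ‖m p‖ ≤ K * Real.exp (-wt ((conjC C).map Complex.im) p.2 -
      ε * ‖toC p‖ ^ (1 / θ)) := by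
    intro p
    have h1 := hWb (reflv (toC p))
    rw [imv_reflv, norm_reflv, imv_toC] at h1
    rw [conjC_im, ← hS, norm_mul, Complex.norm_real, Real.norm_of_nonneg (Real.exp_nonneg _)]
    calc _ ≤ K * Real.exp (wt S p.2 - ε * ‖toC p‖ ^ (1 / θ)) * Real.exp (-2 * wt S p.2) := by
          gcongr
      _ = _ := by
          rw [mul_assoc, ← Real.exp_add]
          ring_nf
  refine ⟨⟨_, superposition_mem_space (posDef_conjC hC) hθ hθ' hε hm hmb⟩, fun g => ?_⟩
  -- By symmetry of the pairing g acts as the functional on the superposition and commutes with the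
  -- integral; the substitution ξ ↦ -ξ undoes the reflection.
  rw [toDual_comm, dual_superposition (posDef_conjC hC) hθ hθ' hε hm hmb, ← integral_comp_neg_fst]
  congr 1
  funext p
  simp only [m]
  simp only [coeff_eq hC hθ hθ', reflv_toC, neg_neg]
  ring

end Synthesis

/-! ### Surjectivity of the transform -/

section Surjectivity

variable {d : ℕ} (φ : FBIPhase d) {U : EuclideanSpace ℂ (Fin d) → ℂ}

/-- The entire function `W` with `U z = hol φ z * W (freq φ z)`. -/
def density (U : EuclideanSpace ℂ (Fin d) → ℂ) (ζ : EuclideanSpace ℂ (Fin d)) : ℂ :=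
  U (freqInv φ ζ) / hol φ (freqInv φ ζ)

theorem hol_mul_density (z : EuclideanSpace ℂ (Fin d)) :
    hol φ z * density φ U (freq φ z) = U z := by
  rw [density, freqInv_freq, mul_div_cancel₀ _ (hol_ne_zero φ z)]

theorem differentiable_density (hU : Differentiable ℂ U) : Differentiable ℂ (density φ U) := by
  have h1 := hU.comp (differentiable_freqInv φ)
  have h2 := (differentiable_hol φ).comp (differentiable_freqInv φ)
  have h3 := h1.mul (h2.inv fun ζ => hol_ne_zero φ (freqInv φ ζ))
  exact h3

/-- Dividing by |hol| strips Φ down to `wt`, in accordance with `norm_hol_mul_exp`. -/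
theorem norm_density_le {K t : ℝ} {ζ : EuclideanSpace ℂ (Fin d)}
    (h : ‖U (freqInv φ ζ)‖ ≤ K * Real.exp (t + φ.weight (freqInv φ ζ))) :
    ‖density φ U ζ‖ ≤ K * Real.exp (wt (φ.C.map Complex.im) (imv ζ) + t) := by
  rw [← norm_hol_mul_exp, freq_freqInv] at h
  rw [density, norm_div, div_le_iff₀ (norm_pos_iff.2 (hol_ne_zero φ _))]
  linarith

theorem exists_norm_density_le_of_growthEstimate {θ : ℝ} (hθ : 1 / 2 ≤ θ)
    (hU : φ.GrowthEstimate θ U) {ε : ℝ} (hε : 0 < ε) : ∃ K, ∀ ζ, ‖density φ U ζ‖ ≤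
      K * Real.exp (wt (φ.C.map Complex.im) (imv ζ) + ε * ‖ζ‖ ^ (1 / θ)) := by
  have hp : 0 ≤ 1 / θ := by positivity
  obtain ⟨R, hR, HR⟩ := exists_norm_freqInv_le φ
  obtain ⟨K, hK, HK⟩ := hU (ε / (R + 1) ^ (1 / θ)) (by positivity)
  refine ⟨K, fun ζ => ?_⟩
  have h1 := HK 0 (freqInv φ ζ)
  rw [mderiv_zero, mlen_zero, mfact_zero, Real.one_rpow, zero_add, pow_one, mul_one] at h1
  refine (norm_density_le φ h1).trans ?_
  refine mul_le_mul_of_nonneg_left (Real.exp_le_exp.2 (add_le_add_right ?_ _)) hK.le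
  have h2 : ‖freqInv φ ζ‖ ^ (1 / θ) ≤ (R + 1) ^ (1 / θ) * ‖ζ‖ ^ (1 / θ) := by
    rw [← Real.mul_rpow (by positivity) (norm_nonneg _)]
    have := HR ζ
    gcongr
    nlinarith [norm_nonneg ζ]
  rw [div_mul_eq_mul_div, div_le_iff₀ (by positivity)]
  nlinarith

theorem exists_norm_density_le_of_decayEstimate {θ : ℝ} (hθ : 1 / 2 ≤ θ)
    (hU : φ.DecayEstimate θ U) : ∃ ε > 0, ∃ K, 0 ≤ K ∧ ∀ ζ, ‖density φ U ζ‖ ≤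
      K * Real.exp (wt (φ.C.map Complex.im) (imv ζ) - ε * ‖ζ‖ ^ (1 / θ)) := by
  have hp : 0 ≤ 1 / θ := by positivity
  obtain ⟨R, hR, HR⟩ := exists_norm_freq_le φ
  obtain ⟨ε, hε, K, hK, HK⟩ := hU
  refine ⟨ε / (R + 1) ^ (1 / θ), by positivity, K, hK.le, fun ζ => ?_⟩
  have h1 := HK 0 (freqInv φ ζ)
  rw [mderiv_zero, mlen_zero, mfact_zero, Real.one_rpow, zero_add, pow_one, mul_one] at h1
  refine (norm_density_le φ h1).trans ?_
  rw [sub_eq_add_neg]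
  gcongr
  have h2 : ‖ζ‖ ^ (1 / θ) ≤ (R + 1) ^ (1 / θ) * ‖freqInv φ ζ‖ ^ (1 / θ) := by
    rw [← Real.mul_rpow (by positivity) (norm_nonneg _)]
    have := HR (freqInv φ ζ)
    rw [freq_freqInv] at this
    gcongr
    nlinarith [norm_nonneg (freqInv φ ζ)]
  have h3 : ε / (R + 1) ^ (1 / θ) * ‖ζ‖ ^ (1 / θ) ≤ ε * ‖freqInv φ ζ‖ ^ (1 / θ) := by
    rw [div_mul_eq_mul_div, div_le_iff₀ (by positivity)]
    nlinarith
  linarith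

theorem transform_injective {θ : ℝ} (hθ : 1 / 2 ≤ θ) (hθ' : θ < 1) :
    Function.Injective (φ.transform hθ) := by
  intro u v huv
  refine dual_ext_of_packet φ.posDef_C hθ hθ' fun ζ => ?_
  have h := congrFun huv (freqInv φ ζ)
  rw [transform_eq φ hθ hθ', transform_eq φ hθ hθ', freq_freqInv] at h
  have hc : (φ.const : ℂ) ≠ 0 := by exact_mod_cast (const_pos φ).ne'
  exact mul_left_cancel₀ (hol_ne_zero φ _) (mul_left_cancel₀ hc h)

/-- There is a constant `c` such that `U` is the transform of every functional that is the
superposition of the conjugate wave packets with the density `c * density φ U`. -/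
theorem exists_transform_eq {θ : ℝ} (hθ : 1 / 2 ≤ θ) (hθ' : θ < 1) : ∃ c : ℂ,
    ∀ U : EuclideanSpace ℂ (Fin d) → ℂ, Differentiable ℂ U →
      (∀ ε > 0, ∃ K, ∀ ζ, ‖density φ U ζ‖ ≤
        K * Real.exp (wt (φ.C.map Complex.im) (imv ζ) + ε * ‖ζ‖ ^ (1 / θ))) →
      ∀ u : Dual d θ, (∀ f : Space d θ, u.1 f =
        ∫ p : EuclideanSpace ℝ (Fin d) × EuclideanSpace ℝ (Fin d), (c * density φ U (toC p)) *
          (coeff φ.C f.1 (toC p) * Real.exp (-2 * wt (φ.C.map Complex.im) p.2))) →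
      U = φ.transform hθ u := by
  obtain ⟨c, hc, H⟩ := exists_reproducing φ.posDef_C hθ hθ'
  have hφ : (φ.const : ℂ) ≠ 0 := by exact_mod_cast (const_pos φ).ne'
  -- The normalization divides out both c_φ and the constant of the reproducing formula.
  refine ⟨(φ.const * c)⁻¹, fun U hU hUb u hu => funext fun z => ?_⟩
  have h1 := H _ (differentiable_density φ hU) hUb (freq φ z)
  have h2 := hu (packet φ.posDef_C hθ hθ' (freq φ z))
  simp only [mul_assoc ((φ.const * c : ℂ)⁻¹)] at h2
  rw [integral_const_mul] at h2
  have h3 : (packet φ.posDef_C hθ hθ' (freq φ z)).1 = gker φ.C (freq φ z) ∘ incl := rfl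
  rw [h3, h1] at h2
  rw [transform_eq φ hθ hθ', h2, ← hol_mul_density φ (U := U) z]
  field_simp

theorem norm_const_mul_le {c : ℂ} {W : EuclideanSpace ℂ (Fin d) → ℂ} {K : ℝ}
    {X : EuclideanSpace ℂ (Fin d) → ℝ} (h : ∀ ζ, ‖W ζ‖ ≤ K * X ζ) (ζ : EuclideanSpace ℂ (Fin d)) :
    ‖c * W ζ‖ ≤ ‖c‖ * K * X ζ := by
  rw [norm_mul, mul_assoc]
  exact mul_le_mul_of_nonneg_left (h ζ) (norm_nonneg c)

theorem exists_dual_transform_eq {θ : ℝ} (hθ : 1 / 2 ≤ θ) (hθ' : θ < 1) (hU : Differentiable ℂ U)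
    (hUb : φ.GrowthEstimate θ U) : ∃ u : Dual d θ, U = φ.transform hθ u := by
  obtain ⟨c, Hc⟩ := exists_transform_eq φ hθ hθ'
  have hb : ∀ ε > 0, ∃ K, ∀ ζ, ‖density φ U ζ‖ ≤
      K * Real.exp (wt (φ.C.map Complex.im) (imv ζ) + ε * ‖ζ‖ ^ (1 / θ)) := fun ε hε =>
    exists_norm_density_le_of_growthEstimate φ hθ hUb hε
  obtain ⟨u, hu⟩ := exists_dual_of_growth φ.posDef_C hθ hθ' (W := fun ζ => c * density φ U ζ)
    (continuous_const.mul (differentiable_density φ hU).continuous) fun ε hε => by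
      obtain ⟨K, HK⟩ := hb ε hε
      exact ⟨‖c‖ * K, norm_const_mul_le HK⟩
  exact ⟨u, Hc U hU hb u hu⟩

theorem exists_space_transform_eq {θ : ℝ} (hθ : 1 / 2 ≤ θ) (hθ' : θ < 1) (hU : Differentiable ℂ U)
    (hUb : φ.DecayEstimate θ U) : ∃ f : Space d θ, U = φ.transform hθ (Space.toDual f) := by
  obtain ⟨c, Hc⟩ := exists_transform_eq φ hθ hθ'
  obtain ⟨ε, hε, K, hK, HK⟩ := exists_norm_density_le_of_decayEstimate φ hθ hUb
  obtain ⟨f, hf⟩ := exists_space_of_decay φ.posDef_C hθ hθ' (W := fun ζ => c * density φ U ζ)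
    (continuous_const.mul (differentiable_density φ hU).continuous) hε (norm_const_mul_le HK)
  refine ⟨f, Hc U hU (fun ε' hε' => ⟨K, fun ζ => (HK ζ).trans ?_⟩) _ hf⟩
  have h1 : 0 ≤ ε * ‖ζ‖ ^ (1 / θ) := by positivity
  have h2 : 0 ≤ ε' * ‖ζ‖ ^ (1 / θ) := by positivity
  gcongr
  linarith

end Surjectivity

end

end GelfandShilov

end

/-! ### Characterization of the transforms of S_θ' and S_θ. -/

theorem mainTheorem3 (d : ℕ) (θ : ℝ) (hθ : 1 / 2 ≤ θ) (hθ' : θ < 1)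
    (φ : GelfandShilov.FBIPhase d) :
    (∀ u : GelfandShilov.Dual d θ,
      AnalyticOnNhd ℂ (φ.transform hθ u) Set.univ ∧ φ.GrowthEstimate θ (φ.transform hθ u)) ∧
    (∀ f : GelfandShilov.Space d θ,
      AnalyticOnNhd ℂ (φ.transform hθ (GelfandShilov.Space.toDual f)) Set.univ ∧
        φ.DecayEstimate θ (φ.transform hθ (GelfandShilov.Space.toDual f))) ∧
    (∀ U : EuclideanSpace ℂ (Fin d) → ℂ, AnalyticOnNhd ℂ U Set.univ → φ.GrowthEstimate θ U →
      ∃! u : GelfandShilov.Dual d θ, U = φ.transform hθ u) ∧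
    (∀ U : EuclideanSpace ℂ (Fin d) → ℂ, AnalyticOnNhd ℂ U Set.univ → φ.DecayEstimate θ U →
      ∃! f : GelfandShilov.Space d θ, U = φ.transform hθ (GelfandShilov.Space.toDual f)) := by
  refine ⟨fun u => ⟨?_, ?_⟩, fun f => ⟨?_, ?_⟩, fun U hU hUb => ?_, fun U hU hUb => ?_⟩
  · exact GelfandShilov.analyticOnNhd_of_differentiable
      (GelfandShilov.differentiable_transform φ hθ hθ' u)
  · exact GelfandShilov.growthEstimate_transform φ hθ hθ' u
  · exact GelfandShilov.analyticOnNhd_of_differentiable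
      (GelfandShilov.differentiable_transform φ hθ hθ' _)
  · exact GelfandShilov.decayEstimate_transform φ hθ hθ' f
  · have hd : Differentiable ℂ U := fun z => (hU z (Set.mem_univ z)).differentiableAt
    obtain ⟨u, hu⟩ := GelfandShilov.exists_dual_transform_eq φ hθ hθ' hd hUb
    exact ⟨u, hu, fun v hv => GelfandShilov.transform_injective φ hθ hθ' (hv.symm.trans hu)⟩
  · have hd : Differentiable ℂ U := fun z => (hU z (Set.mem_univ z)).differentiableAt
    obtain ⟨f, hf⟩ := GelfandShilov.exists_space_transform_eq φ hθ hθ' hd hUb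
    exact ⟨f, hf, fun g hg => GelfandShilov.toDual_injective φ.posDef_C hθ hθ'
      (GelfandShilov.transform_injective φ hθ hθ' (hg.symm.trans hf))⟩
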